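/- Conventions. A Markov chain $P$ over $[q]^n$ ($n\ge 1$) is given by an initial distribution $P_1$ on $[q]$ and Markov kernels $P_{k|k-1}$ on $[q]$, $2\le k\le n$; it is identified with its trajectory law $P(x_1,\dots,x_n)=P_1(x_1)\prod_{k=2}^{n}P_{k|k-1}(x_k\mid x_{k-1})$, and $\mathrm{TV}(P,Q)=\frac12\sum_{x\in[q]^n}|P(x)-Q(x)|$. Running time is the number of steps of a random access machine with exact real arithmetic, with finitely many registers and arrays for natural numbers and for real numbers, in which each elementary operation costs one step: $+,-,\times,/$ on reals, $+$ and truncated $-$ on naturals, conversion of a natural to a real number, comparison of two registers, loading a natural constant, indirect memory access; division of a real number by $0$ returns $0$. The input consists of $n$, $q$, $\varepsilon$ and the tables of the initial distributions and kernels of both chains. For finite distributions $p,p'$ let $(p\|p')$ denote the distribution of $p(X)/p'(X)$ for $X\sim p'$. For a finitely supported distribution $R$ on $[0,\infty)$ of mean at most $1$ let $\Delta(R)=\mathbb E_{r\sim R}[\max(1-r,0)]$, and let $R^\dagger$ be the distribution on $[0,\infty]$ with $R^\dagger(r)=rR(r)$ for $r<\infty$ and $R^\dagger(\infty)=1-\mathbb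 E_{r\sim R}[r]$. * $\mathsf{Concatenate}(p,p',(R_x)_{x\in[q]})$, for distributions $p,p'$ on $[q]$, is the mixture over $x\sim p'$ of the distributions of $\frac{p(x)}{p'(x)}\,r$, $r\sim R_x$. * $\mathsf{Sparsify}(R,\varepsilon_s,\delta_s)$: put $a_t=1-(1+\varepsilon_s)^{-t}$ and $\ell=\max\bigl(0,\lceil -\log\delta_s/\log(1+\varepsilon_s)\rceil\bigr)$ (with $\ell=0$ if $\delta_s=0$), and partition $[0,\infty]$ into $I_t=[a_t,a_{t+1})$ $(t<\ell)$, $I_\ell=[a_\ell,1)$, $\{1\}$, $J_\ell=(1,1/a_\ell]$, $J_t=(1/a_{t+1},1/a_t]$ $(t<\ell)$, where $1/a_0=\infty$. The result has, for each cell $I$ with $R(I)>0$, an atom of mass $R(I)$ at $R^\dagger(I)/R(I)$. Algorithm A. Let $D_k$ be the chain with law $Q_1Q_{2|1}\cdots Q_{k|k-1}P_{k+1|k}\cdots P_{n|n-1}$, $D_0=P$, $D_n=Q$, and let $d=\frac12\max_{1\le k\le n}\mathrm{TV}(D_{k-1},D_k)$, $\varepsilon_s=\frac{\varepsilon}{4n}$,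 $\delta_s=\frac{\varepsilon}{2n}d$. If $n=1$, put $R=(P_1\|Q_1)$. If $n\ge2$, put $R'_{n,x}=(P_{n|n-1}(\cdot|x)\,\|\,Q_{n|n-1}(\cdot|x))$ for $x\in[q]$; for $k=n-1,\dots,1$ put $\tilde R_{k+1,x}=\mathsf{Sparsify}(R'_{k+1,x},\varepsilon_s,\delta_s)$ for $x\in[q]$ and, if $k>1$, $R'_{k,x}=\mathsf{Concatenate}(P_{k|k-1}(\cdot|x),Q_{k|k-1}(\cdot|x),(\tilde R_{k+1,y})_{y\in[q]})$ for $x\in[q]$; finally put $R=\mathsf{Concatenate}(P_1,Q_1,(\tilde R_{2,y})_{y\in[q]})$. The output is $\widehat\Delta=\Delta(R)$. **Theorem.** There are a deterministic program for this machine, which computes the output of Algorithm A, and an absolute constant $C>0$ such that for all $n\ge 1$, $q\ge1$, all Markov chains $P,Q$ over $[q]^n$ and all real $\varepsilon>0$, the program halts on the input $(P,Q,\varepsilon)$ with an output $\widehat\Delta$ satisfying $$(1-\varepsilon)\,\mathrm{TV}(P,Q)\le\widehat\Delta\le \mathrm{TV}(P,Q),$$ and, if $\mathrm{TV}(P,Q)>0$,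 after at most $$C\cdot\frac{q^2n^2}{\min(\varepsilon,1)}\cdot\log q\cdot\log\max\Bigl(2,\frac{n}{\varepsilon\,\mathrm{TV}(P,Q)}\Bigr)$$ steps. In particular, for $n\ge2$ and $0<\varepsilon\le1$ its running time is $O\bigl(\frac{q^2n^2}{\varepsilon}\log q\,\log\frac{n}{\varepsilon\,\mathrm{TV}(P,Q)}\bigr)$. -/

import Mathlib

open scoped ENNReal

/-! A random access machine with exact real arithmetic at unit cost, as a structured language. -/

namespace RealRAM

/-- A memory: registers and arrays that hold natural numbers (used for counting and addressing),
and registers and arrays that hold real numbers. A program mentions only finitely many registers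
and arrays by name; the cells of an array are addressed by the contents of a register. -/
structure Memory where
  nreg : ℕ → ℕ
  rreg : ℕ → ℝ
  narr : ℕ → ℕ → ℕ
  rarr : ℕ → ℕ → ℝ

/-- The elementary instructions. The first argument `d` of an instruction that computes a value is
the number of the register that receives it. -/
inductive Instr where
  | skip
  | nconst (d c : ℕ)
  | nadd (d a b : ℕ)
  | nsub (d a b : ℕ)
  | nload (d A i : ℕ)
  | nstore (A i a : ℕ)
  | rcast (d a : ℕ)
  | radd (d a b : ℕ)
  | rsub (d a b : ℕ)
  | rmul (d a b : ℕ)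
  | rdiv (d a b : ℕ)
  | rload (d A i : ℕ)
  | rstore (A i a : ℕ)

/-- The tests: comparison of two registers of the same kind. -/
inductive Test where
  | nlt (a b : ℕ)
  | nle (a b : ℕ)
  | rlt (a b : ℕ)
  | rle (a b : ℕ)

/-- Programs. -/
inductive Program where
  | instr (c : Instr)
  | seq (p p' : Program)
  | ite (b : Test) (p p' : Program)
  | while (b : Test) (p : Program)

/-- Effect of an elementary instruction (subtraction of natural numbers is truncated at `0`, and
division of a real number by `0` returns `0`). -/
noncomputable def Instr.apply (c : Instr) (s : Memory) : Memory :=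
  match c with
  | .skip => s
  | .nconst d k => { s with nreg := Function.update s.nreg d k }
  | .nadd d a b => { s with nreg := Function.update s.nreg d (s.nreg a + s.nreg b) }
  | .nsub d a b => { s with nreg := Function.update s.nreg d (s.nreg a - s.nreg b) }
  | .nload d A i => { s with nreg := Function.update s.nreg d (s.narr A (s.nreg i)) }
  | .nstore A i a =>
      { s with narr := Function.update s.narr A
                (Function.update (s.narr A) (s.nreg i) (s.nreg a)) }
  | .rcast d a => { s with rreg := Function.update s.rreg d (s.nreg a : ℝ) }
  | .radd d a b => { s with rreg := Function.update s.rreg d (s.rreg a + s.rreg b) }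
  | .rsub d a b => { s with rreg := Function.update s.rreg d (s.rreg a - s.rreg b) }
  | .rmul d a b => { s with rreg := Function.update s.rreg d (s.rreg a * s.rreg b) }
  | .rdiv d a b => { s with rreg := Function.update s.rreg d (s.rreg a / s.rreg b) }
  | .rload d A i => { s with rreg := Function.update s.rreg d (s.rarr A (s.nreg i)) }
  | .rstore A i a =>
      { s with rarr := Function.update s.rarr A
                (Function.update (s.rarr A) (s.nreg i) (s.rreg a)) }

/-- Truth of a test. -/
def Test.Holds (b : Test) (s : Memory) : Prop :=
  match b with
  | .nlt a b => s.nreg a < s.nreg b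
  | .nle a b => s.nreg a ≤ s.nreg b
  | .rlt a b => s.rreg a < s.rreg b
  | .rle a b => s.rreg a ≤ s.rreg b

/-- `Exec p s s' t`: started in the memory `s`, the program `p` halts in the memory `s'` after
exactly `t` steps. Every elementary instruction and every evaluation of a test is one step. -/
inductive Exec : Program → Memory → Memory → ℕ → Prop where
  | instr (c : Instr) (s : Memory) : Exec (.instr c) s (c.apply s) 1
  | seq {p p' : Program} {s s' s'' : Memory} {t t' : ℕ} :
      Exec p s s' t → Exec p' s' s'' t' → Exec (.seq p p') s s'' (t + t')
  | ite_true {b : Test} {p p' : Program} {s s' : Memory} {t : ℕ} :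
      b.Holds s → Exec p s s' t → Exec (.ite b p p') s s' (t + 1)
  | ite_false {b : Test} {p p' : Program} {s s' : Memory} {t : ℕ} :
      ¬ b.Holds s → Exec p' s s' t → Exec (.ite b p p') s s' (t + 1)
  | while_true {b : Test} {p : Program} {s s' s'' : Memory} {t t' : ℕ} :
      b.Holds s → Exec p s s' t → Exec (.while b p) s' s'' t' →
        Exec (.while b p) s s'' (t + t' + 1)
  | while_false {b : Test} {p : Program} {s : Memory} :
      ¬ b.Holds s → Exec (.while b p) s s 1

/-- The machine is deterministic: final memory and number of steps are unique. -/
theorem Exec.unique {p : Program} {s s₁ s₂ : Memory} {t₁ t₂ : ℕ}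
    (h₁ : Exec p s s₁ t₁) (h₂ : Exec p s s₂ t₂) : s₁ = s₂ ∧ t₁ = t₂ := by
  induction h₁ generalizing s₂ t₂ with
  | instr c s => cases h₂; exact ⟨rfl, rfl⟩
  | seq _ _ ih ih' =>
      cases h₂ with
      | seq k k' =>
        obtain ⟨rfl, rfl⟩ := ih k
        obtain ⟨rfl, rfl⟩ := ih' k'
        exact ⟨rfl, rfl⟩
  | ite_true hb _ ih =>
      cases h₂ with
      | ite_true _ k => obtain ⟨rfl, rfl⟩ := ih k; exact ⟨rfl, rfl⟩
      | ite_false hb' _ => exact absurd hb hb'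
  | ite_false hb _ ih =>
      cases h₂ with
      | ite_true hb' _ => exact absurd hb' hb
      | ite_false _ k => obtain ⟨rfl, rfl⟩ := ih k; exact ⟨rfl, rfl⟩
  | while_true hb _ _ ih ih' =>
      cases h₂ with
      | while_true _ k k' =>
        obtain ⟨rfl, rfl⟩ := ih k
        obtain ⟨rfl, rfl⟩ := ih' k'
        exact ⟨rfl, rfl⟩
      | while_false hb' => exact absurd hb hb'
  | while_false hb =>
      cases h₂ with
      | while_true hb' _ _ => exact absurd hb' hb
      | while_false _ => exact ⟨rfl, rfl⟩

end RealRAM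

namespace MarkovTV

/-- Total variation distance of two mass functions on a finite sample space. -/
noncomputable def tv {Ω : Type*} [Fintype Ω] (p p' : Ω → ℝ) : ℝ :=
  (1 / 2) * ∑ x, |p x - p' x|

/-- An `(m + 1)`-step Markov chain with state space `[q]`: an initial distribution and `m`
Markov kernels; `kernel i x` is the distribution of the next coordinate, given that the
coordinate with (zero-based) index `i` is `x`. -/
structure Chain (m q : ℕ) where
  initial : Fin q → ℝ
  kernel : Fin m → Fin q → Fin q → ℝ
  initial_mem : initial ∈ stdSimplex ℝ (Fin q)
  kernel_mem : ∀ i x, kernel i x ∈ stdSimplex ℝ (Fin q)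

/-- The joint distribution of the trajectory, a mass function on `[q]^(m+1)`. -/
noncomputable def Chain.law {m q : ℕ} (P : Chain m q) (x : Fin (m + 1) → Fin q) : ℝ :=
  P.initial (x 0) * ∏ i : Fin m, P.kernel i (x i.castSucc) (x i.succ)

/-- The memory at the start. Natural registers `0`, `1` hold the length `n = m + 1` and `q`, real
register `0` holds `ε`. Real arrays `0`, `1` hold the initial distributions of `P`, `Q`, and real
arrays `2`, `3` their kernels, the entry `kernel i x y` at address `(i q + x) q + y`.
All other registers and cells are `0`. -/
noncomputable def input {m q : ℕ} (P Q : Chain m q) (ε : ℝ) : RealRAM.Memory where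
  nreg := fun r => if r = 0 then m + 1 else if r = 1 then q else 0
  rreg := fun r => if r = 0 then ε else 0
  narr := fun _ _ => 0
  rarr := fun A j =>
    if A = 0 then vec P.initial j
    else if A = 1 then vec Q.initial j
    else if A = 2 then table P.kernel j
    else if A = 3 then table Q.kernel j
    else 0
where
  vec (v : Fin q → ℝ) (j : ℕ) : ℝ := ∑ x : Fin q, if j = (x : ℕ) then v x else 0
  table (K : Fin m → Fin q → Fin q → ℝ) (j : ℕ) : ℝ :=
    ∑ i : Fin m, ∑ x : Fin q, ∑ y : Fin q, if j = ((i : ℕ) * q + (x : ℕ)) * q + (y : ℕ) then K i x y else 0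

/-! Likelihood ratio distributions, concatenation and sparsification. -/

/-- A finitely supported mass function `r ↦ R r` on `[0, ∞)`. -/
abbrev Ratio : Type := ℝ →₀ ℝ

/-- The likelihood ratio `(p ‖ p')`: the distribution of `p X / p' X` for `X ∼ p'`. -/
noncomputable def ratio {Ω : Type*} [Fintype Ω] (p p' : Ω → ℝ) : Ratio :=
  ∑ x, Finsupp.single (p x / p' x) (p' x)

/-- `E[max(1 - R, 0)]`. -/
noncomputable def Ratio.tv (R : Ratio) : ℝ := R.sum fun r w => w * max (1 - r) 0

/-- `Concatenate(p, p', R)`: the mixture over `x ∼ p'` of the distributions of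
`(p x / p' x) * r` for `r ∼ R x`. -/
noncomputable def concatenate {q : ℕ} (p p' : Fin q → ℝ) (R : Fin q → Ratio) : Ratio :=
  ∑ x, (R x).sum fun r w => Finsupp.single (p x / p' x * r) (p' x * w)

open Classical in
/-- The mass `R(I)`, for `I ⊆ [0, ∞]`. -/
noncomputable def Ratio.mass (R : Ratio) (I : Set ℝ≥0∞) : ℝ :=
  R.sum fun r w => if ENNReal.ofReal r ∈ I then w else 0

open Classical in
/-- The mass `R†(I)`, for `I ⊆ [0, ∞]`, of the other member of the canonical pair of `R`:
`R†(r) = r R(r)` for finite `r`, and `R†(∞) = 1 - E[R]`. -/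
noncomputable def Ratio.massDagger (R : Ratio) (I : Set ℝ≥0∞) : ℝ :=
  (R.sum fun r w => if ENNReal.ofReal r ∈ I then r * w else 0) +
    if ⊤ ∈ I then 1 - R.sum (fun r w => r * w) else 0

/-- The atom that replaces the part of `R` in `I`: all of its mass, at the quotient
`R†(I) / R(I)`. -/
noncomputable def Ratio.merged (R : Ratio) (I : Set ℝ≥0∞) : Ratio :=
  Finsupp.single (R.massDagger I / R.mass I) (R.mass I)

/-- The points `a_t = 1 - (1 + ε)^(-t)`. -/
noncomputable def cutPoint (ε : ℝ) (t : ℕ) : ℝ := 1 - ((1 + ε) ^ t)⁻¹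

/-- The number `⌈-log δ / log (1 + ε)⌉` (and `0` if this is negative). -/
noncomputable def lastCell (ε δ : ℝ) : ℕ := ⌈-Real.log δ / Real.log (1 + ε)⌉₊

/-- `I_t = [a_t, a_{t+1})` for `t < k`, and `I_k = [a_k, 1)`. -/
noncomputable def lowerCell (ε : ℝ) (k t : ℕ) : Set ℝ≥0∞ :=
  Set.Ico (ENNReal.ofReal (cutPoint ε t))
    (if t < k then ENNReal.ofReal (cutPoint ε (t + 1)) else 1)

/-- `J_t = (1 / a_{t+1}, 1 / a_t]` for `t < k`, and `J_k = (1, 1 / a_k]`, where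
`1 / a_0 = 1 / 0 = ∞`. -/
noncomputable def upperCell (ε : ℝ) (k t : ℕ) : Set ℝ≥0∞ :=
  Set.Ioc (if t < k then (ENNReal.ofReal (cutPoint ε (t + 1)))⁻¹ else 1)
    (ENNReal.ofReal (cutPoint ε t))⁻¹

/-- `Sparsify(R, ε, δ)`: merge `R` within each of the cells `I_0, …, I_k, {1}, J_k, …, J_0`,
which partition `[0, ∞]`. -/
noncomputable def sparsify (R : Ratio) (ε δ : ℝ) : Ratio :=
  (∑ t ∈ Finset.range (lastCell ε δ + 1), R.merged (lowerCell ε (lastCell ε δ) t)) +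
    R.merged {1} +
    ∑ t ∈ Finset.range (lastCell ε δ + 1), R.merged (upperCell ε (lastCell ε δ) t)

/-- The chain that moves its first `k` coordinates like `Q` and the remaining ones like `P`. -/
noncomputable def hybrid {m q : ℕ} (P Q : Chain m q) (k : ℕ) : Chain m q where
  initial := if 0 < k then Q.initial else P.initial
  kernel := fun i => if (i : ℕ) + 1 < k then Q.kernel i else P.kernel i
  initial_mem := by split_ifs; exacts [Q.initial_mem, P.initial_mem]
  kernel_mem := fun i x => by split_ifs; exacts [Q.kernel_mem i x, P.kernel_mem i x]

/-- The lower bound for the total variation distance from which the algorithm starts: half the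
largest distance between consecutive hybrids. -/
noncomputable def lowerBound {m q : ℕ} (P Q : Chain m q) : ℝ :=
  (1 / 2) * ⨆ k : Fin (m + 1), tv (hybrid P Q (k : ℕ)).law (hybrid P Q ((k : ℕ) + 1)).law

/-- The approximate conditional ratio of the whole remaining trajectory given the current state
`x`, for the remaining `m + 1` kernels `K` and `L`: the exact conditional ratio for the last
kernel, then backwards alternately sparsify (with parameters `ε`, `δ`) and concatenate. -/
noncomputable def approxCondRatio {q : ℕ} (ε δ : ℝ) :
    (m : ℕ) → (K L : Fin (m + 1) → Fin q → Fin q → ℝ) → Fin q → Ratio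
  | 0, K, L => fun x => ratio (K 0 x) (L 0 x)
  | m + 1, K, L => fun x =>
      concatenate (K 0 x) (L 0 x) fun y =>
        sparsify (approxCondRatio ε δ m (fun i => K i.succ) (fun i => L i.succ) y) ε δ

/-- The ratio that the algorithm computes in the end. -/
noncomputable def approxRatio {q : ℕ} (ε δ : ℝ) :
    {m : ℕ} → (P Q : Chain m q) → Ratio
  | 0, P, Q => ratio P.initial Q.initial
  | m + 1, P, Q =>
      concatenate P.initial Q.initial fun x =>
        sparsify (approxCondRatio ε δ m P.kernel Q.kernel x) ε δ

/-- The estimate that the algorithm outputs, with its choice of the parameters, where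
`n = m + 1`. -/
noncomputable def estimate {m q : ℕ} (P Q : Chain m q) (ε : ℝ) : ℝ :=
  (approxRatio (ε / (4 * ((m : ℝ) + 1))) (ε / (2 * ((m : ℝ) + 1)) * lowerBound P Q) P Q).tv

end MarkovTV

/-!
Everything rests on one functional. For a ratio distribution `R` let
`Ratio.gap R α β = E[max(α - β r, 0)]` with `r ∼ R`; if `R` is the ratio `(p ‖ p')`, this is
`∑ x, max (α p' x - β p x) 0`, and at `α = β = 1` it is the total variation distance. Concatenation
turns into the exact recursion `gap_concatenate`: condition on the next state and multiply `α` and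
`β` with its two probabilities. Hence `TV(P, Q)` is the sum over the first state of the gaps of the
exact conditional ratios (`tv_law_eq`), and the estimate is the same sum for the sparsified ratios
(`estimate_eq_sum`).

**Accuracy.** Merging atoms replaces a sum of positive parts by the positive part of the sum. So
sparsification never increases the gap (`Ratio.IsValid.gap_sparsify_le`), and the estimate is at
most the distance. Conversely, merging within a cell in which the ratio varies by at most `b - a`
loses at most `β (b - a) / 2` times the mass of the cell (`sum_max_le_merge`); the geometric cut
points make `b - a` at most `ε (1 - r)` for all ratios `r` in a cell below `1`, except in the last
one, which has length at most `δ`; the cells above `1` are treated in the same way with the inverse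
ratio. Altogether one sparsification loses at most
`(α + β) / 2 * (ε TV(R) + δ)` (`Ratio.IsValid.gap_le_gap_sparsify`). Summed over the initial
segments of the trajectory, the conditional distances are averaged under the laws of `P` and of `Q`.
Each average is at most `2 TV(P, Q)`, because making the two marginals of a pair of joint laws equal
at most doubles the distance (`sum_mul_gap_le_left`, `sum_mul_gap_le_right`). So each of the at most
`n` sparsification steps loses at most `2 ε_s TV(P, Q) + δ_s` (`sum_gap_exactRatio_le`). The same
doubling bound, applied to the distance of consecutive hybrids, gives `d ≤ TV(P, Q)`
(`lowerBound_le`), and the triangle inequality gives `TV(P, Q) ≤ 2 n d` (`tv_le_lowerBound`).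
With the choice of `ε_s` and `δ_s` the total loss is at most `ε TV(P, Q)`.

**Running time.** A sparsified ratio is stored as a row of `N = 2 ℓ + 3` masses and ratios in the
order of the cells, which is also the order of the ratios (`Ratio.IsValid.encodes_sparsify`).
Multiplication by a constant `p y / p' y` preserves this order, so the atoms of one row are
distributed to the cells by two pointers that only move forward, in `O(N)` steps and without any
search (`runs_sweepProg`). The `n - 1` kernels with `q` rows each, every one of which collects the
atoms of `q` rows, cost `O(n q² N)` steps (`runs_estimateProg`). The number `ℓ` of cells is found
without logarithms, by multiplying `δ_s` by `1 + ε_s` until the product reaches `1`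
(`lt_lastCell_iff`). Since `d` is exact up to the factor `2 n` and `log (1 + x) ≥ x / (1 + x)`,
`ℓ + 1` is `O(n / min(ε, 1) * log max(2, n / (ε TV(P, Q))))` (`lastCell_le`). The factor `log q` is at least
`log 2` because two chains with a positive distance have at least two states.

Programs are verified with a Hoare logic for total correctness with time bounds (`Runs`), in which
the registers and arrays of reals to which a program does not write keep their values (`Frame`).
-/

/-! ### Reasoning about programs -/

namespace RealRAM

/-- Whether an instruction writes to the register of natural numbers `r`. -/
def Instr.writesNreg : Instr → ℕ → Bool
  | .nconst d _, r | .nadd d _ _, r | .nsub d _ _, r | .nload d _ _, r => Nat.beq d r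
  | _, _ => false

/-- Whether an instruction writes to the register of real numbers `r`. -/
def Instr.writesRreg : Instr → ℕ → Bool
  | .rcast d _, r | .radd d _ _, r | .rsub d _ _, r | .rmul d _ _, r | .rdiv d _ _, r
  | .rload d _ _, r => Nat.beq d r
  | _, _ => false

/-- Whether an instruction writes to the array of real numbers `A`. -/
def Instr.writesRarr : Instr → ℕ → Bool
  | .rstore A _ _, r => Nat.beq A r
  | _, _ => false

/-- Whether some instruction of a program satisfies `f`. -/
def Program.mentions (f : Instr → Bool) : Program → Bool
  | .instr c => f c
  | .seq p p' => p.mentions f || p'.mentions f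
  | .ite _ p p' => p.mentions f || p'.mentions f
  | .while _ p => p.mentions f

/-- The two memories agree on every register and every array of real numbers to which `p` does not
write. For a concrete program and register the side conditions hold by `rfl`. -/
structure Frame (p : Program) (s s' : Memory) : Prop where
  nreg : ∀ r, p.mentions (·.writesNreg r) = false → s'.nreg r = s.nreg r
  rreg : ∀ r, p.mentions (·.writesRreg r) = false → s'.rreg r = s.rreg r
  rarr : ∀ r, p.mentions (·.writesRarr r) = false → s'.rarr r = s.rarr r

theorem Frame.refl (p : Program) (s : Memory) : Frame p s s :=
  ⟨fun _ _ => rfl, fun _ _ => rfl, fun _ _ => rfl⟩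

theorem Frame.trans {p : Program} {s s' s'' : Memory} (h : Frame p s s') (h' : Frame p s' s'') :
    Frame p s s'' :=
  ⟨fun r hr => (h'.nreg r hr).trans (h.nreg r hr), fun r hr => (h'.rreg r hr).trans (h.rreg r hr),
    fun r hr => (h'.rarr r hr).trans (h.rarr r hr)⟩

theorem Frame.mono {p p' : Program} {s s' : Memory} (h : Frame p s s')
    (hp : ∀ f, p'.mentions f = false → p.mentions f = false) : Frame p' s s' :=
  ⟨fun r hr => h.nreg r (hp _ hr), fun r hr => h.rreg r (hp _ hr), fun r hr => h.rarr r (hp _ hr)⟩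

theorem Instr.frame (c : Instr) (s : Memory) : Frame (.instr c) s (c.apply s) := by
  constructor <;> intro r hr <;>
    cases c <;> simp [Program.mentions, Instr.writesNreg, Instr.writesRreg, Instr.writesRarr,
      Instr.apply] at hr ⊢ <;>
    exact Function.update_of_ne (fun h => Nat.ne_of_beq_eq_false hr h.symm) _ _

/-- A program changes only what it writes to. -/
theorem Exec.frame {p : Program} {s s' : Memory} {t : ℕ} (h : Exec p s s' t) : Frame p s s' := by
  induction h with
  | instr c s => exact c.frame s
  | seq _ _ ih ih' =>
      exact (ih.mono fun f hf => by simp [Program.mentions] at hf; exact hf.1).trans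
        (ih'.mono fun f hf => by simp [Program.mentions] at hf; exact hf.2)
  | ite_true _ _ ih => exact ih.mono fun f hf => by simp [Program.mentions] at hf; exact hf.1
  | ite_false _ _ ih => exact ih.mono fun f hf => by simp [Program.mentions] at hf; exact hf.2
  | while_true _ _ _ ih ih' => exact Frame.trans (p := .while _ _) (ih.mono fun f hf => hf) ih'
  | while_false _ => exact Frame.refl _ _

/-- Total correctness with a time bound: started in `s`, the program `p` halts after at most `T`
steps, in a memory that satisfies `Post`. -/
def Runs (p : Program) (s : Memory) (T : ℕ) (Post : Memory → Prop) : Prop :=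
  ∃ s' t, Exec p s s' t ∧ t ≤ T ∧ Post s'

theorem Runs.mono {p : Program} {s : Memory} {T T' : ℕ} {Post Post' : Memory → Prop}
    (h : Runs p s T Post) (hT : T ≤ T') (hP : ∀ s', Frame p s s' → Post s' → Post' s') :
    Runs p s T' Post' := by
  obtain ⟨s', t, he, ht, hp⟩ := h
  exact ⟨s', t, he, ht.trans hT, hP s' he.frame hp⟩

theorem Runs.seq {p p' : Program} {s : Memory} {T T' : ℕ} {Mid Post : Memory → Prop}
    (h : Runs p s T Mid) (h' : ∀ s', Frame p s s' → Mid s' → Runs p' s' T' Post) :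
    Runs (.seq p p') s (T + T') Post := by
  obtain ⟨s', t, he, ht, hp⟩ := h
  obtain ⟨s'', t', he', ht', hp'⟩ := h' s' he.frame hp
  exact ⟨s'', _, he.seq he', by omega, hp'⟩

theorem Runs.ite {b : Test} {p p' : Program} {s : Memory} {T : ℕ} {Post : Memory → Prop}
    (h : b.Holds s → Runs p s T Post) (h' : ¬ b.Holds s → Runs p' s T Post) :
    Runs (.ite b p p') s (T + 1) Post := by
  by_cases hb : b.Holds s
  · obtain ⟨s', t, he, ht, hp⟩ := h hb
    exact ⟨s', _, .ite_true hb he, by omega, hp⟩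
  · obtain ⟨s', t, he, ht, hp⟩ := h' hb
    exact ⟨s', _, .ite_false hb he, by omega, hp⟩

/-- A loop whose invariant `Inv k` carries a bound `k` for the number of remaining rounds. -/
theorem Runs.whileLoop {b : Test} {p : Program} {T : ℕ} {Inv : ℕ → Memory → Prop} {s₀ : Memory}
    {k : ℕ} (h₀ : Inv k s₀)
    (h : ∀ k s, Frame p s₀ s → Inv k s → b.Holds s →
      0 < k ∧ Runs p s T (Inv (k - 1))) :
    Runs (.while b p) s₀ (k * (T + 1) + 1) (fun s' => ¬ b.Holds s' ∧ ∃ k, Inv k s') := by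
  suffices H : ∀ k s, Frame p s₀ s → Inv k s →
      Runs (.while b p) s (k * (T + 1) + 1) (fun s' => ¬ b.Holds s' ∧ ∃ k, Inv k s') from
    H k s₀ (Frame.refl _ _) h₀
  intro k
  induction k with
  | zero =>
      intro s hF hs
      refine ⟨s, 1, .while_false fun hb => ?_, by omega, fun hb => ?_, 0, hs⟩ <;>
        exact absurd (h 0 s hF hs hb).1 (by omega)
  | succ k ih =>
      intro s hF hs
      by_cases hb : b.Holds s
      · obtain ⟨-, s', t, he, ht, hp⟩ := h _ s hF hs hb
        obtain ⟨s'', t', he', ht', hp'⟩ := ih s' (hF.trans he.frame) hp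
        refine ⟨s'', _, .while_true hb he he', ?_, hp'⟩
        rw [Nat.succ_mul]; omega
      · exact ⟨s, 1, .while_false hb, by omega, hb, _, hs⟩

/-- A list of instructions as a program. -/
def block : List Instr → Program
  | [] => .instr .skip
  | [c] => .instr c
  | c :: cs => .seq (.instr c) (block cs)

/-- The effect of a list of instructions. -/
noncomputable def effect : List Instr → Memory → Memory
  | [], s => s
  | c :: cs, s => effect cs (c.apply s)

theorem Runs.block {cs : List Instr} {s : Memory} {Post : Memory → Prop} {T : ℕ}
    (h : Post (effect cs s)) (hT : cs.length + 1 ≤ T) : Runs (block cs) s T Post := by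
  have key : ∀ cs s, ∃ t, Exec (RealRAM.block cs) s (effect cs s) t ∧ t ≤ cs.length + 1 := by
    intro cs
    induction cs with
    | nil => exact fun s => ⟨1, .instr .skip s, by simp⟩
    | cons c cs ih =>
        intro s
        match cs, ih with
        | [], _ => exact ⟨1, .instr c s, by simp⟩
        | c' :: cs, ih =>
            obtain ⟨t, ht, hle⟩ := ih (c.apply s)
            exact ⟨_, Exec.seq (.instr c s) ht, by simp at hle ⊢; omega⟩
  obtain ⟨t, ht, hle⟩ := key cs s
  exact ⟨_, t, ht, by omega, h⟩

theorem Runs.block_seq {cs : List Instr} {p : Program} {s : Memory} {Post : Memory → Prop} {T : ℕ}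
    (h : Runs p (effect cs s) T Post) :
    Runs (.seq (RealRAM.block cs) p) s (cs.length + 1 + T) Post :=
  Runs.seq (Mid := (· = effect cs s)) (Runs.block rfl le_rfl) fun _ _ hs => hs ▸ h

/-- Memory `s` with the register of natural numbers `i` set to `k`. -/
def Memory.setNreg (s : Memory) (i k : ℕ) : Memory :=
  { s with nreg := Function.update s.nreg i k }

/-- `for i = 0, …, (register b) - 1 do p`; the register `2` has to contain `1`. -/
def forLoop (i b : ℕ) (p : Program) : Program :=
  .seq (.instr (.nconst i 0)) (.while (.nlt i b) (.seq p (.instr (.nadd i i 2))))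

/-- The invariant `Inv k` is about the state at the start of round `k`, with the loop counter `i`
equal to `k`. Within the loop, the frame of the whole loop gives all registers that stay
constant. -/
theorem Runs.forLoop {i b : ℕ} {p : Program} {T B : ℕ} {Inv : ℕ → Memory → Prop} {s₀ : Memory}
    (hib : i ≠ b) (hi2 : i ≠ 2)
    (hi : p.mentions (·.writesNreg i) = false) (hb : p.mentions (·.writesNreg b) = false)
    (h2 : p.mentions (·.writesNreg 2) = false)
    (hB : s₀.nreg b = B) (hone : s₀.nreg 2 = 1) (h₀ : Inv 0 (s₀.setNreg i 0))
    (h : ∀ k s, k < B → Frame (forLoop i b p) s₀ s → s.nreg i = k → Inv k s →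
      Runs p s T (fun s' => Inv (k + 1) (s'.setNreg i (k + 1)))) :
    Runs (forLoop i b p) s₀ (B * (T + 2) + 2) fun s => Frame (forLoop i b p) s₀ s ∧ Inv B s := by
  have hF1 : Frame (RealRAM.forLoop i b p) s₀ (s₀.setNreg i 0) :=
    (Instr.frame (.nconst i 0) s₀).mono fun f hf => by
      simp [RealRAM.forLoop, Program.mentions] at hf ⊢; exact hf.1
  have hmem : ∀ r, r ≠ i → p.mentions (·.writesNreg r) = false →
      (RealRAM.forLoop i b p).mentions (·.writesNreg r) = false := fun r hr hp => by
    have h' : Nat.beq i r = false :=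
      Bool.eq_false_iff.2 fun h => hr (Nat.eq_of_beq_eq_true h).symm
    have h1 : (Instr.nconst i 0).writesNreg r = false := h'
    have h3 : (Instr.nadd i i 2).writesNreg r = false := h'
    simp only [RealRAM.forLoop, Program.mentions, hp, h1, h3, Bool.or_false]
  have main := Runs.whileLoop (b := .nlt i b) (p := .seq p (.instr (.nadd i i 2))) (T := T + 1)
    (k := B) (s₀ := s₀.setNreg i 0)
    (Inv := fun k s => ∃ j, k + j = B ∧ s.nreg i = j ∧ Inv j s) ⟨0, by simp, by
      simp [Memory.setNreg], h₀⟩ ?_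
  · obtain ⟨s', t, he, ht, hn, k, j, hkj, hj, hInv⟩ := main
    refine ⟨s', _, Exec.seq (.instr _ _) he, by ring_nf at ht ⊢; omega, ?_⟩
    have hF := hF1.trans (he.frame.mono fun f hf => by
      simp [RealRAM.forLoop, Program.mentions] at hf ⊢; exact hf.2)
    have hbB : s'.nreg b = B := (hF.nreg b (hmem b hib.symm hb)).trans hB
    have : ¬ j < B := fun h => hn (by simp [Test.Holds, hj, hbB, h])
    obtain rfl : j = B := by omega
    exact ⟨hF, hInv⟩
  · rintro k s hF ⟨j, hkj, hj, hInv⟩ hlt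
    have hF' := hF1.trans (hF.mono fun f hf => by
      simp [RealRAM.forLoop, Program.mentions] at hf ⊢; exact hf.2)
    have hbB : s.nreg b = B := (hF'.nreg b (hmem b hib.symm hb)).trans hB
    have h21 : s.nreg 2 = 1 := (hF'.nreg 2 (hmem 2 hi2.symm h2)).trans hone
    simp only [Test.Holds, hj, hbB] at hlt
    refine ⟨by omega, Runs.seq (h j s hlt hF' hj hInv) fun s' hFs hs' => ?_⟩
    refine ⟨_, 1, .instr _ _, le_rfl, j + 1, by omega, ?_, ?_⟩
    · simp [Instr.apply, hFs.nreg i hi, hFs.nreg 2 h2, hj, h21]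
    · simpa [Instr.apply, hFs.nreg i hi, hFs.nreg 2 h2, hj, h21, Memory.setNreg] using hs'

end RealRAM

/-! ### Ratio distributions -/

namespace MarkovTV

open Finset

/-- The integral of `f` against a finitely supported mass function. -/
noncomputable def Ratio.integral (R : Ratio) (f : ℝ → ℝ) : ℝ := R.sum fun r w => w * f r

/-- `E[max(α - β r, 0)]` for `r ∼ R`. If `R` is the ratio `(p ‖ p')`, this is the value
`∑ x, max (α p' x - β p x) 0`; at `α = β = 1` it is the total variation distance. -/
noncomputable def Ratio.gap (R : Ratio) (α β : ℝ) : ℝ := R.integral fun r => max (α - β * r) 0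

/-- A ratio distribution: a probability distribution on `[0, ∞)` of mean at most `1`. -/
structure Ratio.IsValid (R : Ratio) : Prop where
  eq_zero_of_neg : ∀ r < 0, R r = 0
  nonneg : ∀ r, 0 ≤ R r
  mass_one : R.integral (fun _ => 1) = 1
  mean_le : R.integral (fun r => r) ≤ 1

theorem Ratio.integral_eq (R : Ratio) (f : ℝ → ℝ) :
    R.integral f = ∑ r ∈ R.support, R r * f r := rfl

theorem Ratio.integral_single (r w : ℝ) (f : ℝ → ℝ) :
    Ratio.integral (Finsupp.single r w) f = w * f r :=
  Finsupp.sum_single_index (by simp)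

theorem Ratio.integral_sum {ι : Type*} (s : Finset ι) (R : ι → Ratio) (f : ℝ → ℝ) :
    Ratio.integral (∑ i ∈ s, R i) f = ∑ i ∈ s, (R i).integral f :=
  (Finsupp.sum_finsetSum_index (fun _ => by simp) (fun _ _ _ => by ring)).symm

theorem Ratio.integral_add (R : Ratio) (f g : ℝ → ℝ) :
    R.integral (fun r => f r + g r) = R.integral f + R.integral g := by
  simp [Ratio.integral_eq, mul_add, Finset.sum_add_distrib]

theorem Ratio.integral_const_mul (R : Ratio) (c : ℝ) (f : ℝ → ℝ) :
    R.integral (fun r => c * f r) = c * R.integral f := by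
  simp only [Ratio.integral_eq, Finset.mul_sum]
  exact Finset.sum_congr rfl fun r _ => by ring

theorem Ratio.IsValid.le_of_mem {R : Ratio} (hR : R.IsValid) {r : ℝ} (hr : r ∈ R.support) :
    0 ≤ r := by
  by_contra h
  exact Finsupp.mem_support_iff.1 hr (hR.eq_zero_of_neg r (not_le.1 h))

theorem Ratio.IsValid.integral_mono {R : Ratio} (hR : R.IsValid) {f g : ℝ → ℝ}
    (h : ∀ r, 0 ≤ r → f r ≤ g r) : R.integral f ≤ R.integral g :=
  Finset.sum_le_sum fun r hr => mul_le_mul_of_nonneg_left (h r (hR.le_of_mem hr)) (hR.nonneg r)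

theorem Ratio.IsValid.integral_congr {R : Ratio} (hR : R.IsValid) {f g : ℝ → ℝ}
    (h : ∀ r, 0 ≤ r → f r = g r) : R.integral f = R.integral g :=
  Finset.sum_congr rfl fun r hr => by simp only [h r (hR.le_of_mem hr)]

/-- The constant ratio `1`, of a pair of equal distributions. -/
theorem Ratio.isValid_single_one : Ratio.IsValid (Finsupp.single 1 1) where
  eq_zero_of_neg r hr := by rw [Finsupp.single_apply, if_neg (by linarith)]
  nonneg r := by rw [Finsupp.single_apply]; split_ifs <;> norm_num
  mass_one := by simp [Ratio.integral_single]
  mean_le := by simp [Ratio.integral_single]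

theorem Ratio.gap_single_one (α β : ℝ) :
    Ratio.gap (Finsupp.single 1 1) α β = max (α - β) 0 := by
  simp [Ratio.gap, Ratio.integral_single]

theorem Ratio.tv_eq_gap (R : Ratio) : R.tv = R.gap 1 1 := by
  simp [Ratio.tv, Ratio.gap, Ratio.integral]

/-! ### Elementary properties of the functional `Ratio.gap` -/

theorem Ratio.gap_mul (R : Ratio) {c : ℝ} (hc : 0 ≤ c) (α β : ℝ) :
    R.gap (c * α) (c * β) = c * R.gap α β := by
  rw [Ratio.gap, Ratio.gap, ← Ratio.integral_const_mul]
  congr 1; ext r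
  rw [mul_max_of_nonneg _ _ hc]; congr 1 <;> ring

theorem Ratio.IsValid.gap_nonneg {R : Ratio} (hR : R.IsValid) (α β : ℝ) : 0 ≤ R.gap α β :=
  Finset.sum_nonneg fun r _ => mul_nonneg (hR.nonneg r) (le_max_right _ _)

/-- Jensen's inequality: forgetting everything that comes later does not increase the distance. -/
theorem Ratio.IsValid.le_gap {R : Ratio} (hR : R.IsValid) {α β : ℝ} (hβ : 0 ≤ β) :
    max (α - β) 0 ≤ R.gap α β := by
  refine max_le ?_ (hR.gap_nonneg _ _)
  have h1 : R.integral (fun r => α * 1 + (-β) * r) ≤ R.gap α β :=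
    hR.integral_mono fun r _ => le_trans (by linarith) (le_max_left _ _)
  rw [Ratio.integral_add, Ratio.integral_const_mul, Ratio.integral_const_mul, hR.mass_one] at h1
  nlinarith [hR.mean_le]

/-- The weight `β` may be replaced by `α` at the cost of `max (β - α) 0`, because the mean of `R` is at
most `1`. -/
theorem Ratio.IsValid.gap_left_le {R : Ratio} (hR : R.IsValid) (α β : ℝ) :
    R.gap α α ≤ R.gap α β + max (β - α) 0 := by
  have h1 : R.gap α α ≤ R.integral (fun r => max (α - β * r) 0 + max (β - α) 0 * r) :=
    hR.integral_mono fun r hr => by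
      have : (β - α) * r ≤ max (β - α) 0 * r := mul_le_mul_of_nonneg_right (le_max_left _ _) hr
      refine max_le ?_ (add_nonneg (le_max_right _ _) (mul_nonneg (le_max_right _ _) hr))
      linarith [le_max_left (α - β * r) 0]
  rw [Ratio.integral_add, Ratio.integral_const_mul] at h1
  refine h1.trans (add_le_add le_rfl ?_)
  nlinarith [hR.mean_le, le_max_right (β - α) 0]

/-- The weight `α` may be replaced by `β` at the same cost, because the mass of `R` is `1`. -/
theorem Ratio.IsValid.gap_right_le {R : Ratio} (hR : R.IsValid) (α β : ℝ) :
    R.gap β β ≤ R.gap α β + max (β - α) 0 := by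
  have h1 : R.gap β β ≤ R.integral (fun r => max (α - β * r) 0 + max (β - α) 0 * 1) :=
    hR.integral_mono fun r hr => by
      refine max_le ?_ (by positivity)
      linarith [le_max_left (α - β * r) 0, le_max_left (β - α) 0]
  rw [Ratio.integral_add, Ratio.integral_const_mul, hR.mass_one, mul_one] at h1
  exact h1

/-! ### Concatenation -/

theorem Ratio.integral_concatenate {q : ℕ} (p p' : Fin q → ℝ) (R : Fin q → Ratio) (f : ℝ → ℝ) :
    (concatenate p p' R).integral f =
      ∑ x, p' x * (R x).integral fun r => f (p x / p' x * r) := by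
  rw [concatenate, Ratio.integral_sum]
  refine Finset.sum_congr rfl fun x _ => ?_
  rw [Finsupp.sum, Ratio.integral_sum, Ratio.integral_eq, Finset.mul_sum]
  exact Finset.sum_congr rfl fun r _ => by rw [Ratio.integral_single]; ring

theorem ratio_eq_concatenate {q : ℕ} (p p' : Fin q → ℝ) :
    ratio p p' = concatenate p p' fun _ => Finsupp.single 1 1 := by
  refine Finset.sum_congr rfl fun x _ => ?_
  rw [Finsupp.sum_single_index] <;> simp

theorem isValid_concatenate {q : ℕ} {p p' : Fin q → ℝ} {R : Fin q → Ratio}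
    (hp : p ∈ stdSimplex ℝ (Fin q)) (hp' : p' ∈ stdSimplex ℝ (Fin q)) (hR : ∀ x, (R x).IsValid) :
    (concatenate p p' R).IsValid where
  eq_zero_of_neg r hr := by
    simp only [concatenate, Finsupp.sum, Finsupp.finsetSum_apply, Finsupp.single_apply]
    refine Finset.sum_eq_zero fun x _ => Finset.sum_eq_zero fun s hs => if_neg fun h => ?_
    have := mul_nonneg (div_nonneg (hp.1 x) (hp'.1 x)) ((hR x).le_of_mem hs)
    linarith
  nonneg r := by
    simp only [concatenate, Finsupp.sum, Finsupp.finsetSum_apply, Finsupp.single_apply]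
    refine Finset.sum_nonneg fun x _ => Finset.sum_nonneg fun s _ => ?_
    split_ifs
    exacts [mul_nonneg (hp'.1 x) ((hR x).nonneg s), le_rfl]
  mass_one := by
    simp only [Ratio.integral_concatenate, (hR _).mass_one, mul_one, hp'.2]
  mean_le := by
    rw [Ratio.integral_concatenate, ← hp.2]
    refine Finset.sum_le_sum fun x _ => ?_
    rw [Ratio.integral_const_mul _ _ fun r => r]
    rcases (hp'.1 x).eq_or_lt with h | h
    · simp [← h, hp.1 x]
    · rw [← mul_assoc, mul_div_cancel₀ _ h.ne']
      exact mul_le_of_le_one_right (hp.1 x) (hR x).mean_le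

/-- Conditioning on the first coordinate. Where `p' x = 0`, the junk value of `p x / p' x` comes
with the mass `0`, and the gap on the right is `0` as well, because its first weight is `0`. -/
theorem gap_concatenate {q : ℕ} {p p' : Fin q → ℝ} {R : Fin q → Ratio}
    (hp : p ∈ stdSimplex ℝ (Fin q)) (hp' : p' ∈ stdSimplex ℝ (Fin q)) (hR : ∀ x, (R x).IsValid)
    (α : ℝ) {β : ℝ} (hβ : 0 ≤ β) :
    (concatenate p p' R).gap α β = ∑ x, (R x).gap (α * p' x) (β * p x) := by
  rw [Ratio.gap, Ratio.integral_concatenate]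
  refine Finset.sum_congr rfl fun x _ => ?_
  rw [← Ratio.integral_const_mul]
  refine (hR x).integral_congr fun r hr => ?_
  rcases (hp'.1 x).eq_or_lt with h | h
  · rw [← h, zero_mul, mul_zero, zero_sub, max_eq_right]
    have := mul_nonneg (mul_nonneg hβ (hp.1 x)) hr
    linarith
  · rw [mul_max_of_nonneg _ _ h.le, mul_zero]
    congr 1; field_simp

/-! ### The cells of the sparsification -/

theorem cutPoint_zero (ε : ℝ) : cutPoint ε 0 = 0 := by simp [cutPoint]

theorem cutPoint_lt_one {ε : ℝ} (hε : 0 < ε) (t : ℕ) : cutPoint ε t < 1 := by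
  have : 0 < ((1 + ε) ^ t)⁻¹ := by positivity
  unfold cutPoint; linarith

theorem cutPoint_strictMono {ε : ℝ} (hε : 0 < ε) : StrictMono (cutPoint ε) := fun s t hst =>
  sub_lt_sub_left (inv_strictAnti₀ (by positivity)
    (pow_lt_pow_right₀ (by linarith) hst)) 1

theorem cutPoint_nonneg {ε : ℝ} (hε : 0 < ε) (t : ℕ) : 0 ≤ cutPoint ε t := by
  rw [← cutPoint_zero ε]; exact (cutPoint_strictMono hε).monotone (Nat.zero_le t)

theorem cutPoint_pos {ε : ℝ} (hε : 0 < ε) {t : ℕ} (ht : 0 < t) : 0 < cutPoint ε t := by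
  rw [← cutPoint_zero ε]; exact cutPoint_strictMono hε ht

/-- The cell `I_t` is so short that merging it costs at most `ε` times the contribution of its atoms
to the distance: every ratio `r` in it has `1 - r ≥ 1 - a_{t+1}`. -/
theorem cutPoint_succ_sub {ε : ℝ} (hε : 0 < ε) (t : ℕ) :
    cutPoint ε (t + 1) - cutPoint ε t = ε * (1 - cutPoint ε (t + 1)) := by
  have : (1 + ε) ≠ 0 := by linarith
  unfold cutPoint
  rw [pow_succ]
  field_simp
  ring

/-- The cells `I_0, …, I_k, {1}, J_k, …, J_0` in increasing order. -/
noncomputable def cell (ε : ℝ) (k c : ℕ) : Set ℝ≥0∞ :=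
  if c ≤ k then lowerCell ε k c else if c = k + 1 then {1} else upperCell ε k (2 * k + 2 - c)

/-- The right end of the cell number `c`, except for the last one. -/
noncomputable def bound (ε : ℝ) (k c : ℕ) : ℝ :=
  if c < k then cutPoint ε (c + 1) else if c ≤ k + 1 then 1 else 1 / cutPoint ε (2 * k + 2 - c)

/-- The number `r` lies to the right of the cell number `c`. -/
def Beyond (ε : ℝ) (k c : ℕ) (r : ℝ) : Prop :=
  if c ≤ k then bound ε k c ≤ r else c < 2 * k + 2 ∧ bound ε k c < r

theorem bound_of_lt {ε : ℝ} {k c : ℕ} (h : c < k) : bound ε k c = cutPoint ε (c + 1) := if_pos h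

theorem bound_eq_one {ε : ℝ} {k c : ℕ} (h : k ≤ c) (h' : c ≤ k + 1) : bound ε k c = 1 := by
  rw [bound, if_neg (by omega), if_pos h']

theorem bound_of_gt {ε : ℝ} {k c : ℕ} (h : k + 1 < c) :
    bound ε k c = 1 / cutPoint ε (2 * k + 2 - c) := by
  rw [bound, if_neg (by omega), if_neg (by omega)]

theorem beyond_of_le {ε r : ℝ} {k c : ℕ} (h : c ≤ k) : Beyond ε k c r ↔ bound ε k c ≤ r := by
  rw [Beyond, if_pos h]

theorem beyond_of_gt {ε r : ℝ} {k c : ℕ} (h : k < c) :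
    Beyond ε k c r ↔ c < 2 * k + 2 ∧ bound ε k c < r := by
  rw [Beyond, if_neg (by omega)]

theorem bound_mono {ε : ℝ} (hε : 0 < ε) {k c c' : ℕ} (h : c ≤ c') (hc' : c' < 2 * k + 2) :
    bound ε k c ≤ bound ε k c' := by
  have hmono := (cutPoint_strictMono hε).monotone
  have h1 : ∀ t, 0 < t → 1 ≤ 1 / cutPoint ε t := fun t ht => by
    rw [le_div_iff₀ (cutPoint_pos hε ht), one_mul]; exact (cutPoint_lt_one hε t).le
  unfold bound
  split_ifs
  all_goals first
    | omega
    | exact hmono (by omega)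
    | exact (cutPoint_lt_one hε _).le
    | exact (cutPoint_lt_one hε _).le.trans (h1 _ (by omega))
    | exact le_rfl
    | exact h1 _ (by omega)
    | exact one_div_le_one_div_of_le (cutPoint_pos hε (by omega)) (hmono (by omega))

theorem Beyond.lt {ε r : ℝ} {k c : ℕ} (h : Beyond ε k c r) : c < 2 * k + 2 := by
  unfold Beyond at h; split_ifs at h <;> [omega; exact h.1]

theorem Beyond.bound_le {ε r : ℝ} {k c : ℕ} (h : Beyond ε k c r) : bound ε k c ≤ r := by
  unfold Beyond at h; split_ifs at h <;> [exact h; exact h.2.le]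

theorem le_bound_of_not_beyond {ε r : ℝ} {k c : ℕ} (hc : c < 2 * k + 2) (h : ¬ Beyond ε k c r) :
    r ≤ bound ε k c := by
  unfold Beyond at h; split_ifs at h with hk
  · exact (not_le.1 h).le
  · exact not_lt.1 fun h' => h ⟨hc, h'⟩

theorem Beyond.anti {ε r : ℝ} {k c c' : ℕ} (hε : 0 < ε) (h : Beyond ε k c r) (hc : c' ≤ c) :
    Beyond ε k c' r := by
  have hb := bound_mono hε hc h.lt
  have hlt := h.lt
  rcases le_or_gt c' k with h1 | h1
  · exact (beyond_of_le h1).2 (hb.trans h.bound_le)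
  · rw [beyond_of_gt (by omega)] at h ⊢
    exact ⟨by omega, hb.trans_lt h.2⟩

theorem Beyond.mono {ε r r' : ℝ} {k c : ℕ} (h : Beyond ε k c r) (hr : r ≤ r') :
    Beyond ε k c r' := by
  unfold Beyond at h ⊢
  split_ifs at h ⊢
  exacts [h.trans hr, ⟨h.1, h.2.trans_le hr⟩]

theorem exists_not_beyond (ε : ℝ) (k : ℕ) (r : ℝ) : ∃ c, ¬ Beyond ε k c r :=
  ⟨2 * k + 2, fun h => lt_irrefl _ h.lt⟩

open Classical in
/-- The number of the cell that contains `r`. -/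
noncomputable def cellIndex (ε : ℝ) (k : ℕ) (r : ℝ) : ℕ := Nat.find (exists_not_beyond ε k r)

theorem lt_cellIndex_iff {ε r : ℝ} {k c : ℕ} (hε : 0 < ε) :
    c < cellIndex ε k r ↔ Beyond ε k c r := by
  classical
  rw [cellIndex, Nat.lt_find_iff]
  exact ⟨fun h => not_not.1 (h c le_rfl), fun h c' hc' => not_not.2 (h.anti hε hc')⟩

theorem cellIndex_lt {ε : ℝ} (hε : 0 < ε) (k : ℕ) (r : ℝ) : cellIndex ε k r < 2 * k + 3 := by
  by_contra h
  exact absurd ((lt_cellIndex_iff (r := r) (k := k) (c := 2 * k + 2) hε).1 (by omega)).lt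
    (lt_irrefl _)

theorem cellIndex_mono {ε r r' : ℝ} {k : ℕ} (hε : 0 < ε) (h : r ≤ r') :
    cellIndex ε k r ≤ cellIndex ε k r' := by
  by_contra hlt
  exact absurd ((lt_cellIndex_iff hε).2 (((lt_cellIndex_iff hε).1 (not_le.1 hlt)).mono h))
    (lt_irrefl _)

theorem cellIndex_eq_iff {ε r : ℝ} {k c : ℕ} (hε : 0 < ε) :
    cellIndex ε k r = c ↔ ¬ Beyond ε k c r ∧ (c = 0 ∨ Beyond ε k (c - 1) r) := by
  rw [← lt_cellIndex_iff hε, ← lt_cellIndex_iff hε]; omega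

theorem mem_lowerCell_iff {ε r : ℝ} {k t : ℕ} (hε : 0 < ε) (hr : 0 ≤ r) :
    ENNReal.ofReal r ∈ lowerCell ε k t ↔
      cutPoint ε t ≤ r ∧ r < if t < k then cutPoint ε (t + 1) else 1 := by
  unfold lowerCell
  rw [Set.mem_Ico, ENNReal.ofReal_le_ofReal_iff hr]
  split_ifs
  · rw [ENNReal.ofReal_lt_ofReal_iff (cutPoint_pos hε (by omega))]
  · rw [ENNReal.ofReal_lt_one]

theorem mem_upperCell_iff {ε r : ℝ} {k t : ℕ} (hε : 0 < ε) :
    ENNReal.ofReal r ∈ upperCell ε k t ↔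
      (if t < k then 1 / cutPoint ε (t + 1) < r else 1 < r) ∧
        (t = 0 ∨ r ≤ 1 / cutPoint ε t) := by
  unfold upperCell
  rw [Set.mem_Ioc]
  refine and_congr ?_ ?_
  · split_ifs
    · have h := cutPoint_pos hε (Nat.succ_pos t)
      rw [← ENNReal.ofReal_inv_of_pos h, ENNReal.ofReal_lt_ofReal_iff_of_nonneg (by positivity),
        one_div]
    · rw [ENNReal.one_lt_ofReal]
  · rcases t.eq_zero_or_pos with rfl | ht
    · simp [cutPoint_zero]
    · rw [← ENNReal.ofReal_inv_of_pos (cutPoint_pos hε ht),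
        ENNReal.ofReal_le_ofReal_iff (inv_nonneg.2 (cutPoint_nonneg hε t)), one_div]
      simp [ht.ne']

/-- The cells partition `[0, ∞)`. -/
theorem mem_cell_iff {ε r : ℝ} {k c : ℕ} (hε : 0 < ε) (hr : 0 ≤ r) (hc : c < 2 * k + 3) :
    ENNReal.ofReal r ∈ cell ε k c ↔ cellIndex ε k r = c := by
  rw [cellIndex_eq_iff hε]
  unfold cell
  split_ifs with h1 h2
  · rw [mem_lowerCell_iff hε hr, and_comm, beyond_of_le h1, not_le]
    refine and_congr ?_ ?_
    · split_ifs with h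
      · rw [bound_of_lt h]
      · rw [bound_eq_one (by omega) (by omega)]
    · rcases c.eq_zero_or_pos with rfl | hpos
      · simp [cutPoint_zero, hr]
      · rw [beyond_of_le (by omega), bound_of_lt (by omega), Nat.sub_add_cancel hpos]
        simp [hpos.ne']
  · subst h2
    rw [Set.mem_singleton_iff, ENNReal.ofReal_eq_one, beyond_of_gt (by omega),
      bound_eq_one (by omega) le_rfl, Nat.add_sub_cancel, beyond_of_le le_rfl,
      bound_eq_one le_rfl (by omega)]
    simp only [(by omega : k + 1 < 2 * k + 2), true_and, not_lt, Nat.succ_ne_zero, false_or]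
    exact le_antisymm_iff
  · rw [mem_upperCell_iff hε, and_comm, beyond_of_gt (by omega), bound_of_gt (by omega),
      beyond_of_gt (by omega)]
    refine and_congr ?_ ?_
    · rw [not_and_or, not_lt, not_lt]
      exact or_congr_left (by omega)
    · have h0 : c ≠ 0 := by omega
      have hlt : c - 1 < 2 * k + 2 := by omega
      simp only [h0, hlt, false_or, true_and]
      split_ifs with h
      · rw [bound_of_gt (by omega), show 2 * k + 2 - (c - 1) = 2 * k + 2 - c + 1 by omega]
      · rw [bound_eq_one (by omega) (by omega)]

/-- Only the last cell contains `∞`. -/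
theorem top_mem_cell_iff {ε : ℝ} {k c : ℕ} (hε : 0 < ε) (hc : c < 2 * k + 3) :
    ⊤ ∈ cell ε k c ↔ c = 2 * k + 2 := by
  unfold cell
  split_ifs with h1 h2
  · simp only [lowerCell, Set.mem_Ico, not_top_lt, and_false, false_iff]; omega
  · simp only [Set.mem_singleton_iff, ENNReal.top_ne_one, false_iff]; omega
  · have : 0 < cutPoint ε (2 * k + 2 - c + 1) := cutPoint_pos hε (by omega)
    simp only [upperCell, Set.mem_Ioc, top_le_iff, ENNReal.inv_eq_top, ENNReal.ofReal_eq_zero]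
    constructor
    · rintro ⟨-, h⟩
      by_contra hne
      exact absurd (cutPoint_pos hε (by omega : 0 < 2 * k + 2 - c)) (not_lt.2 h)
    · rintro rfl
      refine ⟨?_, by simp [cutPoint_zero]⟩
      split_ifs
      · rw [lt_top_iff_ne_top, ne_eq, ENNReal.inv_eq_top, ENNReal.ofReal_eq_zero]
        exact not_le.2 this
      · exact ENNReal.one_lt_top

theorem sparsify_eq_sum (R : Ratio) (ε δ : ℝ) :
    sparsify R ε δ =
      ∑ c ∈ range (2 * lastCell ε δ + 3), R.merged (cell ε (lastCell ε δ) c) := by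
  unfold sparsify
  generalize lastCell ε δ = k
  rw [show 2 * k + 3 = (k + 1) + 1 + (k + 1) by ring, Finset.sum_range_add _ (k + 1 + 1),
    Finset.sum_range_succ _ (k + 1)]
  congr 1
  · congr 1
    · refine Finset.sum_congr rfl fun c hc => ?_
      rw [cell, if_pos (by simp at hc; omega)]
    · simp [cell]
  · rw [← Finset.sum_range_reflect]
    refine Finset.sum_congr rfl fun c hc => ?_
    rw [Finset.mem_range] at hc
    rw [cell, if_neg (by omega), if_neg (by omega)]
    congr 2; omega

/-- The mass of `R` in the cell number `c`. -/
noncomputable def Ratio.cellMass (R : Ratio) (ε : ℝ) (k c : ℕ) : ℝ := R.mass (cell ε k c)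

/-- The mass of `R†` in the cell number `c`. -/
noncomputable def Ratio.cellDagger (R : Ratio) (ε : ℝ) (k c : ℕ) : ℝ := R.massDagger (cell ε k c)

theorem Ratio.IsValid.cellMass_eq {R : Ratio} (hR : R.IsValid) {ε : ℝ} {k c : ℕ} (hε : 0 < ε)
    (hc : c < 2 * k + 3) :
    R.cellMass ε k c = R.integral fun r => if cellIndex ε k r = c then 1 else 0 := by
  unfold cellMass mass
  refine Finset.sum_congr rfl fun r hr => ?_
  simp only [mem_cell_iff hε (hR.le_of_mem hr) hc, mul_ite, mul_one, mul_zero]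

theorem Ratio.IsValid.cellDagger_eq {R : Ratio} (hR : R.IsValid) {ε : ℝ} {k c : ℕ} (hε : 0 < ε)
    (hc : c < 2 * k + 3) :
    R.cellDagger ε k c = (R.integral fun r => if cellIndex ε k r = c then r else 0) +
      if c = 2 * k + 2 then 1 - R.integral (fun r => r) else 0 := by
  unfold cellDagger massDagger
  simp only [top_mem_cell_iff hε hc]
  congr 1
  · refine Finset.sum_congr rfl fun r hr => ?_
    simp only [mem_cell_iff hε (hR.le_of_mem hr) hc, mul_ite, mul_zero, mul_comm r]
  · congr 2
    exact Finset.sum_congr rfl fun r _ => mul_comm _ _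

theorem sparsify_eq (R : Ratio) (ε δ : ℝ) :
    sparsify R ε δ = ∑ c ∈ range (2 * lastCell ε δ + 3), Finsupp.single
      (R.cellDagger ε (lastCell ε δ) c / R.cellMass ε (lastCell ε δ) c)
      (R.cellMass ε (lastCell ε δ) c) :=
  sparsify_eq_sum R ε δ

theorem Ratio.integral_sparsify (R : Ratio) (ε δ : ℝ) (f : ℝ → ℝ) :
    (sparsify R ε δ).integral f = ∑ c ∈ range (2 * lastCell ε δ + 3),
      R.cellMass ε (lastCell ε δ) c *
        f (R.cellDagger ε (lastCell ε δ) c / R.cellMass ε (lastCell ε δ) c) := by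
  rw [sparsify_eq, Ratio.integral_sum]
  simp only [Ratio.integral_single]

/-! ### Effect of the sparsification -/

/-- Merging atoms whose ratio `v i / w i` lies in an interval `[a, b]` decreases the sum of the
positive parts of `α w i - β v i` by at most `β (b - a) / 2` times their mass. The factor `1 / 2`
comes from the fact that the deviations of a ratio from its average sum up to `0`. -/
theorem sum_max_le_merge {ι : Type*} {S : Finset ι} {w v : ι → ℝ} {a b α β : ℝ}
    (hw : ∀ i ∈ S, 0 ≤ w i) (ha : ∀ i ∈ S, a * w i ≤ v i) (hb : ∀ i ∈ S, v i ≤ b * w i)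
    (hβ : 0 ≤ β) :
    ∑ i ∈ S, max (α * w i - β * v i) 0 ≤
      max (α * ∑ i ∈ S, w i - β * ∑ i ∈ S, v i) 0 + β / 2 * ((b - a) * ∑ i ∈ S, w i) := by
  set W := ∑ i ∈ S, w i with hW
  set V := ∑ i ∈ S, v i with hV
  have hW0 : 0 ≤ W := Finset.sum_nonneg hw
  rcases hW0.eq_or_lt with h0 | hpos
  · have hw0 : ∀ i ∈ S, w i = 0 := (Finset.sum_eq_zero_iff_of_nonneg hw).1 (hW ▸ h0.symm)
    have hv0 : ∀ i ∈ S, v i = 0 := fun i hi => by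
      have h1 := ha i hi
      have h2 := hb i hi
      rw [hw0 i hi, mul_zero] at h1 h2
      exact le_antisymm h2 h1
    rw [Finset.sum_eq_zero fun i hi => by rw [hw0 i hi, hv0 i hi]; simp, ← h0]
    have := le_max_right (α * 0 - β * V) 0
    linarith
  set ρ := V / W with hρ
  have hρW : W * ρ = V := mul_div_cancel₀ V hpos.ne'
  have haV : a * W ≤ V := by rw [hW, hV, Finset.mul_sum]; exact Finset.sum_le_sum ha
  have hbV : V ≤ b * W := by rw [hW, hV, Finset.mul_sum]; exact Finset.sum_le_sum hb
  have haρ : a ≤ ρ := (le_div_iff₀ hpos).2 haV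
  have hbρ : ρ ≤ b := (div_le_iff₀ hpos).2 hbV
  have key : ∀ i ∈ S, max (α * w i - β * v i) 0 ≤
      w i * max (α - β * ρ) 0 + β / 2 * ((b - a) * w i + (w i * ρ - v i)) := fun i hi => by
    have h1 := mul_le_mul_of_nonneg_left (le_max_left (α - β * ρ) 0) (hw i hi)
    have h2 := mul_nonneg (hw i hi) (le_max_right (α - β * ρ) 0)
    have h3 : w i * ρ - v i ≤ (b - a) * w i := by
      nlinarith [ha i hi, mul_le_mul_of_nonneg_left hbρ (hw i hi)]
    have h4 : -(w i * ρ - v i) ≤ (b - a) * w i := by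
      nlinarith [hb i hi, mul_le_mul_of_nonneg_left haρ (hw i hi)]
    have h5 : 0 ≤ β * ((b - a) * w i + (w i * ρ - v i)) := mul_nonneg hβ (by linarith)
    have h6 : β * (w i * ρ - v i) ≤ β * ((b - a) * w i) := mul_le_mul_of_nonneg_left h3 hβ
    refine max_le ?_ (by linarith)
    nlinarith
  refine (Finset.sum_le_sum key).trans (le_of_eq ?_)
  rw [Finset.sum_add_distrib, ← Finset.sum_mul, ← Finset.mul_sum, Finset.sum_add_distrib,
    ← Finset.mul_sum, Finset.sum_sub_distrib, ← Finset.sum_mul, ← hW, ← hV, hρW, sub_self, add_zero,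
    mul_max_of_nonneg _ _ hpos.le, mul_zero]
  congr 2
  rw [mul_sub, ← hρW]; ring

/-- The same with the two sides of the ratio exchanged. -/
theorem sum_max_le_merge' {ι : Type*} {S : Finset ι} {w v : ι → ℝ} {a b α β : ℝ}
    (hv : ∀ i ∈ S, 0 ≤ v i) (ha : ∀ i ∈ S, a * v i ≤ w i) (hb : ∀ i ∈ S, w i ≤ b * v i)
    (hα : 0 ≤ α) :
    ∑ i ∈ S, max (α * w i - β * v i) 0 ≤
      max (α * ∑ i ∈ S, w i - β * ∑ i ∈ S, v i) 0 + α / 2 * ((b - a) * ∑ i ∈ S, v i) := by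
  have hneg : ∀ x : ℝ, max x 0 = x + max (-x) 0 := fun x => by
    rcases le_total x 0 with h | h
    · rw [max_eq_right h, max_eq_left (by linarith)]; ring
    · rw [max_eq_left h, max_eq_right (by linarith)]; ring
  have h := sum_max_le_merge (α := β) hv ha hb hα
  rw [hneg (α * _ - _), Finset.sum_congr rfl fun i _ => hneg (α * w i - β * v i),
    Finset.sum_add_distrib, Finset.sum_sub_distrib, ← Finset.mul_sum, ← Finset.mul_sum]
  simp only [neg_sub]
  linarith

/-- The masses of the atoms of `R` on `[0, ∞]`; the atom `none` is `∞`. -/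
def Ratio.weight (R : Ratio) : Option ℝ → ℝ
  | none => 0
  | some r => R r

/-- The masses of the atoms of `R†` on `[0, ∞]`; the atom `none` is `∞`. -/
noncomputable def Ratio.weightDagger (R : Ratio) : Option ℝ → ℝ
  | none => 1 - R.integral fun r => r
  | some r => R r * r

/-- The number of the cell of an element of `[0, ∞]`. -/
noncomputable def cellIndexTop (ε : ℝ) (k : ℕ) : Option ℝ → ℕ
  | none => 2 * k + 2
  | some r => cellIndex ε k r

/-- The atoms of `R` and `R†`. -/
noncomputable def Ratio.atoms (R : Ratio) : Finset (Option ℝ) := insertNone R.support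

/-- The atoms in the cell number `c`. -/
noncomputable def Ratio.cellAtoms (R : Ratio) (ε : ℝ) (k c : ℕ) : Finset (Option ℝ) :=
  R.atoms.filter fun i => cellIndexTop ε k i = c

theorem Ratio.forall_atoms {R : Ratio} (hR : R.IsValid) {p : Option ℝ → Prop}
    (h0 : p none) (h : ∀ r, 0 ≤ r → p (some r)) : ∀ i ∈ R.atoms, p i := fun i hi => by
  match i with
  | none => exact h0
  | some r => exact h r (hR.le_of_mem (by simpa [Ratio.atoms] using hi))

theorem Ratio.IsValid.weight_nonneg {R : Ratio} (hR : R.IsValid) (i : Option ℝ) :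
    0 ≤ R.weight i := by
  match i with
  | none => exact le_rfl
  | some r => exact hR.nonneg r

theorem Ratio.IsValid.weightDagger_nonneg {R : Ratio} (hR : R.IsValid) :
    ∀ i ∈ R.atoms, 0 ≤ R.weightDagger i :=
  Ratio.forall_atoms hR (sub_nonneg.2 hR.mean_le) fun r hr => mul_nonneg (hR.nonneg r) hr

theorem Ratio.IsValid.sum_weight {R : Ratio} (hR : R.IsValid) :
    ∑ i ∈ R.atoms, R.weight i = 1 := by
  rw [Ratio.atoms, Finset.sum_insertNone, ← hR.mass_one, Ratio.integral_eq]
  simp [Ratio.weight]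

theorem Ratio.sum_weightDagger (R : Ratio) : ∑ i ∈ R.atoms, R.weightDagger i = 1 := by
  rw [Ratio.atoms, Finset.sum_insertNone]
  simp [Ratio.weightDagger, Ratio.integral_eq]

theorem Ratio.IsValid.sum_max {R : Ratio} (hR : R.IsValid) (α : ℝ) {β : ℝ} (hβ : 0 ≤ β) :
    ∑ i ∈ R.atoms, max (α * R.weight i - β * R.weightDagger i) 0 = R.gap α β := by
  have h : max (α * R.weight none - β * R.weightDagger none) 0 = 0 := by
    rw [Ratio.weight, Ratio.weightDagger, max_eq_right]
    nlinarith [hR.mean_le]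
  rw [Ratio.atoms, Finset.sum_insertNone, h, zero_add, Ratio.gap, Ratio.integral_eq]
  refine Finset.sum_congr rfl fun r _ => ?_
  rw [Ratio.weight, Ratio.weightDagger, mul_max_of_nonneg _ _ (hR.nonneg r), mul_zero]
  congr 1; ring

theorem Ratio.IsValid.sum_cellAtoms_weight {R : Ratio} (hR : R.IsValid) {ε : ℝ} {k c : ℕ}
    (hε : 0 < ε) (hc : c < 2 * k + 3) :
    ∑ i ∈ R.cellAtoms ε k c, R.weight i = R.cellMass ε k c := by
  rw [hR.cellMass_eq hε hc, Ratio.cellAtoms, Finset.sum_filter, Ratio.atoms,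
    Finset.sum_insertNone, Ratio.integral_eq]
  simp only [Ratio.weight, ite_self, zero_add, mul_ite, mul_one, mul_zero]
  rfl

theorem Ratio.IsValid.sum_cellAtoms_weightDagger {R : Ratio} (hR : R.IsValid) {ε : ℝ} {k c : ℕ}
    (hε : 0 < ε) (hc : c < 2 * k + 3) :
    ∑ i ∈ R.cellAtoms ε k c, R.weightDagger i = R.cellDagger ε k c := by
  rw [hR.cellDagger_eq hε hc, Ratio.cellAtoms, Finset.sum_filter, Ratio.atoms,
    Finset.sum_insertNone, Ratio.integral_eq, add_comm]
  simp only [Ratio.weightDagger, cellIndexTop, eq_comm (a := 2 * k + 2), mul_ite, mul_zero]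
  rfl

theorem Ratio.sum_cellAtoms (R : Ratio) {ε : ℝ} (k : ℕ) (hε : 0 < ε) (f : Option ℝ → ℝ) :
    ∑ c ∈ range (2 * k + 3), ∑ i ∈ R.cellAtoms ε k c, f i = ∑ i ∈ R.atoms, f i := by
  refine Finset.sum_fiberwise_of_maps_to (fun i _ => ?_) _
  rw [Finset.mem_range]
  match i with
  | none => simp [cellIndexTop]
  | some r => exact cellIndex_lt hε k r

theorem Ratio.IsValid.cellMass_nonneg {R : Ratio} (hR : R.IsValid) {ε : ℝ} {k c : ℕ}
    (hε : 0 < ε) (hc : c < 2 * k + 3) : 0 ≤ R.cellMass ε k c := by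
  rw [← hR.sum_cellAtoms_weight hε hc]
  exact Finset.sum_nonneg fun i _ => hR.weight_nonneg i

theorem Ratio.IsValid.cellDagger_nonneg {R : Ratio} (hR : R.IsValid) {ε : ℝ} {k c : ℕ}
    (hε : 0 < ε) (hc : c < 2 * k + 3) : 0 ≤ R.cellDagger ε k c := by
  rw [← hR.sum_cellAtoms_weightDagger hε hc]
  exact Finset.sum_nonneg fun i hi => hR.weightDagger_nonneg i (Finset.mem_filter.1 hi).1

theorem Ratio.IsValid.sum_cellMass {R : Ratio} (hR : R.IsValid) {ε : ℝ} (k : ℕ) (hε : 0 < ε) :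
    ∑ c ∈ range (2 * k + 3), R.cellMass ε k c = 1 := by
  rw [← hR.sum_weight, ← R.sum_cellAtoms k hε]
  exact Finset.sum_congr rfl fun c hc =>
    (hR.sum_cellAtoms_weight hε (Finset.mem_range.1 hc)).symm

theorem Ratio.IsValid.sum_cellDagger {R : Ratio} (hR : R.IsValid) {ε : ℝ} (k : ℕ) (hε : 0 < ε) :
    ∑ c ∈ range (2 * k + 3), R.cellDagger ε k c = 1 := by
  rw [← R.sum_weightDagger, ← R.sum_cellAtoms k hε]
  exact Finset.sum_congr rfl fun c hc =>
    (hR.sum_cellAtoms_weightDagger hε (Finset.mem_range.1 hc)).symm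

theorem Ratio.IsValid.sparsify {R : Ratio} (hR : R.IsValid) {ε : ℝ} (hε : 0 < ε) (δ : ℝ) :
    (sparsify R ε δ).IsValid where
  eq_zero_of_neg r hr := by
    rw [sparsify_eq, Finsupp.finsetSum_apply]
    refine Finset.sum_eq_zero fun c hc => ?_
    rw [Finset.mem_range] at hc
    rw [Finsupp.single_apply, if_neg]
    intro h
    have := div_nonneg (hR.cellDagger_nonneg hε hc) (hR.cellMass_nonneg hε hc)
    linarith
  nonneg r := by
    rw [sparsify_eq, Finsupp.finsetSum_apply]
    refine Finset.sum_nonneg fun c hc => ?_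
    rw [Finset.mem_range] at hc
    rw [Finsupp.single_apply]
    split_ifs
    exacts [hR.cellMass_nonneg hε hc, le_rfl]
  mass_one := by
    rw [Ratio.integral_sparsify]
    simp only [mul_one]
    exact hR.sum_cellMass _ hε
  mean_le := by
    rw [Ratio.integral_sparsify, ← hR.sum_cellDagger (lastCell ε δ) hε]
    refine Finset.sum_le_sum fun c hc => ?_
    rw [Finset.mem_range] at hc
    rcases eq_or_ne (R.cellMass ε (lastCell ε δ) c) 0 with h | h
    · rw [h, zero_mul]; exact hR.cellDagger_nonneg hε hc
    · rw [mul_div_cancel₀ _ h]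

theorem Ratio.IsValid.gap_sparsify_eq {R : Ratio} (hR : R.IsValid) {ε : ℝ} (hε : 0 < ε) (δ α : ℝ)
    {β : ℝ} (hβ : 0 ≤ β) :
    (MarkovTV.sparsify R ε δ).gap α β = ∑ c ∈ range (2 * lastCell ε δ + 3),
      max (α * R.cellMass ε (lastCell ε δ) c - β * R.cellDagger ε (lastCell ε δ) c) 0 := by
  rw [Ratio.gap, Ratio.integral_sparsify]
  refine Finset.sum_congr rfl fun c hc => ?_
  rw [Finset.mem_range] at hc
  rcases (hR.cellMass_nonneg hε hc).eq_or_lt with h | h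
  · rw [← h, zero_mul, mul_zero, zero_sub, max_eq_right]
    exact neg_nonpos.2 (mul_nonneg hβ (hR.cellDagger_nonneg hε hc))
  · rw [mul_max_of_nonneg _ _ h.le, mul_zero]
    congr 1; field_simp

/-- Sparsification does not increase the distance (data processing). -/
theorem Ratio.IsValid.gap_sparsify_le {R : Ratio} (hR : R.IsValid) {ε : ℝ} (hε : 0 < ε) (δ α : ℝ)
    {β : ℝ} (hβ : 0 ≤ β) : (MarkovTV.sparsify R ε δ).gap α β ≤ R.gap α β := by
  rw [hR.gap_sparsify_eq hε δ α hβ, ← hR.sum_max α hβ, ← R.sum_cellAtoms (lastCell ε δ) hε]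
  refine Finset.sum_le_sum fun c hc => ?_
  rw [Finset.mem_range] at hc
  refine max_le ?_ (Finset.sum_nonneg fun i _ => le_max_right _ _)
  rw [← hR.sum_cellAtoms_weight hε hc, ← hR.sum_cellAtoms_weightDagger hε hc, Finset.mul_sum,
    Finset.mul_sum, ← Finset.sum_sub_distrib]
  exact Finset.sum_le_sum fun i _ => le_max_left _ _

theorem cutPoint_le_of_cellIndex {ε r : ℝ} {k c : ℕ} (hε : 0 < ε) (hr : 0 ≤ r)
    (h : cellIndex ε k r = c) (hc : c ≤ k) :
    cutPoint ε c ≤ r ∧ r ≤ if c < k then cutPoint ε (c + 1) else 1 := by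
  have := (mem_cell_iff hε hr (by omega)).2 h
  rw [cell, if_pos hc, mem_lowerCell_iff hε hr] at this
  exact ⟨this.1, this.2.le⟩

theorem eq_one_of_cellIndex {ε r : ℝ} {k : ℕ} (hε : 0 < ε) (hr : 0 ≤ r)
    (h : cellIndex ε k r = k + 1) : r = 1 := by
  have := (mem_cell_iff hε hr (by omega)).2 h
  rw [cell, if_neg (by omega), if_pos rfl] at this
  simpa using this

theorem cutPoint_mul_le_of_cellIndex {ε r : ℝ} {k t : ℕ} (hε : 0 < ε) (hr : 0 ≤ r) (ht : t ≤ k)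
    (h : cellIndex ε k r = 2 * k + 2 - t) :
    cutPoint ε t * r ≤ 1 ∧ 1 ≤ (if t < k then cutPoint ε (t + 1) else 1) * r := by
  have := (mem_cell_iff hε hr (by omega)).2 h
  rw [cell, if_neg (by omega), if_neg (by omega), mem_upperCell_iff hε,
    show 2 * k + 2 - (2 * k + 2 - t) = t by omega] at this
  constructor
  · rcases t.eq_zero_or_pos with rfl | hpos
    · simp [cutPoint_zero]
    · have h2 := this.2.resolve_left hpos.ne'
      rwa [le_div_iff₀ (cutPoint_pos hε hpos), mul_comm] at h2
  · have h1 := this.1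
    split_ifs at h1 ⊢
    · rw [div_lt_iff₀ (cutPoint_pos hε (Nat.succ_pos t)), mul_comm] at h1
      exact h1.le
    · linarith

/-- The choice of the number of cells makes the cell `[a_ℓ, 1)` no longer than `δ`. The cell
`(1, 1 / a_ℓ]` is its mirror image for the inverse ratio. -/
theorem one_sub_cutPoint_lastCell_le {ε δ : ℝ} (hε : 0 < ε) (hδ : 0 < δ) :
    1 - cutPoint ε (lastCell ε δ) ≤ δ := by
  have h1 : 0 < Real.log (1 + ε) := Real.log_pos (by linarith)
  have h2 : -Real.log δ ≤ lastCell ε δ * Real.log (1 + ε) := by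
    rw [← div_le_iff₀ h1]; exact Nat.le_ceil _
  rw [cutPoint, sub_sub_cancel, inv_le_comm₀ (by positivity) hδ,
    ← Real.log_le_log_iff (by positivity) (by positivity), Real.log_inv, Real.log_pow]
  exact h2

/-- The bounds for the loss in the cell number `c`: a part proportional to the contribution of the
cell to the distance, and an additional loss in the cells next to `{1}`. -/
theorem Ratio.IsValid.sum_cellAtoms_le {R : Ratio} (hR : R.IsValid) {ε δ : ℝ} (hε : 0 < ε)
    (hδ : 0 < δ) {α β : ℝ} (hα : 0 ≤ α) (hβ : 0 ≤ β) {k c : ℕ} (hk : k = lastCell ε δ)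
    (hc : c < 2 * k + 3) :
    ∑ i ∈ R.cellAtoms ε k c, max (α * R.weight i - β * R.weightDagger i) 0 ≤
      max (α * R.cellMass ε k c - β * R.cellDagger ε k c) 0 +
      β / 2 * (ε * ∑ i ∈ R.cellAtoms ε k c, max (R.weight i - R.weightDagger i) 0 +
        if c = k then δ else 0) +
      α / 2 * (ε * ∑ i ∈ R.cellAtoms ε k c, max (R.weightDagger i - R.weight i) 0 +
        if c = k + 2 then δ else 0) := by
  have hδk : 1 - cutPoint ε k ≤ δ := hk ▸ one_sub_cutPoint_lastCell_le hε hδ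
  set S := R.cellAtoms ε k c with hS
  have hSi : ∀ i ∈ S, i ∈ R.atoms ∧ cellIndexTop ε k i = c := fun i hi => Finset.mem_filter.1 hi
  have hM : ∑ i ∈ S, R.weight i = R.cellMass ε k c := hR.sum_cellAtoms_weight hε hc
  have hD : ∑ i ∈ S, R.weightDagger i = R.cellDagger ε k c := hR.sum_cellAtoms_weightDagger hε hc
  have hM1 : R.cellMass ε k c ≤ 1 := by
    rw [← hR.sum_cellMass k hε]
    exact Finset.single_le_sum (f := fun c => R.cellMass ε k c)
      (fun j hj => hR.cellMass_nonneg hε (Finset.mem_range.1 hj)) (Finset.mem_range.2 hc)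
  have hD1 : R.cellDagger ε k c ≤ 1 := by
    rw [← hR.sum_cellDagger k hε]
    exact Finset.single_le_sum (f := fun c => R.cellDagger ε k c)
      (fun j hj => hR.cellDagger_nonneg hε (Finset.mem_range.1 hj)) (Finset.mem_range.2 hc)
  have hM0 := hR.cellMass_nonneg hε hc
  have hD0 := hR.cellDagger_nonneg hε hc
  have hsl : 0 ≤ ∑ i ∈ S, max (R.weight i - R.weightDagger i) 0 :=
    Finset.sum_nonneg fun i _ => le_max_right _ _
  have hsu : 0 ≤ ∑ i ∈ S, max (R.weightDagger i - R.weight i) 0 :=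
    Finset.sum_nonneg fun i _ => le_max_right _ _
  rcases lt_trichotomy c (k + 1) with hlt | heq | hgt
  · -- `c ≤ k`: the ratio is in `[a_c, a_{c+1})` or in `[a_k, 1)`
    set b := if c < k then cutPoint ε (c + 1) else 1 with hb
    have hw := sum_max_le_merge (S := S) (w := R.weight) (v := R.weightDagger) (a := cutPoint ε c)
      (b := b) (α := α) (β := β) (fun i _ => hR.weight_nonneg i)
      (fun i hi => by
        match i, hSi i hi with
        | none, h => exact absurd h.2 (by simp only [cellIndexTop]; omega)
        | some r, h =>
          have hr : 0 ≤ r := hR.le_of_mem (by simpa [Ratio.atoms] using h.1)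
          have := (cutPoint_le_of_cellIndex hε hr h.2 (by omega)).1
          rw [Ratio.weight, Ratio.weightDagger, mul_comm]
          exact mul_le_mul_of_nonneg_left this (hR.nonneg r))
      (fun i hi => by
        match i, hSi i hi with
        | none, h => exact absurd h.2 (by simp only [cellIndexTop]; omega)
        | some r, h =>
          have hr : 0 ≤ r := hR.le_of_mem (by simpa [Ratio.atoms] using h.1)
          have := (cutPoint_le_of_cellIndex hε hr h.2 (by omega)).2
          rw [Ratio.weight, Ratio.weightDagger, mul_comm]
          exact mul_le_mul_of_nonneg_right this (hR.nonneg r)) hβ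
    rw [hM, hD] at hw
    refine hw.trans ?_
    have hα' : 0 ≤ α / 2 * (ε * ∑ i ∈ S, max (R.weightDagger i - R.weight i) 0 +
        if c = k + 2 then δ else 0) := by
      rw [if_neg (by omega)]; positivity
    refine le_add_of_le_of_nonneg (add_le_add le_rfl ?_) hα'
    refine mul_le_mul_of_nonneg_left ?_ (by positivity)
    by_cases hck : c < k
    · rw [hb, if_pos hck, if_neg (by omega), cutPoint_succ_sub hε, mul_assoc, add_zero]
      refine mul_le_mul_of_nonneg_left ?_ hε.le
      rw [← hM, Finset.mul_sum]
      refine Finset.sum_le_sum fun i hi => le_trans ?_ (le_max_left _ _)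
      match i, hSi i hi with
      | none, h => exact absurd h.2 (by simp only [cellIndexTop]; omega)
      | some r, h =>
        have hr : 0 ≤ r := hR.le_of_mem (by simpa [Ratio.atoms] using h.1)
        have := (cutPoint_le_of_cellIndex hε hr h.2 (by omega)).2
        rw [if_pos hck] at this
        rw [Ratio.weight, Ratio.weightDagger]
        nlinarith [hR.nonneg r]
    · obtain rfl : c = k := by omega
      rw [hb, if_neg hck, if_pos rfl]
      have : (1 - cutPoint ε c) * R.cellMass ε c c ≤ δ * 1 :=
        mul_le_mul hδk hM1 hM0 hδ.le
      have := mul_nonneg hε.le hsl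
      linarith
  · -- the ratio is `1`, and nothing is lost
    have hone : ∀ i ∈ S, R.weightDagger i = 1 * R.weight i := fun i hi => by
      match i, hSi i hi with
      | none, h => exact absurd h.2 (by simp only [cellIndexTop]; omega)
      | some r, h =>
        have hr : 0 ≤ r := hR.le_of_mem (by simpa [Ratio.atoms] using h.1)
        have := eq_one_of_cellIndex hε hr (h.2.trans heq)
        rw [Ratio.weight, Ratio.weightDagger, this, mul_one, one_mul]
    have hw := sum_max_le_merge (S := S) (w := R.weight) (v := R.weightDagger) (a := 1)
      (b := 1) (α := α) (β := β) (fun i _ => hR.weight_nonneg i)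
      (fun i hi => (hone i hi).ge) (fun i hi => (hone i hi).le) hβ
    rw [hM, hD, sub_self, zero_mul, mul_zero, add_zero] at hw
    rw [if_neg (by omega), if_neg (by omega)]
    have h1 : 0 ≤ β / 2 * (ε * ∑ i ∈ S, max (R.weight i - R.weightDagger i) 0 + 0) := by positivity
    have h2 : 0 ≤ α / 2 * (ε * ∑ i ∈ S, max (R.weightDagger i - R.weight i) 0 + 0) := by positivity
    linarith
  · -- the inverse of the ratio is in `[a_t, a_{t+1})` or in `[a_k, 1)`
    obtain ⟨t, ht, rfl⟩ : ∃ t ≤ k, c = 2 * k + 2 - t := ⟨2 * k + 2 - c, by omega, by omega⟩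
    set b := if t < k then cutPoint ε (t + 1) else 1 with hb
    have hb0 : 0 ≤ b := by
      rw [hb]; split_ifs
      exacts [cutPoint_nonneg hε _, zero_le_one]
    have hw := sum_max_le_merge' (S := S) (w := R.weight) (v := R.weightDagger)
      (a := cutPoint ε t) (b := b) (α := α) (β := β)
      (fun i hi => hR.weightDagger_nonneg i (hSi i hi).1)
      (fun i hi => by
        match i, hSi i hi with
        | none, h =>
          have h0 : t = 0 := by
            have := h.2
            simp only [cellIndexTop] at this
            omega
          rw [h0, cutPoint_zero, zero_mul]
          exact hR.weight_nonneg _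
        | some r, h =>
          have hr : 0 ≤ r := hR.le_of_mem (by simpa [Ratio.atoms] using h.1)
          have := (cutPoint_mul_le_of_cellIndex hε hr ht h.2).1
          rw [Ratio.weight, Ratio.weightDagger]
          nlinarith [hR.nonneg r])
      (fun i hi => by
        match i, hSi i hi with
        | none, h => exact mul_nonneg hb0 (hR.weightDagger_nonneg none h.1)
        | some r, h =>
          have hr : 0 ≤ r := hR.le_of_mem (by simpa [Ratio.atoms] using h.1)
          have := (cutPoint_mul_le_of_cellIndex hε hr ht h.2).2
          rw [Ratio.weight, Ratio.weightDagger]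
          nlinarith [hR.nonneg r]) hα
    rw [hM, hD] at hw
    refine hw.trans ?_
    rw [if_neg (by omega : ¬ 2 * k + 2 - t = k), add_assoc]
    have hβ' : 0 ≤ β / 2 * (ε * ∑ i ∈ S, max (R.weight i - R.weightDagger i) 0 + 0) := by
      positivity
    refine add_le_add le_rfl (le_add_of_nonneg_of_le hβ' ?_)
    refine mul_le_mul_of_nonneg_left ?_ (by positivity)
    by_cases htk : t < k
    · rw [hb, if_pos htk, if_neg (by omega), cutPoint_succ_sub hε, mul_assoc, add_zero]
      refine mul_le_mul_of_nonneg_left ?_ hε.le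
      rw [← hD, Finset.mul_sum]
      refine Finset.sum_le_sum fun i hi => le_trans ?_ (le_max_left _ _)
      match i, hSi i hi with
      | none, h =>
        have h1 := hR.weightDagger_nonneg none h.1
        have h2 := mul_nonneg (cutPoint_nonneg hε (t + 1)) h1
        simp only [Ratio.weight]
        linarith
      | some r, h =>
        have hr : 0 ≤ r := hR.le_of_mem (by simpa [Ratio.atoms] using h.1)
        have := (cutPoint_mul_le_of_cellIndex hε hr ht h.2).2
        rw [if_pos htk] at this
        rw [Ratio.weight, Ratio.weightDagger]
        nlinarith [hR.nonneg r]
    · obtain rfl : t = k := by omega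
      rw [hb, if_neg htk, if_pos (by omega)]
      have : (1 - cutPoint ε t) * R.cellDagger ε t (2 * t + 2 - t) ≤ δ * 1 :=
        mul_le_mul hδk hD1 hD0 hδ.le
      have := mul_nonneg hε.le hsu
      linarith

/-- Sparsification loses little of the distance. -/
theorem Ratio.IsValid.gap_le_gap_sparsify {R : Ratio} (hR : R.IsValid) {ε δ : ℝ} (hε : 0 < ε)
    (hδ : 0 < δ) {α β : ℝ} (hα : 0 ≤ α) (hβ : 0 ≤ β) :
    R.gap α β ≤
      (MarkovTV.sparsify R ε δ).gap α β + (α + β) / 2 * (ε * R.gap 1 1 + δ) := by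
  have h1 : ∑ i ∈ R.atoms, max (R.weight i - R.weightDagger i) 0 = R.gap 1 1 := by
    rw [← hR.sum_max 1 zero_le_one]; simp
  have h2 : ∑ i ∈ R.atoms, max (R.weightDagger i - R.weight i) 0 = R.gap 1 1 := by
    rw [← h1, ← sub_eq_zero, ← Finset.sum_sub_distrib]
    have : ∀ i, max (R.weightDagger i - R.weight i) 0 - max (R.weight i - R.weightDagger i) 0 =
        R.weightDagger i - R.weight i := fun i => by
      rcases le_total (R.weight i) (R.weightDagger i) with h | h
      · rw [max_eq_left (by linarith), max_eq_right (by linarith)]; ring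
      · rw [max_eq_right (by linarith), max_eq_left (by linarith)]; ring
    simp only [this, Finset.sum_sub_distrib, hR.sum_weight, R.sum_weightDagger, sub_self]
  have h := Finset.sum_le_sum fun c hc =>
    hR.sum_cellAtoms_le hε hδ hα hβ (k := lastCell ε δ) rfl (Finset.mem_range.1 hc)
  rw [R.sum_cellAtoms _ hε, hR.sum_max α hβ, Finset.sum_add_distrib, Finset.sum_add_distrib,
    ← hR.gap_sparsify_eq hε δ α hβ, ← Finset.mul_sum, ← Finset.mul_sum, Finset.sum_add_distrib,
    Finset.sum_add_distrib, ← Finset.mul_sum, ← Finset.mul_sum, R.sum_cellAtoms _ hε,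
    R.sum_cellAtoms _ hε, h1, h2, Finset.sum_ite_eq', Finset.sum_ite_eq',
    if_pos (Finset.mem_range.2 (by omega)), if_pos (Finset.mem_range.2 (by omega))] at h
  linarith

end MarkovTV

/-! ### Accuracy along the chain -/

namespace MarkovTV

open Finset

variable {q : ℕ}

/-- The first `m` members of a sequence of matrices are stochastic. -/
def Stochastic (m : ℕ) (K : ℕ → Fin q → Fin q → ℝ) : Prop :=
  ∀ i < m, ∀ x, K i x ∈ stdSimplex ℝ (Fin q)

theorem Stochastic.shift {m : ℕ} {K : ℕ → Fin q → Fin q → ℝ} (h : Stochastic (m + 1) K) :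
    Stochastic m fun i => K (i + 1) := fun i hi => h (i + 1) (by omega)

/-- The exact ratio of the remaining trajectory, given the current state, if `m` steps with the
kernels `K` and `L` remain. -/
noncomputable def exactRatio : (m : ℕ) → (K L : ℕ → Fin q → Fin q → ℝ) → Fin q → Ratio
  | 0, _, _ => fun _ => Finsupp.single 1 1
  | m + 1, K, L => fun x =>
      concatenate (K 0 x) (L 0 x) (exactRatio m (fun i => K (i + 1)) fun i => L (i + 1))

/-- The approximation that the algorithm computes for `exactRatio`, sparsified after every step.
(The sparsification of the constant ratio `1` would not change it, so that the last kernel needs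
no special treatment.) -/
noncomputable def sparseRatio (ε δ : ℝ) :
    (m : ℕ) → (K L : ℕ → Fin q → Fin q → ℝ) → Fin q → Ratio
  | 0, _, _ => fun _ => Finsupp.single 1 1
  | m + 1, K, L => fun x => sparsify
      (concatenate (K 0 x) (L 0 x) (sparseRatio ε δ m (fun i => K (i + 1)) fun i => L (i + 1))) ε δ

theorem isValid_exactRatio {m : ℕ} {K L : ℕ → Fin q → Fin q → ℝ} (hK : Stochastic m K)
    (hL : Stochastic m L) (x : Fin q) : (exactRatio m K L x).IsValid := by
  induction m generalizing K L x with
  | zero => exact Ratio.isValid_single_one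
  | succ m ih =>
      exact isValid_concatenate (hK 0 (by omega) x) (hL 0 (by omega) x) (ih hK.shift hL.shift)

theorem isValid_sparseRatio {ε : ℝ} (hε : 0 < ε) (δ : ℝ) {m : ℕ} {K L : ℕ → Fin q → Fin q → ℝ}
    (hK : Stochastic m K) (hL : Stochastic m L) (x : Fin q) :
    (sparseRatio ε δ m K L x).IsValid := by
  induction m generalizing K L x with
  | zero => exact Ratio.isValid_single_one
  | succ m ih =>
      exact (isValid_concatenate (hK 0 (by omega) x) (hL 0 (by omega) x)
        (ih hK.shift hL.shift)).sparsify hε δ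

/-- The gap of the exact ratio, by conditioning on the next state. -/
theorem gap_exactRatio_succ {m : ℕ} {K L : ℕ → Fin q → Fin q → ℝ} (hK : Stochastic (m + 1) K)
    (hL : Stochastic (m + 1) L) (x : Fin q) (α : ℝ) {β : ℝ} (hβ : 0 ≤ β) :
    (exactRatio (m + 1) K L x).gap α β =
      ∑ y, (exactRatio m (fun i => K (i + 1)) (fun i => L (i + 1)) y).gap
        (α * L 0 x y) (β * K 0 x y) :=
  gap_concatenate (hK 0 (by omega) x) (hL 0 (by omega) x)
    (isValid_exactRatio hK.shift hL.shift) α hβ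

theorem gap_sparseRatio_le {ε : ℝ} (hε : 0 < ε) (δ : ℝ) {m : ℕ} {K L : ℕ → Fin q → Fin q → ℝ}
    (hK : Stochastic m K) (hL : Stochastic m L) (x : Fin q) (α : ℝ) {β : ℝ} (hβ : 0 ≤ β) :
    (sparseRatio ε δ m K L x).gap α β ≤ (exactRatio m K L x).gap α β := by
  induction m generalizing K L x α β with
  | zero => exact le_rfl
  | succ m ih =>
      have hKx := hK 0 (by omega) x
      have hLx := hL 0 (by omega) x
      have hv := isValid_sparseRatio hε δ hK.shift hL.shift
      refine ((isValid_concatenate hKx hLx hv).gap_sparsify_le hε δ α hβ).trans ?_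
      rw [gap_concatenate hKx hLx hv α hβ, gap_exactRatio_succ hK hL x α hβ]
      exact Finset.sum_le_sum fun y _ => ih hK.shift hL.shift y _ (mul_nonneg hβ (hKx.1 y))

theorem sum_max_sub_comm {Ω : Type*} [Fintype Ω] {α β : Ω → ℝ} (h : ∑ ω, α ω = ∑ ω, β ω) :
    ∑ ω, max (β ω - α ω) 0 = ∑ ω, max (α ω - β ω) 0 := by
  have h1 : ∀ ω, max (β ω - α ω) 0 = max (α ω - β ω) 0 + (β ω - α ω) := fun ω => by
    rcases le_total (α ω) (β ω) with h | h
    · rw [max_eq_left (by linarith), max_eq_right (by linarith)]; ring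
    · rw [max_eq_right (by linarith), max_eq_left (by linarith)]; ring
  simp only [h1, Finset.sum_add_distrib, Finset.sum_sub_distrib, h, sub_self, add_zero]

/-- For joint laws of `ω` and a further trajectory, whose marginals in `ω` are `α` and `β` and
whose conditional ratio given `ω` is `R ω`: replacing the marginal `β` by `α` at most doubles the
distance. -/
theorem sum_mul_gap_le_left {Ω : Type*} [Fintype Ω] {R : Ω → Ratio} (hR : ∀ ω, (R ω).IsValid)
    {α β : Ω → ℝ} (hα : ∀ ω, 0 ≤ α ω) (hβ : ∀ ω, 0 ≤ β ω) (h : ∑ ω, α ω = ∑ ω, β ω) :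
    ∑ ω, α ω * (R ω).gap 1 1 ≤ 2 * ∑ ω, (R ω).gap (α ω) (β ω) := by
  have h1 : ∑ ω, α ω * (R ω).gap 1 1 ≤ ∑ ω, ((R ω).gap (α ω) (β ω) + max (β ω - α ω) 0) :=
    Finset.sum_le_sum fun ω _ => by
      rw [← Ratio.gap_mul _ (hα ω), mul_one]; exact (hR ω).gap_left_le _ _
  have h2 : ∑ ω, max (α ω - β ω) 0 ≤ ∑ ω, (R ω).gap (α ω) (β ω) :=
    Finset.sum_le_sum fun ω _ => (hR ω).le_gap (hβ ω)
  rw [Finset.sum_add_distrib, sum_max_sub_comm h] at h1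
  linarith

/-- The same as `sum_mul_gap_le_left`, with the marginal `α` replaced by `β`. -/
theorem sum_mul_gap_le_right {Ω : Type*} [Fintype Ω] {R : Ω → Ratio} (hR : ∀ ω, (R ω).IsValid)
    {α β : Ω → ℝ} (hβ : ∀ ω, 0 ≤ β ω) (h : ∑ ω, α ω = ∑ ω, β ω) :
    ∑ ω, β ω * (R ω).gap 1 1 ≤ 2 * ∑ ω, (R ω).gap (α ω) (β ω) := by
  have h1 : ∑ ω, β ω * (R ω).gap 1 1 ≤ ∑ ω, ((R ω).gap (α ω) (β ω) + max (β ω - α ω) 0) :=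
    Finset.sum_le_sum fun ω _ => by
      rw [← Ratio.gap_mul _ (hβ ω), mul_one]; exact (hR ω).gap_right_le _ _
  have h2 : ∑ ω, max (α ω - β ω) 0 ≤ ∑ ω, (R ω).gap (α ω) (β ω) :=
    Finset.sum_le_sum fun ω _ => (hR ω).le_gap (hβ ω)
  rw [Finset.sum_add_distrib, sum_max_sub_comm h] at h1
  linarith

/-- Every sparsification loses at most `2 ε` times the distance of the whole trajectories, plus
`δ`. The index `ω` stands for the first part of the trajectory, which ends in the state `e ω` and
has the laws `α` and `β`. -/
theorem sum_gap_exactRatio_le {ε δ : ℝ} (hε : 0 < ε) (hδ : 0 < δ) {m : ℕ}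
    {K L : ℕ → Fin q → Fin q → ℝ} (hK : Stochastic m K) (hL : Stochastic m L) {Ω : Type}
    [Fintype Ω] (e : Ω → Fin q) {α β : Ω → ℝ} (hα : ∀ ω, 0 ≤ α ω) (hβ : ∀ ω, 0 ≤ β ω)
    (hα1 : ∑ ω, α ω = 1) (hβ1 : ∑ ω, β ω = 1) :
    ∑ ω, (exactRatio m K L (e ω)).gap (α ω) (β ω) ≤
      ∑ ω, (sparseRatio ε δ m K L (e ω)).gap (α ω) (β ω) +
        m * (2 * ε * ∑ ω, (exactRatio m K L (e ω)).gap (α ω) (β ω) + δ) := by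
  induction m generalizing K L Ω with
  | zero => simp [exactRatio, sparseRatio]
  | succ m ih =>
      have hK0 := hK 0 (by omega)
      have hL0 := hL 0 (by omega)
      set K' := fun i => K (i + 1)
      set L' := fun i => L (i + 1)
      have hv := isValid_sparseRatio hε δ hK.shift hL.shift
      set H := ∑ ω, (exactRatio (m + 1) K L (e ω)).gap (α ω) (β ω) with hH
      have hH' : H = ∑ z : Ω × Fin q, (exactRatio m K' L' z.2).gap
          (α z.1 * L 0 (e z.1) z.2) (β z.1 * K 0 (e z.1) z.2) := by
        rw [Fintype.sum_prod_type]
        exact Finset.sum_congr rfl fun ω _ => gap_exactRatio_succ hK hL _ _ (hβ ω)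
      have h1 := ih hK.shift hL.shift (Prod.snd : Ω × Fin q → Fin q)
        (α := fun z => α z.1 * L 0 (e z.1) z.2) (β := fun z => β z.1 * K 0 (e z.1) z.2)
        (fun z => mul_nonneg (hα _) ((hL0 _).1 _)) (fun z => mul_nonneg (hβ _) ((hK0 _).1 _))
        (by simp only [Fintype.sum_prod_type, ← Finset.mul_sum, (hL0 _).2, mul_one, hα1])
        (by simp only [Fintype.sum_prod_type, ← Finset.mul_sum, (hK0 _).2, mul_one, hβ1])
      rw [← hH', Fintype.sum_prod_type] at h1
      have hR := isValid_exactRatio hK hL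
      have h2 : ∀ ω, ∑ y, (sparseRatio ε δ m K' L' y).gap (α ω * L 0 (e ω) y) (β ω * K 0 (e ω) y) ≤
          (sparseRatio ε δ (m + 1) K L (e ω)).gap (α ω) (β ω) +
            (α ω + β ω) / 2 * (ε * (exactRatio (m + 1) K L (e ω)).gap 1 1 + δ) := fun ω => by
        have hC := isValid_concatenate (hK0 (e ω)) (hL0 (e ω)) hv
        rw [← gap_concatenate (hK0 (e ω)) (hL0 (e ω)) hv _ (hβ ω)]
        refine (hC.gap_le_gap_sparsify hε hδ (hα ω) (hβ ω)).trans (add_le_add le_rfl ?_)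
        have := hα ω
        have := hβ ω
        refine mul_le_mul_of_nonneg_left (add_le_add ?_ le_rfl) (by positivity)
        refine mul_le_mul_of_nonneg_left ?_ hε.le
        rw [gap_concatenate (hK0 (e ω)) (hL0 (e ω)) hv _ zero_le_one,
          gap_exactRatio_succ hK hL _ _ zero_le_one]
        exact Finset.sum_le_sum fun y _ => gap_sparseRatio_le hε δ hK.shift hL.shift y _
          (mul_nonneg zero_le_one ((hK0 _).1 y))
      have h3 := Finset.sum_le_sum fun ω (_ : ω ∈ Finset.univ) => h2 ω
      have h4 := sum_mul_gap_le_left (fun ω => hR (e ω)) hα hβ (hα1.trans hβ1.symm)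
      have h5 := sum_mul_gap_le_right (fun ω => hR (e ω)) hβ (hα1.trans hβ1.symm)
      have h6 : ∑ ω, (α ω + β ω) / 2 * (ε * (exactRatio (m + 1) K L (e ω)).gap 1 1 + δ) =
          ε / 2 * (∑ ω, α ω * (exactRatio (m + 1) K L (e ω)).gap 1 1) +
            ε / 2 * (∑ ω, β ω * (exactRatio (m + 1) K L (e ω)).gap 1 1) +
              δ / 2 * (∑ ω, α ω + ∑ ω, β ω) := by
        simp only [Finset.mul_sum, ← Finset.sum_add_distrib]
        exact Finset.sum_congr rfl fun ω _ => by ring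
      rw [Finset.sum_add_distrib, h6, hα1, hβ1] at h3
      have h7 := mul_le_mul_of_nonneg_left (add_le_add h4 h5) (by positivity : 0 ≤ ε / 2)
      push_cast
      linarith

/-! ### Laws of trajectories -/

/-- The sum over all trajectories of a product of matrix entries. -/
noncomputable def pathSum (m : ℕ) (f : Fin q → ℝ) (A : ℕ → Fin q → Fin q → ℝ) : ℝ :=
  ∑ z : Fin (m + 1) → Fin q, f (z 0) * ∏ i : Fin m, A i (z i.castSucc) (z i.succ)

/-- The product of a row vector and a matrix. -/
noncomputable def push (f : Fin q → ℝ) (B : Fin q → Fin q → ℝ) (y : Fin q) : ℝ :=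
  ∑ x, f x * B x y

theorem sum_cons {m : ℕ} (g : (Fin (m + 1) → Fin q) → ℝ) :
    ∑ z, g z = ∑ x : Fin q, ∑ z : Fin m → Fin q, g (Fin.cons x z) := by
  rw [← (Fin.consEquiv fun _ => Fin q).sum_comp, Fintype.sum_prod_type]
  rfl

theorem prod_cons {m : ℕ} (A : ℕ → Fin q → Fin q → ℝ) (x : Fin q) (z : Fin (m + 1) → Fin q) :
    ∏ i : Fin (m + 1), A i ((Fin.cons x z : Fin (m + 2) → Fin q) i.castSucc)
        ((Fin.cons x z : Fin (m + 2) → Fin q) i.succ) =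
      A 0 x (z 0) * ∏ i : Fin m, A (i + 1) (z i.castSucc) (z i.succ) := by
  rw [Fin.prod_univ_succ]
  rfl

theorem pathSum_zero (f : Fin q → ℝ) (A : ℕ → Fin q → Fin q → ℝ) :
    pathSum 0 f A = ∑ x, f x := by
  rw [pathSum, sum_cons]
  simp

theorem pathSum_succ (m : ℕ) (f : Fin q → ℝ) (A : ℕ → Fin q → Fin q → ℝ) :
    pathSum (m + 1) f A = pathSum m (push f (A 0)) fun i => A (i + 1) := by
  rw [pathSum, sum_cons, Finset.sum_comm, pathSum]
  refine Finset.sum_congr rfl fun z _ => ?_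
  simp only [prod_cons, Fin.cons_zero, push, Finset.sum_mul, mul_assoc]

theorem sum_push {f : Fin q → ℝ} {B : Fin q → Fin q → ℝ} (hB : ∀ x, ∑ y, B x y = 1) :
    ∑ y, push f B y = ∑ x, f x := by
  simp only [push]
  rw [Finset.sum_comm]
  simp only [← Finset.mul_sum, hB, mul_one]

theorem pathSum_of_stochastic {m : ℕ} (f : Fin q → ℝ) {A : ℕ → Fin q → Fin q → ℝ}
    (hA : ∀ i < m, ∀ x, ∑ y, A i x y = 1) : pathSum m f A = ∑ x, f x := by
  induction m generalizing f A with
  | zero => exact pathSum_zero f A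
  | succ m ih =>
      rw [pathSum_succ, ih _ fun i hi => hA (i + 1) (by omega), sum_push (hA 0 (by omega))]

/-- The law of the state after `k` steps. -/
noncomputable def marginal (f : Fin q → ℝ) (A : ℕ → Fin q → Fin q → ℝ) : ℕ → Fin q → ℝ
  | 0 => f
  | k + 1 => push (marginal f A k) (A k)

theorem marginal_succ' (f : Fin q → ℝ) (A : ℕ → Fin q → Fin q → ℝ) (k : ℕ) :
    marginal f A (k + 1) = marginal (push f (A 0)) (fun i => A (i + 1)) k := by
  induction k with
  | zero => rfl
  | succ k ih => rw [marginal, ih]; rfl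

theorem marginal_congr (f : Fin q → ℝ) {A B : ℕ → Fin q → Fin q → ℝ} {k : ℕ}
    (h : ∀ i < k, A i = B i) : marginal f A k = marginal f B k := by
  induction k with
  | zero => rfl
  | succ k ih => rw [marginal, marginal, ih fun i hi => h i (by omega), h k (by omega)]

/-- If all matrices after number `k` are stochastic, only the law after `k` steps and the row sums
of the matrix number `k` matter. -/
theorem pathSum_eq_marginal {m k : ℕ} (hk : k < m) (f : Fin q → ℝ) {A : ℕ → Fin q → Fin q → ℝ}
    (hA : ∀ i < m, k < i → ∀ x, ∑ y, A i x y = 1) :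
    pathSum m f A = ∑ x, marginal f A k x * ∑ y, A k x y := by
  induction m generalizing f A k with
  | zero => omega
  | succ m ih =>
      rw [pathSum_succ]
      cases k with
      | zero =>
          rw [pathSum_of_stochastic _ fun i hi => hA (i + 1) (by omega) (by omega)]
          simp only [push, marginal, Finset.mul_sum]
          exact Finset.sum_comm
      | succ k =>
          rw [ih (k := k) (by omega) _ fun i hi hki => hA (i + 1) (by omega) (by omega),
            marginal_succ']

/-- The kernels of a chain as an infinite sequence of matrices, which are `0` from the end of the
chain on. -/
def Chain.step {m : ℕ} (P : Chain m q) (i : ℕ) : Fin q → Fin q → ℝ :=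
  if h : i < m then P.kernel ⟨i, h⟩ else 0

theorem Chain.step_coe {m : ℕ} (P : Chain m q) (i : Fin m) : P.step i = P.kernel i :=
  dif_pos i.2

theorem Chain.stochastic_step {m : ℕ} (P : Chain m q) : Stochastic m P.step := fun i hi x => by
  rw [Chain.step, dif_pos hi]; exact P.kernel_mem _ _

theorem Chain.law_eq {m : ℕ} (P : Chain m q) (z : Fin (m + 1) → Fin q) :
    P.law z = P.initial (z 0) * ∏ i : Fin m, P.step i (z i.castSucc) (z i.succ) := by
  simp only [Chain.law, Chain.step_coe]

theorem Chain.law_nonneg {m : ℕ} (P : Chain m q) (z : Fin (m + 1) → Fin q) : 0 ≤ P.law z :=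
  mul_nonneg (P.initial_mem.1 _) (Finset.prod_nonneg fun _ _ => (P.kernel_mem _ _).1 _)

theorem Chain.sum_law {m : ℕ} (P : Chain m q) : ∑ z, P.law z = 1 := by
  simp only [P.law_eq]
  exact (pathSum_of_stochastic _ fun _ hi x => (P.stochastic_step _ hi x).2).trans P.initial_mem.2

theorem tv_eq_sum_max {Ω : Type*} [Fintype Ω] {p p' : Ω → ℝ} (h : ∑ x, p x = ∑ x, p' x) :
    tv p p' = ∑ x, max (p' x - p x) 0 := by
  have h1 : ∀ x, |p x - p' x| = max (p' x - p x) 0 + max (p x - p' x) 0 := fun x => by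
    rcases le_total (p x) (p' x) with h | h
    · rw [abs_of_nonpos (by linarith), max_eq_left (by linarith), max_eq_right (by linarith)]; ring
    · rw [abs_of_nonneg (by linarith), max_eq_right (by linarith), max_eq_left (by linarith)]; ring
  simp only [tv, h1, Finset.sum_add_distrib, sum_max_sub_comm h]
  ring

/-- `exactRatio` is the likelihood ratio of the laws of the remaining trajectory; `K` and `L` take
part with the weights `β` and `α`. -/
theorem gap_exactRatio_eq_sum {m : ℕ} {K L : ℕ → Fin q → Fin q → ℝ} (hK : Stochastic m K)
    (hL : Stochastic m L) (x : Fin q) (α : ℝ) {β : ℝ} (hβ : 0 ≤ β) :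
    (exactRatio m K L x).gap α β = ∑ z : Fin m → Fin q,
      max (α * ∏ i : Fin m, L i ((Fin.cons x z : Fin (m + 1) → Fin q) i.castSucc)
          ((Fin.cons x z : Fin (m + 1) → Fin q) i.succ) -
        β * ∏ i : Fin m, K i ((Fin.cons x z : Fin (m + 1) → Fin q) i.castSucc)
          ((Fin.cons x z : Fin (m + 1) → Fin q) i.succ)) 0 := by
  induction m generalizing K L x α β with
  | zero => simp [exactRatio, Ratio.gap_single_one]
  | succ m ih =>
      rw [gap_exactRatio_succ hK hL x α hβ, sum_cons]
      refine Finset.sum_congr rfl fun y _ => ?_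
      rw [ih hK.shift hL.shift y _ (mul_nonneg hβ ((hK 0 (by omega) x).1 y))]
      refine Finset.sum_congr rfl fun z _ => ?_
      simp only [prod_cons, Fin.cons_zero, mul_assoc]

/-- The distance of two chains, by conditioning on the first state. -/
theorem tv_law_eq {m : ℕ} (P Q : Chain m q) :
    tv P.law Q.law =
      ∑ x, (exactRatio m P.step Q.step x).gap (Q.initial x) (P.initial x) := by
  rw [tv_eq_sum_max (P.sum_law.trans Q.sum_law.symm), sum_cons]
  refine Finset.sum_congr rfl fun x _ => ?_
  rw [gap_exactRatio_eq_sum P.stochastic_step Q.stochastic_step x _ (P.initial_mem.1 x)]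
  refine Finset.sum_congr rfl fun z _ => ?_
  rw [P.law_eq, Q.law_eq, Fin.cons_zero]

theorem sparsify_approxCondRatio (ε δ : ℝ) (m : ℕ) (K L : ℕ → Fin q → Fin q → ℝ) (x : Fin q) :
    sparsify (approxCondRatio ε δ m (fun i => K i) (fun i => L i) x) ε δ =
      sparseRatio ε δ (m + 1) K L x := by
  induction m generalizing K L x with
  | zero =>
      change sparsify (ratio (K 0 x) (L 0 x)) ε δ = _
      rw [ratio_eq_concatenate]
      rfl
  | succ m ih =>
      have h := funext fun y => ih (fun i => K (i + 1)) (fun i => L (i + 1)) y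
      change sparsify (concatenate (K 0 x) (L 0 x) fun y => sparsify (approxCondRatio ε δ m
        (fun i => K (i + 1)) (fun i => L (i + 1)) y) ε δ) ε δ = _
      rw [h]
      rfl

/-- The algorithm concatenates with ratios that have been sparsified after every step. -/
theorem approxRatio_eq (ε δ : ℝ) {m : ℕ} (P Q : Chain m q) :
    approxRatio ε δ P Q =
      concatenate P.initial Q.initial (sparseRatio ε δ m P.step Q.step) := by
  cases m with
  | zero => exact ratio_eq_concatenate _ _
  | succ m =>
      rw [approxRatio]
      congr 1
      ext1 x
      rw [← sparsify_approxCondRatio]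
      simp only [Chain.step_coe]

/-! ### The lower bound for the distance -/

/-- The distance of the hybrids number `k` and `k + 1` (see `tv_hybrid`), in the form in which it is
computed. -/
noncomputable def hybridDist {m : ℕ} (P Q : Chain m q) : ℕ → ℝ
  | 0 => tv P.initial Q.initial
  | k + 1 => ∑ x, marginal Q.initial Q.step k x * tv (P.step k x) (Q.step k x)

theorem tv_nonneg {Ω : Type*} [Fintype Ω] (p p' : Ω → ℝ) : 0 ≤ tv p p' :=
  mul_nonneg (by norm_num) (Finset.sum_nonneg fun _ _ => abs_nonneg _)

theorem hybrid_law {m : ℕ} (P Q : Chain m q) (k : ℕ) (z : Fin (m + 1) → Fin q) :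
    (hybrid P Q k).law z = (if 0 < k then Q.initial else P.initial) (z 0) *
      ∏ i : Fin m, (if (i : ℕ) + 1 < k then Q.step i else P.step i) (z i.castSucc) (z i.succ) := by
  simp only [Chain.law, hybrid, Chain.step_coe]

/-- Consecutive hybrids differ in a single factor. The sum over the later coordinates is `1`, and
the sum over the earlier ones is the marginal of `Q`. -/
theorem tv_hybrid {m : ℕ} (P Q : Chain m q) {k : ℕ} (hk : k ≤ m) :
    tv (hybrid P Q k).law (hybrid P Q (k + 1)).law = hybridDist P Q k := by
  cases k with
  | zero =>
      have h : ∀ z, |(hybrid P Q 0).law z - (hybrid P Q (0 + 1)).law z| =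
          |P.initial (z 0) - Q.initial (z 0)| *
            ∏ i : Fin m, P.step i (z i.castSucc) (z i.succ) := fun z => by
        have h1 : (hybrid P Q 0).law z = P.initial (z 0) *
            ∏ i : Fin m, P.step i (z i.castSucc) (z i.succ) := by
          simp [hybrid_law]
        have h2 : (hybrid P Q (0 + 1)).law z = Q.initial (z 0) *
            ∏ i : Fin m, P.step i (z i.castSucc) (z i.succ) := by
          simp [hybrid_law]
        rw [h1, h2, ← sub_mul, abs_mul, abs_of_nonneg (a := ∏ i : Fin m, _)]
        refine Finset.prod_nonneg fun i _ => ?_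
        rw [P.step_coe]; exact (P.kernel_mem _ _).1 _
      simp only [tv, h, hybridDist]
      congr 1
      exact pathSum_of_stochastic (fun x => |P.initial x - Q.initial x|)
        fun i hi x => (P.stochastic_step i hi x).2
  | succ k =>
      set A : ℕ → Fin q → Fin q → ℝ := fun i => if i < k then Q.step i else
        if i = k then fun x y => |P.step k x y - Q.step k x y| else P.step i with hA
      have h : ∀ z, |(hybrid P Q (k + 1)).law z - (hybrid P Q (k + 1 + 1)).law z| =
          Q.initial (z 0) * ∏ i : Fin m, A i (z i.castSucc) (z i.succ) := fun z => by
        set j : Fin m := ⟨k, by omega⟩ with hj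
        have h1 : ∀ l : ℕ, l = k + 1 ∨ l = k + 2 → (hybrid P Q l).law z = Q.initial (z 0) *
            ((if l = k + 1 then P.step k (z j.castSucc) (z j.succ)
              else Q.step k (z j.castSucc) (z j.succ)) *
              ∏ i ∈ Finset.univ.erase j, A i (z i.castSucc) (z i.succ)) := fun l hl => by
          rw [hybrid_law, ← Finset.mul_prod_erase _ _ (Finset.mem_univ j), if_pos (by omega)]
          congr 2
          · rcases hl with rfl | rfl
            · rw [if_neg (by simp [hj]), if_pos rfl]
            · rw [if_pos (by simp [hj]), if_neg (by omega)]
          · refine Finset.prod_congr rfl fun i hi => ?_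
            have hne : (i : ℕ) ≠ k := fun h => (Finset.mem_erase.1 hi).1 (Fin.ext h)
            simp only [hA]
            by_cases hik : (i : ℕ) < k
            · rw [if_pos (by omega), if_pos hik]
            · rw [if_neg (by omega), if_neg hik, if_neg hne]
        rw [h1 _ (.inl rfl), h1 _ (.inr rfl), if_pos rfl, if_neg (by omega), ← mul_sub, ← sub_mul,
          abs_mul, abs_mul, abs_of_nonneg (Q.initial_mem.1 _),
          abs_of_nonneg (a := ∏ i ∈ _, _),
          ← Finset.mul_prod_erase Finset.univ (fun i : Fin m => A i (z i.castSucc) (z i.succ))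
            (Finset.mem_univ j)]
        · simp [hA, hj]
        · refine Finset.prod_nonneg fun i _ => ?_
          simp only [hA]
          split_ifs
          · rw [Q.step_coe]; exact (Q.kernel_mem _ _).1 _
          · exact abs_nonneg _
          · rw [P.step_coe]; exact (P.kernel_mem _ _).1 _
      simp only [tv, h, hybridDist]
      have h2 := pathSum_eq_marginal (m := m) (k := k) (by omega) Q.initial (A := A)
        (fun i hi hki x => by
          simp only [hA, if_neg (by omega : ¬ i < k), if_neg (by omega : ¬ i = k)]
          exact (P.stochastic_step i hi x).2)
      rw [pathSum] at h2
      rw [h2, marginal_congr (B := Q.step) _ fun i hi => by simp [hA, hi], Finset.mul_sum]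
      refine Finset.sum_congr rfl fun x _ => ?_
      simp only [hA, lt_irrefl, if_false, if_true]
      ring

/-- The average of `tv (K k ·) (L k ·)` under the law of the state after `k` steps of the chain
with kernels `L`, started in `x`. -/
noncomputable def meanDist (K L : ℕ → Fin q → Fin q → ℝ) : ℕ → Fin q → ℝ
  | 0, x => tv (K 0 x) (L 0 x)
  | k + 1, x => ∑ y, L 0 x y * meanDist (fun i => K (i + 1)) (fun i => L (i + 1)) k y

theorem sum_marginal_mul_tv (K L : ℕ → Fin q → Fin q → ℝ) (f : Fin q → ℝ) (k : ℕ) :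
    ∑ x, marginal f L k x * tv (K k x) (L k x) = ∑ x, f x * meanDist K L k x := by
  induction k generalizing K L f with
  | zero => rfl
  | succ k ih =>
      rw [marginal_succ', ih (fun i => K (i + 1)) fun i => L (i + 1)]
      simp only [push, meanDist, Finset.sum_mul, Finset.mul_sum, mul_assoc]
      exact Finset.sum_comm

/-- Making the laws of the first part of the trajectory equal at most doubles the distance, and the
next step alone is at most as far apart as the whole remaining trajectory. -/
theorem sum_mul_meanDist_le {m k : ℕ} (hk : k < m) {K L : ℕ → Fin q → Fin q → ℝ}
    (hK : Stochastic m K) (hL : Stochastic m L) {Ω : Type} [Fintype Ω] (e : Ω → Fin q)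
    {α β : Ω → ℝ} (hα : ∀ ω, 0 ≤ α ω) (hβ : ∀ ω, 0 ≤ β ω) (h : ∑ ω, α ω = ∑ ω, β ω) :
    ∑ ω, α ω * meanDist K L k (e ω) ≤
      2 * ∑ ω, (exactRatio m K L (e ω)).gap (α ω) (β ω) := by
  obtain ⟨m, rfl⟩ : ∃ m', m = m' + 1 := ⟨m - 1, by omega⟩
  have hK0 := hK 0 (by omega)
  have hL0 := hL 0 (by omega)
  induction k generalizing m K L Ω with
  | zero =>
      refine le_trans (Finset.sum_le_sum fun ω _ => ?_) (sum_mul_gap_le_left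
        (fun ω => isValid_exactRatio hK hL (e ω)) hα hβ h)
      refine mul_le_mul_of_nonneg_left ?_ (hα ω)
      rw [meanDist, tv_eq_sum_max ((hK0 _).2.trans (hL0 _).2.symm),
        gap_exactRatio_succ hK hL _ _ zero_le_one]
      refine Finset.sum_le_sum fun y _ => ?_
      rw [one_mul, one_mul]
      exact (isValid_exactRatio hK.shift hL.shift y).le_gap ((hK0 _).1 y)
  | succ k ih =>
      obtain ⟨m, rfl⟩ : ∃ m', m = m' + 1 := ⟨m - 1, by omega⟩
      have h1 := ih (Ω := Ω × Fin q) Prod.snd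
        (α := fun z => α z.1 * L 0 (e z.1) z.2) (β := fun z => β z.1 * K 0 (e z.1) z.2)
        (fun z => mul_nonneg (hα _) ((hL0 _).1 _)) (fun z => mul_nonneg (hβ _) ((hK0 _).1 _))
        (by simp only [Fintype.sum_prod_type, ← Finset.mul_sum, (hL0 _).2, (hK0 _).2, mul_one, h])
        m (by omega) hK.shift hL.shift (hK.shift 0 (by omega)) (hL.shift 0 (by omega))
      rw [Fintype.sum_prod_type, Fintype.sum_prod_type] at h1
      rw [Finset.sum_congr rfl fun ω _ => gap_exactRatio_succ hK hL (e ω) (α ω) (hβ ω)]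
      refine le_trans (le_of_eq ?_) h1
      simp only [meanDist, Finset.mul_sum, mul_assoc]

theorem hybridDist_le {m : ℕ} (P Q : Chain m q) {k : ℕ} (hk : k ≤ m) :
    hybridDist P Q k ≤ 2 * tv P.law Q.law := by
  have h0 := tv_nonneg P.law Q.law
  have hv := isValid_exactRatio P.stochastic_step Q.stochastic_step
  have hs : ∑ x, Q.initial x = ∑ x, P.initial x := Q.initial_mem.2.trans P.initial_mem.2.symm
  cases k with
  | zero =>
      have h1 : hybridDist P Q 0 ≤ tv P.law Q.law := by
        rw [hybridDist, tv_eq_sum_max hs.symm, tv_law_eq]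
        exact Finset.sum_le_sum fun x _ => (hv x).le_gap (P.initial_mem.1 x)
      linarith
  | succ k =>
      rw [hybridDist, sum_marginal_mul_tv, tv_law_eq]
      exact sum_mul_meanDist_le (by omega) P.stochastic_step Q.stochastic_step id
        Q.initial_mem.1 P.initial_mem.1 hs

theorem tv_triangle {Ω : Type*} [Fintype Ω] (p p' p'' : Ω → ℝ) :
    tv p p'' ≤ tv p p' + tv p' p'' := by
  rw [tv, tv, tv, ← mul_add, ← Finset.sum_add_distrib]
  exact mul_le_mul_of_nonneg_left (Finset.sum_le_sum fun x _ => abs_sub_le _ _ _) (by norm_num)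

theorem tv_le_sum_hybridDist {m : ℕ} (P Q : Chain m q) :
    tv P.law Q.law ≤ ∑ k ∈ Finset.range (m + 1), hybridDist P Q k := by
  have h : ∀ k ≤ m + 1, tv (hybrid P Q 0).law (hybrid P Q k).law ≤
      ∑ j ∈ Finset.range k, hybridDist P Q j := fun k => by
    induction k with
    | zero => intro _; simp [tv]
    | succ k ih =>
        intro hk
        rw [Finset.sum_range_succ, ← tv_hybrid P Q (by omega : k ≤ m)]
        exact (tv_triangle _ _ _).trans (add_le_add (ih (by omega)) le_rfl)
  have h0 : (hybrid P Q 0).law = P.law := funext fun z => by simp [hybrid_law, P.law_eq]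
  have h1 : (hybrid P Q (m + 1)).law = Q.law := funext fun z => by
    simp [hybrid_law, Q.law_eq]
  have := h (m + 1) le_rfl
  rwa [h0, h1] at this

theorem lowerBound_eq {m : ℕ} (P Q : Chain m q) {b : ℝ} (hb : ∀ k ≤ m, hybridDist P Q k ≤ b)
    (hb' : ∃ k ≤ m, hybridDist P Q k = b) : lowerBound P Q = b / 2 := by
  have h : ⨆ k : Fin (m + 1), tv (hybrid P Q (k : ℕ)).law (hybrid P Q ((k : ℕ) + 1)).law = b := by
    simp only [tv_hybrid P Q (Nat.le_of_lt_succ (Fin.is_lt _))]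
    obtain ⟨k, hk, rfl⟩ := hb'
    refine le_antisymm (ciSup_le fun j => hb j (by omega)) ?_
    exact le_ciSup (f := fun j : Fin (m + 1) => hybridDist P Q j)
      (Set.finite_range _).bddAbove ⟨k, by omega⟩
  rw [lowerBound, h]; ring

theorem exists_lowerBound {m : ℕ} (P Q : Chain m q) : ∃ b, (∀ k ≤ m, hybridDist P Q k ≤ b) ∧
    (∃ k ≤ m, hybridDist P Q k = b) ∧ lowerBound P Q = b / 2 := by
  obtain ⟨k, hk, h⟩ := Finset.exists_max_image (Finset.range (m + 1)) (hybridDist P Q) ⟨0, by simp⟩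
  have h1 : ∀ j ≤ m, hybridDist P Q j ≤ hybridDist P Q k := fun j hj => h j (by simp; omega)
  have h2 : ∃ j ≤ m, hybridDist P Q j = hybridDist P Q k := ⟨k, by simp at hk; omega, rfl⟩
  exact ⟨_, h1, h2, lowerBound_eq P Q h1 h2⟩

theorem lowerBound_le {m : ℕ} (P Q : Chain m q) : lowerBound P Q ≤ tv P.law Q.law := by
  obtain ⟨b, -, ⟨k, hk, rfl⟩, h⟩ := exists_lowerBound P Q
  linarith [hybridDist_le P Q hk]

theorem tv_le_lowerBound {m : ℕ} (P Q : Chain m q) :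
    tv P.law Q.law ≤ 2 * ((m : ℝ) + 1) * lowerBound P Q := by
  obtain ⟨b, hb, -, h⟩ := exists_lowerBound P Q
  have h1 := (tv_le_sum_hybridDist P Q).trans (Finset.sum_le_card_nsmul _ _ b fun k hk =>
    hb k (by simp at hk; omega))
  rw [Finset.card_range, nsmul_eq_mul] at h1
  rw [h]; push_cast at h1; linarith

/-! ### Accuracy of the estimate -/

theorem estimate_eq_sum {m : ℕ} (P Q : Chain m q) {ε : ℝ} (hε : 0 < ε) :
    estimate P Q ε = ∑ x, (sparseRatio (ε / (4 * ((m : ℝ) + 1)))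
      (ε / (2 * ((m : ℝ) + 1)) * lowerBound P Q) m P.step Q.step x).gap
        (Q.initial x) (P.initial x) := by
  rw [estimate, approxRatio_eq, Ratio.tv_eq_gap, gap_concatenate P.initial_mem Q.initial_mem
    (isValid_sparseRatio (by positivity) _ P.stochastic_step Q.stochastic_step) _ zero_le_one]
  simp only [one_mul]

theorem estimate_le {m : ℕ} (P Q : Chain m q) {ε : ℝ} (hε : 0 < ε) :
    estimate P Q ε ≤ tv P.law Q.law := by
  rw [estimate_eq_sum P Q hε, tv_law_eq]
  exact Finset.sum_le_sum fun x _ => gap_sparseRatio_le (by positivity) _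
    P.stochastic_step Q.stochastic_step x _ (P.initial_mem.1 x)

theorem le_estimate {m : ℕ} (P Q : Chain m q) {ε : ℝ} (hε : 0 < ε) :
    (1 - ε) * tv P.law Q.law ≤ estimate P Q ε := by
  set d := lowerBound P Q with hd
  have h1 := lowerBound_le P Q
  have h2 := tv_le_lowerBound P Q
  have h3 := tv_nonneg P.law Q.law
  rcases le_or_gt d 0 with h | h
  · -- the distance is `0`, and the sparsification, for which `δ` is not positive, is irrelevant
    have h4 : tv P.law Q.law = 0 := le_antisymm (h2.trans
      (mul_nonpos_of_nonneg_of_nonpos (by positivity) h)) h3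
    rw [h4, mul_zero, estimate_eq_sum P Q hε]
    exact Finset.sum_nonneg fun x _ => (isValid_sparseRatio (by positivity) _
      P.stochastic_step Q.stochastic_step x).gap_nonneg _ _
  · have h4 := sum_gap_exactRatio_le (ε := ε / (4 * ((m : ℝ) + 1)))
      (δ := ε / (2 * ((m : ℝ) + 1)) * d) (by positivity) (by positivity)
      P.stochastic_step Q.stochastic_step id Q.initial_mem.1 P.initial_mem.1 Q.initial_mem.2
      P.initial_mem.2
    simp only [id] at h4
    rw [← tv_law_eq, hd, ← estimate_eq_sum P Q hε, ← hd] at h4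
    have h5 : (m : ℝ) * (2 * (ε / (4 * ((m : ℝ) + 1))) * tv P.law Q.law +
        ε / (2 * ((m : ℝ) + 1)) * d) =
          (m : ℝ) / ((m : ℝ) + 1) * (ε * ((tv P.law Q.law + d) / 2)) := by
      field_simp; ring
    have h6 : (m : ℝ) / ((m : ℝ) + 1) ≤ 1 := by
      rw [div_le_one (by positivity)]; linarith
    have h7 : ε * ((tv P.law Q.law + d) / 2) ≤ ε * tv P.law Q.law :=
      mul_le_mul_of_nonneg_left (by linarith) hε.le
    have h8 := mul_le_of_le_one_left (by positivity : 0 ≤ ε * ((tv P.law Q.law + d) / 2)) h6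
    linarith

end MarkovTV

/-! ### The program: lower bound for the distance -/

namespace MarkovTV

open Finset RealRAM

/-- Uniqueness of the row and the column of an address. -/
theorem row_inj {q i i' y y' : ℕ} (hy : y < q) (hy' : y' < q) :
    i * q + y = i' * q + y' ↔ i = i' ∧ y = y' := by
  constructor
  · intro h
    have hq : 0 < q := by omega
    have h1 : (i * q + y) / q = (i' * q + y') / q := by rw [h]
    have h2 : ∀ j z, z < q → (j * q + z) / q = j := fun j z hz => by
      rw [add_comm, Nat.add_mul_div_right _ _ hq, Nat.div_eq_of_lt hz, zero_add]
    rw [h2 _ _ hy, h2 _ _ hy'] at h1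
    subst h1
    exact ⟨rfl, by omega⟩
  · rintro ⟨rfl, rfl⟩; rfl

/-- Real register `6` receives the distance of the real registers `4` and `5`. -/
def absDiff : Program :=
  .ite (.rle 4 5) (block [.rsub 6 5 4]) (block [.rsub 6 4 5])

theorem runs_absDiff (s : Memory) : Runs absDiff s 3
    (· = { s with rreg := Function.update s.rreg 6 |s.rreg 4 - s.rreg 5| }) :=
  Runs.ite (fun h => Runs.block (by
      simp only [Test.Holds] at h
      rw [abs_of_nonpos (by linarith), neg_sub]
      rfl) le_rfl)
    fun h => Runs.block (by
      simp only [Test.Holds, not_le] at h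
      rw [abs_of_pos (by linarith)]
      rfl) le_rfl

/-- The marginals of a chain with initial law `f` and kernels `L`, all indexed by natural
numbers. -/
noncomputable def natMarginal (q : ℕ) (f : ℕ → ℝ) (L : ℕ → ℝ) : ℕ → ℕ → ℝ
  | 0 => f
  | k + 1 => fun y => ∑ x ∈ range q, natMarginal q f L k x * L ((k * q + x) * q + y)

/-- Twice the distances of the hybrids, for chains that are given by arrays. -/
noncomputable def natDist (q : ℕ) (f g K L : ℕ → ℝ) : ℕ → ℝ
  | 0 => ∑ x ∈ range q, |f x - g x|
  | k + 1 => ∑ x ∈ range q, ∑ y ∈ range q,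
      |K ((k * q + x) * q + y) - L ((k * q + x) * q + y)| * natMarginal q g L k x

/-- Real register `2` receives the `L¹` distance of the initial laws, and the initial law of `Q` is
copied to row `0` of array `4`. -/
def initialDistProg : Program :=
  forLoop 3 1 (.seq (block [.rload 4 0 3, .rload 5 1 3, .rstore 4 3 5])
    (.seq absDiff (block [.radd 2 2 6])))

theorem runs_initialDistProg {s₀ : Memory} {q : ℕ} (hq : s₀.nreg 1 = q) (h1 : s₀.nreg 2 = 1)
    (hr2 : s₀.rreg 2 = 0) (hA : ∀ j, s₀.rarr 4 j = 0) :
    Runs initialDistProg s₀ (q * 11 + 2) fun s =>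
      s.rreg 2 = ∑ x ∈ range q, |s₀.rarr 0 x - s₀.rarr 1 x| ∧
      ∀ j, s.rarr 4 j = if j < q then s₀.rarr 1 j else 0 := by
  refine Runs.mono (Runs.forLoop (T := 9) (B := q) (Inv := fun k s =>
      s.rreg 2 = ∑ x ∈ range k, |s₀.rarr 0 x - s₀.rarr 1 x| ∧
      ∀ j, s.rarr 4 j = if j < k then s₀.rarr 1 j else 0)
    (by decide) (by decide) rfl rfl rfl hq h1 ?_ ?_) le_rfl fun _ _ h => h.2
  · simp [Memory.setNreg, hr2, hA]
  · rintro k s hk hF hi ⟨hr, hj⟩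
    have e0 := hF.rarr 0 rfl
    have e1 := hF.rarr 1 rfl
    refine (Runs.block_seq (Runs.seq (runs_absDiff _) fun s' _ hs' =>
      (Runs.block (Post := fun s' => _) (T := 2) ?_ le_rfl))).mono le_rfl fun _ _ h => h
    subst hs'
    constructor
    · simp [effect, Instr.apply, Memory.setNreg, hi, e0, e1, hr, Finset.sum_range_succ]
    · intro j
      simp only [effect, Instr.apply, Memory.setNreg]
      simp [hi, e1, Function.update_apply, hj]
      split_ifs <;> first | rfl | omega | (congr; omega)

/-- The contribution of a single pair of states: real register `7` holds the probability of the
first state. -/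
def pairDistProg : Program :=
  .seq (block [.rload 4 2 5, .rload 5 3 5]) (.seq absDiff
    (block [.rmul 6 6 7, .radd 3 3 6, .nadd 8 7 4, .rload 8 4 8, .rmul 6 7 5, .radd 8 8 6,
      .rstore 4 8 8, .nadd 5 5 2]))

/-- The `L¹` distance of the hybrids number `k + 1` and `k + 2` in real register `3`, and the law of
the next state in row `k + 1` of array `4`. -/
def stepDistProg : Program :=
  .seq (block [.nadd 7 7 1, .radd 3 9 9])
    (forLoop 3 1 (.seq (block [.rload 7 4 6, .nadd 6 6 2]) (forLoop 4 1 pairDistProg)))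

theorem runs_pairDistProg (s : Memory) : Runs pairDistProg s 15 fun s' =>
    s'.nreg 5 = s.nreg 5 + s.nreg 2 ∧
    s'.rreg 3 = s.rreg 3 +
      |s.rarr 2 (s.nreg 5) - s.rarr 3 (s.nreg 5)| * s.rreg 7 ∧
    ∀ j, s'.rarr 4 j = s.rarr 4 j +
      if j = s.nreg 7 + s.nreg 4 then s.rreg 7 * s.rarr 3 (s.nreg 5) else 0 := by
  refine (Runs.block_seq (Runs.seq (runs_absDiff _) fun s' _ hs' =>
    (Runs.block (Post := fun s' => _) (T := 9) ?_ le_rfl))).mono le_rfl fun _ _ h => h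
  subst hs'
  refine ⟨by simp [effect, Instr.apply], by simp [effect, Instr.apply], fun j => ?_⟩
  simp only [effect, Instr.apply]
  simp [Function.update_apply]
  split_ifs with h <;> simp [h]

theorem runs_stepDistProg {s₀ : Memory} {q : ℕ} (hq : s₀.nreg 1 = q) (h1 : s₀.nreg 2 = 1)
   (h9 : s₀.rreg 9 = 0) (hle : s₀.nreg 6 = s₀.nreg 7) :
    Runs stepDistProg s₀ (q * (q * 17 + 7) + 5) fun s =>
      s.nreg 5 = s₀.nreg 5 + q * q ∧ s.nreg 6 = s₀.nreg 6 + q ∧ s.nreg 7 = s₀.nreg 7 + q ∧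
      s.rreg 3 = ∑ x ∈ range q, ∑ y ∈ range q,
        |s₀.rarr 2 (s₀.nreg 5 + x * q + y) - s₀.rarr 3 (s₀.nreg 5 + x * q + y)| *
          s₀.rarr 4 (s₀.nreg 6 + x) ∧
      ∀ j, s.rarr 4 j = s₀.rarr 4 j + ∑ x ∈ range q, ∑ y ∈ range q,
        if j = s₀.nreg 7 + q + y then
          s₀.rarr 4 (s₀.nreg 6 + x) * s₀.rarr 3 (s₀.nreg 5 + x * q + y) else 0 := by
  refine (Runs.block_seq (Runs.forLoop (T := q * 17 + 5) (B := q) (Inv := fun k s =>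
      s.nreg 5 = s₀.nreg 5 + k * q ∧ s.nreg 6 = s₀.nreg 6 + k ∧
      s.rreg 3 = ∑ x ∈ range k, ∑ y ∈ range q,
        |s₀.rarr 2 (s₀.nreg 5 + x * q + y) - s₀.rarr 3 (s₀.nreg 5 + x * q + y)| *
          s₀.rarr 4 (s₀.nreg 6 + x) ∧
      ∀ j, s.rarr 4 j = s₀.rarr 4 j + ∑ x ∈ range k, ∑ y ∈ range q,
        if j = s₀.nreg 7 + q + y then
          s₀.rarr 4 (s₀.nreg 6 + x) * s₀.rarr 3 (s₀.nreg 5 + x * q + y) else 0)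
    (by decide) (by decide) rfl rfl rfl (by simp [effect, Instr.apply, hq])
    (by simp [effect, Instr.apply, h1]) ?_ ?_)).mono ?_ ?_
  · simp [effect, Instr.apply, Memory.setNreg, h9]
  · rintro k s hk hF hi ⟨i5, i6, i3, i4⟩
    have e1 : s.nreg 1 = q := (hF.nreg 1 rfl).trans (by simp [effect, Instr.apply, hq])
    have e2 : s.nreg 2 = 1 := (hF.nreg 2 rfl).trans (by simp [effect, Instr.apply, h1])
    have e7 : s.nreg 7 = s₀.nreg 7 + q := (hF.nreg 7 rfl).trans (by simp [effect, Instr.apply, hq])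
    have a2 : s.rarr 2 = s₀.rarr 2 := (hF.rarr 2 rfl).trans (by simp [effect, Instr.apply])
    have a3 : s.rarr 3 = s₀.rarr 3 := (hF.rarr 3 rfl).trans (by simp [effect, Instr.apply])
    -- the row that is read has not been changed
    have hμ : s.rarr 4 (s.nreg 6) = s₀.rarr 4 (s₀.nreg 6 + k) := by
      rw [i6, i4, add_eq_left]
      exact Finset.sum_eq_zero fun x _ => Finset.sum_eq_zero fun y _ => if_neg (by omega)
    refine (Runs.block_seq (Runs.forLoop (T := 15) (B := q) (Inv := fun l s' =>
        s'.nreg 5 = s₀.nreg 5 + k * q + l ∧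
        s'.rreg 3 = s.rreg 3 + ∑ y ∈ range l,
          |s₀.rarr 2 (s₀.nreg 5 + k * q + y) - s₀.rarr 3 (s₀.nreg 5 + k * q + y)| *
            s₀.rarr 4 (s₀.nreg 6 + k) ∧
        ∀ j, s'.rarr 4 j = s.rarr 4 j + ∑ y ∈ range l,
          if j = s₀.nreg 7 + q + y then
            s₀.rarr 4 (s₀.nreg 6 + k) * s₀.rarr 3 (s₀.nreg 5 + k * q + y) else 0)
      (by decide) (by decide) rfl rfl rfl (by simp [effect, Instr.apply, e1])
      (by simp [effect, Instr.apply, e2]) ?_ ?_)).mono ?_ ?_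
    · simp [effect, Instr.apply, Memory.setNreg, i5]
    · rintro l s' hl hF' hi' ⟨j5, j3, j4⟩
      have g2 : s'.nreg 2 = 1 := (hF'.nreg 2 rfl).trans (by simp [effect, Instr.apply, e2])
      have g7 : s'.nreg 7 = s₀.nreg 7 + q :=
        (hF'.nreg 7 rfl).trans (by simp [effect, Instr.apply, e7])
      have b2 : s'.rarr 2 = s₀.rarr 2 := (hF'.rarr 2 rfl).trans (by simp [effect, Instr.apply, a2])
      have b3 : s'.rarr 3 = s₀.rarr 3 := (hF'.rarr 3 rfl).trans (by simp [effect, Instr.apply, a3])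
      have b7 : s'.rreg 7 = s₀.rarr 4 (s₀.nreg 6 + k) :=
        (hF'.rreg 7 rfl).trans (by simp [effect, Instr.apply, hμ])
      refine (runs_pairDistProg s').mono le_rfl ?_
      rintro s'' _ ⟨k5, k3, k4⟩
      refine ⟨by simp [Memory.setNreg, k5, j5, g2, add_assoc], ?_, fun j => ?_⟩
      · simp only [Memory.setNreg]
        rw [k3, j3, b2, b3, b7, j5, Finset.sum_range_succ, add_assoc]
      · simp only [Memory.setNreg]
        rw [k4, j4, b3, b7, j5, g7, hi', Finset.sum_range_succ, add_assoc]
    · simp only [List.length]; omega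
    · rintro s' - ⟨hF', j5, j3, j4⟩
      have g6 : s'.nreg 6 = s.nreg 6 + 1 := by
        rw [hF'.nreg 6 rfl]; simp [effect, Instr.apply, e2]
      refine ⟨?_, ?_, ?_, fun j => ?_⟩
      · simp only [Memory.setNreg]
        simp [j5]; ring
      · simp [Memory.setNreg, g6, i6, add_assoc]
      · simp only [Memory.setNreg]
        rw [j3, i3, Finset.sum_range_succ]
      · simp only [Memory.setNreg]
        rw [j4, i4, Finset.sum_range_succ, add_assoc]
  · simp only [List.length]; ring_nf; omega
  · rintro s - ⟨hF, i5, i6, i3, i4⟩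
    exact ⟨i5, i6, by rw [hF.nreg 7 rfl]; simp [effect, Instr.apply, hq], i3, i4⟩

/-- Real register `2` receives the largest `L¹` distance of two consecutive hybrids. The pointer in
register `5` runs through the tables of the kernels, the pointers in registers `6` and `7` through
the rows of array `4`. -/
def hybridDistProg : Program :=
  .seq initialDistProg (.seq (block [.nsub 10 0 2])
    (forLoop 9 10 (.seq stepDistProg (.ite (.rlt 2 3) (block [.radd 2 3 9]) (block [])))))

theorem runs_hybridDistProg {s₀ : Memory} {m q : ℕ} (hm : s₀.nreg 0 = m + 1) (hq : s₀.nreg 1 = q)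
    (h1 : s₀.nreg 2 = 1) (h5 : s₀.nreg 5 = 0) (h6 : s₀.nreg 6 = 0) (h7 : s₀.nreg 7 = 0)
    (hr2 : s₀.rreg 2 = 0) (h9 : s₀.rreg 9 = 0) (hA : ∀ j, s₀.rarr 4 j = 0) :
    Runs hybridDistProg s₀ (m * (q * (q * 17 + 7) + 10) + q * 11 + 6) fun s =>
      s.nreg 5 = m * (q * q) ∧ s.nreg 10 = m ∧
      (∀ k ≤ m, natDist q (s₀.rarr 0) (s₀.rarr 1) (s₀.rarr 2) (s₀.rarr 3) k ≤ s.rreg 2) ∧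
      ∃ k ≤ m, natDist q (s₀.rarr 0) (s₀.rarr 1) (s₀.rarr 2) (s₀.rarr 3) k = s.rreg 2 := by
  set D := natDist q (s₀.rarr 0) (s₀.rarr 1) (s₀.rarr 2) (s₀.rarr 3) with hD
  set μ := natMarginal q (s₀.rarr 1) (s₀.rarr 3) with hμ
  refine (Runs.seq (runs_initialDistProg hq h1 hr2 hA) (Post := _) fun s₁ hF₁ h =>
    Runs.block_seq ((Runs.forLoop (i := 9) (b := 10) (T := q * (q * 17 + 7) + 8) (B := m)
    (Inv := fun k s =>
      s.nreg 5 = k * (q * q) ∧ s.nreg 6 = k * q ∧ s.nreg 7 = k * q ∧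
      (∀ j ≤ k, D j ≤ s.rreg 2) ∧ (∃ j ≤ k, D j = s.rreg 2) ∧
      (∀ y < q, s.rarr 4 (k * q + y) = μ k y) ∧ ∀ j, (k + 1) * q ≤ j → s.rarr 4 j = 0)
    (by decide) (by decide) rfl rfl rfl ?_ ?_ ?_ ?_).mono le_rfl
    (Post' := fun s => s.nreg 5 = m * (q * q) ∧ s.nreg 10 = m ∧
      (∀ k ≤ m, D k ≤ s.rreg 2) ∧ ∃ k ≤ m, D k = s.rreg 2) ?_)).mono ?_ fun _ _ h => h
  · simp [effect, Instr.apply, hF₁.nreg 0 rfl, hF₁.nreg 2 rfl, hm, h1]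
  · simp [effect, Instr.apply, hF₁.nreg 2 rfl, h1]
  · obtain ⟨hr, ha⟩ := h
    refine ⟨?_, ?_, ?_, ?_, ?_, ?_, ?_⟩
    · simp [effect, Instr.apply, Memory.setNreg, hF₁.nreg 5 rfl, h5]
    · simp [effect, Instr.apply, Memory.setNreg, hF₁.nreg 6 rfl, h6]
    · simp [effect, Instr.apply, Memory.setNreg, hF₁.nreg 7 rfl, h7]
    · intro j hj
      obtain rfl : j = 0 := by omega
      exact hr.ge
    · exact ⟨0, le_rfl, hr.symm⟩
    · intro y hy
      simp only [effect, Instr.apply, Memory.setNreg, ha, zero_mul, zero_add, if_pos hy]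
      rfl
    · intro j hj
      simp only [effect, Instr.apply, Memory.setNreg, ha]
      exact if_neg (by omega)
  · rintro k s hk hF hi ⟨i5, i6, i7, hle, hex, hrow, hzero⟩
    have e1 : s.nreg 1 = q := (hF.nreg 1 rfl).trans (by
      simp [effect, Instr.apply, hF₁.nreg 1 rfl, hq])
    have e2 : s.nreg 2 = 1 := (hF.nreg 2 rfl).trans (by
      simp [effect, Instr.apply, hF₁.nreg 2 rfl, h1])
    have e9 : s.rreg 9 = 0 := (hF.rreg 9 rfl).trans (by
      simp [effect, Instr.apply, hF₁.rreg 9 rfl, h9])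
    have a2 : s.rarr 2 = s₀.rarr 2 := (hF.rarr 2 rfl).trans (by
      simp [effect, Instr.apply, hF₁.rarr 2 rfl])
    have a3 : s.rarr 3 = s₀.rarr 3 := (hF.rarr 3 rfl).trans (by
      simp [effect, Instr.apply, hF₁.rarr 3 rfl])
    refine (Runs.seq (runs_stepDistProg e1 e2 e9 (i6.trans i7.symm)) (T' := 2 + 1)
      fun s' hF' h' => ?_).mono (T := q * (q * 17 + 7) + 5 + (2 + 1)) (by omega) fun _ _ h => h
    obtain ⟨j5, j6, j7, j3, j4⟩ := h'
    have hstep : s'.rreg 3 = D (k + 1) := by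
      rw [j3, hD, natDist]
      refine Finset.sum_congr rfl fun x hx => Finset.sum_congr rfl fun y hy => ?_
      rw [i6, hrow x (Finset.mem_range.1 hx), i5, a2, a3, add_mul, mul_assoc]
    have hr2' : s'.rreg 2 = s.rreg 2 := hF'.rreg 2 rfl
    have hrow' : ∀ y < q, s'.rarr 4 ((k + 1) * q + y) = μ (k + 1) y := fun y hy => by
      rw [j4, hzero _ (by omega), zero_add, hμ, natMarginal]
      refine Finset.sum_congr rfl fun x hx => ?_
      rw [Finset.sum_eq_single y]
      · rw [if_pos (by rw [i7, add_mul, one_mul]), i6, hrow x (Finset.mem_range.1 hx), i5, a3,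
          add_mul, mul_assoc]
      · intro y' _ hne
        exact if_neg (by rw [i7, add_mul, one_mul]; omega)
      · intro h
        exact absurd (Finset.mem_range.2 hy) h
    have hzero' : ∀ j, (k + 1 + 1) * q ≤ j → s'.rarr 4 j = 0 := fun j hj => by
      rw [add_mul, one_mul] at hj
      rw [j4, hzero _ (by omega), zero_add]
      refine Finset.sum_eq_zero fun x _ => Finset.sum_eq_zero fun y hy => if_neg ?_
      rw [Finset.mem_range] at hy
      rw [i7]; rw [add_mul, one_mul] at hj; omega
    have n5 : s'.nreg 5 = (k + 1) * (q * q) := by rw [j5, i5]; ring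
    have n6 : s'.nreg 6 = (k + 1) * q := by rw [j6, i6]; ring
    have n7 : s'.nreg 7 = (k + 1) * q := by rw [j7, i7]; ring
    refine Runs.ite (fun hb => Runs.block ?_ le_rfl) (fun hb => Runs.block ?_ (by decide))
    · simp only [Test.Holds, hstep, hr2'] at hb
      have hnew : (effect [.radd 2 3 9] s').rreg 2 = D (k + 1) := by
        simp [effect, Instr.apply, hstep, hF'.rreg 9 rfl, e9]
      refine ⟨?_, ?_, ?_, ?_, ?_, hrow', hzero'⟩
      · simpa [effect, Instr.apply, Memory.setNreg] using n5
      · simpa [effect, Instr.apply, Memory.setNreg] using n6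
      · simpa [effect, Instr.apply, Memory.setNreg] using n7
      · intro j hj
        refine le_of_le_of_eq ?_ hnew.symm
        rcases (by omega : j ≤ k ∨ j = k + 1) with h | rfl
        exacts [(hle j h).trans hb.le, le_rfl]
      · exact ⟨k + 1, le_rfl, hnew.symm⟩
    · simp only [Test.Holds, hstep, hr2', not_lt] at hb
      refine ⟨?_, ?_, ?_, ?_, ?_, hrow', hzero'⟩
      · simpa [effect, Memory.setNreg] using n5
      · simpa [effect, Memory.setNreg] using n6
      · simpa [effect, Memory.setNreg] using n7
      · intro j hj
        refine le_of_le_of_eq ?_ hr2'.symm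
        rcases (by omega : j ≤ k ∨ j = k + 1) with h | rfl
        exacts [hle j h, hb]
      · obtain ⟨j, hj, h⟩ := hex
        exact ⟨j, by omega, h.trans hr2'.symm⟩
  · rintro s - ⟨hF, i5, -, -, hle, hex, -⟩
    exact ⟨i5, by
      rw [hF.nreg 10 rfl]
      simp [effect, Instr.apply, hF₁.nreg 0 rfl, hF₁.nreg 2 rfl, hm, h1], hle, hex⟩
  · simp only [List.length]; ring_nf; omega

/-! ### The program: parameters, ends of the cells, and initial tables -/

/-- Real registers `1`, `12`, `14`, `15` receive `1`, `ε / (4 n)`, `δ` and `1 + ε / (4 n)`. The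
largest `L¹` distance of consecutive hybrids, in real register `2`, is four times the lower bound
`d`.
Register `11` is used for the constant `4` and then set back to `0`. -/
def paramProg : Program :=
  block [.rcast 1 2, .nadd 11 0 0, .rcast 11 11, .nadd 11 11 11, .rcast 10 11, .rdiv 12 0 10,
    .rdiv 13 0 11, .nconst 11 4, .rcast 10 11, .rdiv 14 2 10, .rmul 14 13 14, .radd 15 1 12,
    .nconst 11 0]

theorem runs_paramProg {s : Memory} {m : ℕ} (hm : s.nreg 0 = m + 1) (h1 : s.nreg 2 = 1) :
    Runs paramProg s 14 fun s' => s'.nreg 11 = 0 ∧ s'.rreg 1 = 1 ∧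
      s'.rreg 14 = s.rreg 0 / (2 * ((m : ℝ) + 1)) * (s.rreg 2 / 4) ∧
      s'.rreg 15 = 1 + s.rreg 0 / (4 * ((m : ℝ) + 1)) := by
  refine Runs.block ⟨?_, ?_, ?_, ?_⟩ le_rfl
  · simp [effect, Instr.apply]
  · simp [effect, Instr.apply, h1]
  · simp [effect, Instr.apply, hm]
    left; congr 1; ring
  · simp [effect, Instr.apply, hm, h1]
    congr 1; ring

/-- Register `11` receives the number of the last lower cell: the number of times that `δ` has to be
multiplied by `1 + ε` until the product reaches `1`. -/
def lastCellProg : Program :=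
  .ite (.rlt 9 14)
    (.seq (block [.radd 4 14 9])
      (.while (.rlt 4 1) (block [.rmul 4 4 15, .nadd 11 11 2])))
    (block [])

theorem lt_lastCell_iff {ε δ : ℝ} (hε : 0 < ε) (hδ : 0 < δ) (j : ℕ) :
    j < lastCell ε δ ↔ δ * (1 + ε) ^ j < 1 := by
  have h1 : 0 < Real.log (1 + ε) := Real.log_pos (by linarith)
  have hpos : 0 < δ * (1 + ε) ^ j := by positivity
  rw [lastCell, Nat.lt_ceil, lt_div_iff₀ h1, ← Real.log_neg_iff hpos,
    Real.log_mul hδ.ne' (by positivity), Real.log_pow]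
  constructor <;> intro h <;> linarith

theorem runs_lastCellProg {s : Memory} {ε δ : ℝ} (hε : 0 < ε) (hδ : 0 ≤ δ) (h1 : s.nreg 2 = 1)
    (h11 : s.nreg 11 = 0) (hr1 : s.rreg 1 = 1) (hr9 : s.rreg 9 = 0) (hr14 : s.rreg 14 = δ)
    (hr15 : s.rreg 15 = 1 + ε) :
    Runs lastCellProg s (lastCell ε δ * 4 + 4) fun s' => s'.nreg 11 = lastCell ε δ := by
  refine (Runs.ite (T := lastCell ε δ * 4 + 3) (fun hb => ?_) fun hb =>
    Runs.block ?_ (by simp)).mono le_rfl fun _ _ h => h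
  · simp only [Test.Holds, hr9, hr14] at hb
    refine (Runs.block_seq ((Runs.whileLoop (b := .rlt 4 1) (T := 3) (k := lastCell ε δ)
      (Inv := fun k s => ∃ j, k + j = lastCell ε δ ∧ s.nreg 11 = j ∧ s.rreg 4 = δ * (1 + ε) ^ j)
      ?_ ?_).mono le_rfl (Post' := fun s' => s'.nreg 11 = lastCell ε δ) ?_)).mono ?_ fun _ _ h => h
    · exact ⟨0, by simp, by simp [effect, Instr.apply, h11],
        by simp [effect, Instr.apply, hr14, hr9]⟩
    · rintro k s' hF ⟨j, hkj, j11, j4⟩ hlt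
      have e1 : s'.rreg 1 = 1 := (hF.rreg 1 rfl).trans (by simp [effect, Instr.apply, hr1])
      have e15 : s'.rreg 15 = 1 + ε := (hF.rreg 15 rfl).trans (by simp [effect, Instr.apply, hr15])
      have e2 : s'.nreg 2 = 1 := (hF.nreg 2 rfl).trans (by simp [effect, Instr.apply, h1])
      simp only [Test.Holds, e1, j4] at hlt
      have := (lt_lastCell_iff hε hb j).2 hlt
      refine ⟨by omega, Runs.block ⟨j + 1, by omega, ?_, ?_⟩ le_rfl⟩
      · simp [effect, Instr.apply, j11, e2]
      · simp [effect, Instr.apply, j4, e15]; ring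
    · rintro s' hF ⟨hn, k, j, hkj, j11, j4⟩
      have e1 : s'.rreg 1 = 1 := (hF.rreg 1 rfl).trans (by simp [effect, Instr.apply, hr1])
      simp only [Test.Holds, e1, j4, ← lt_lastCell_iff hε hb j] at hn
      omega
    · simp only [List.length]; omega
  · -- for `δ = 0` the convention `log 0 = 0` gives `lastCell ε δ = 0`
    simp only [Test.Holds, hr9, hr14] at hb
    have : δ = 0 := by linarith
    simp [effect, h11, this, lastCell]

/-- Register `12` receives the number `N` of cells, register `13` receives `N - 1`, and array `6`
the right ends of the cells. -/
def boundProg : Program :=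
  .seq (block [.nadd 13 11 11, .nadd 13 13 2, .nadd 13 13 2, .nadd 12 13 2, .rstore 6 11 1,
      .nadd 8 11 2, .rstore 6 8 1, .radd 4 1 9])
    (forLoop 3 11 (block [.rmul 4 4 15, .rdiv 5 1 4, .rsub 5 1 5, .rstore 6 3 5, .rdiv 6 1 5,
      .nsub 8 13 3, .nsub 8 8 2, .rstore 6 8 6]))

theorem runs_boundProg {s : Memory} {ε : ℝ} {ℓ : ℕ} (h1 : s.nreg 2 = 1) (h11 : s.nreg 11 = ℓ)
    (hr1 : s.rreg 1 = 1) (hr9 : s.rreg 9 = 0) (hr15 : s.rreg 15 = 1 + ε) :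
    Runs boundProg s (ℓ * 11 + 11) fun s' => s'.nreg 12 = 2 * ℓ + 3 ∧ s'.nreg 13 = 2 * ℓ + 2 ∧
      ∀ c < 2 * ℓ + 2, s'.rarr 6 c = bound ε ℓ c := by
  refine (Runs.block_seq ((Runs.forLoop (T := 9) (B := ℓ) (Inv := fun k s => k ≤ ℓ ∧
      s.rreg 4 = (1 + ε) ^ k ∧ ∀ c < 2 * ℓ + 2,
        c < k ∨ (ℓ ≤ c ∧ c ≤ ℓ + 1) ∨ 2 * ℓ + 2 ≤ c + k → s.rarr 6 c = bound ε ℓ c)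
    (by decide) (by decide) rfl rfl rfl (by simp [effect, Instr.apply, h11])
    (by simp [effect, Instr.apply, h1]) ?_ ?_).mono le_rfl ?_)).mono ?_ fun _ _ h => h
  · refine ⟨Nat.zero_le _, by simp [effect, Instr.apply, Memory.setNreg, hr1, hr9],
      fun c hc h => ?_⟩
    rw [bound_eq_one (by omega) (by omega)]
    simp [effect, Instr.apply, Memory.setNreg, h11, h1, hr1, Function.update_apply]
    omega
  · rintro k s' hk hF hi ⟨-, j4, j6⟩
    have e2 : s'.nreg 2 = 1 := (hF.nreg 2 rfl).trans (by simp [effect, Instr.apply, h1])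
    have e13 : s'.nreg 13 = 2 * ℓ + 2 := (hF.nreg 13 rfl).trans (by
      simp [effect, Instr.apply, h1, h11]; omega)
    have e1 : s'.rreg 1 = 1 := (hF.rreg 1 rfl).trans (by simp [effect, Instr.apply, hr1])
    have e15 : s'.rreg 15 = 1 + ε := (hF.rreg 15 rfl).trans (by simp [effect, Instr.apply, hr15])
    refine Runs.block ⟨hk, ?_, fun c hc h => ?_⟩ le_rfl
    · simp [effect, Instr.apply, Memory.setNreg, j4, e15, pow_succ]
    · simp [effect, Instr.apply, Memory.setNreg, j4, e15, e1, e2, e13, hi, Function.update_apply]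
      split_ifs with h2 h3
      · rw [bound_of_gt (by omega), cutPoint, show 2 * ℓ + 2 - c = k + 1 by omega, pow_succ]
        simp
      · subst h3
        rw [bound_of_lt hk, cutPoint, pow_succ]
        simp
      · exact j6 c hc (by omega)
  · rintro s' - ⟨hF, -, -, h⟩
    refine ⟨?_, ?_, fun c hc => h c hc (by omega)⟩
    · rw [hF.nreg 12 rfl]; simp [effect, Instr.apply, h1, h11]; omega
    · rw [hF.nreg 13 rfl]; simp [effect, Instr.apply, h1, h11]; omega
  · simp only [List.length]; omega

/-- Arrays `7` and `8`, of rows of `N` masses and ratios, receive `q` copies of the constant ratio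
`1`; registers `15` and `16` receive `q N`, and register `17` receives `q * q`. The machine has no
multiplication of natural numbers, so that these products are sums. -/
def initTableProg : Program :=
  .seq (forLoop 3 1 (block [.nadd 8 15 11, .nadd 8 8 2, .rstore 7 8 1, .rstore 8 8 1,
    .nadd 15 15 12, .nadd 17 17 1])) (block [.nadd 16 15 19])

theorem runs_initTableProg {s₀ : Memory} {q ℓ : ℕ} (hq : s₀.nreg 1 = q) (h1 : s₀.nreg 2 = 1)
    (h11 : s₀.nreg 11 = ℓ) (h12 : s₀.nreg 12 = 2 * ℓ + 3) (h15 : s₀.nreg 15 = 0)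
    (h17 : s₀.nreg 17 = 0) (h19 : s₀.nreg 19 = 0) (hr1 : s₀.rreg 1 = 1)
    (h7 : ∀ a, s₀.rarr 7 a = 0) (h8 : ∀ a, s₀.rarr 8 a = 0) :
    Runs initTableProg s₀ (q * 9 + 4) fun s =>
      s.nreg 15 = q * (2 * ℓ + 3) ∧ s.nreg 16 = q * (2 * ℓ + 3) ∧ s.nreg 17 = q * q ∧
      (∀ x < q, ∀ c < 2 * ℓ + 3, s.rarr 7 (x * (2 * ℓ + 3) + c) = (if c = ℓ + 1 then 1 else 0) ∧
        s.rarr 8 (x * (2 * ℓ + 3) + c) = (if c = ℓ + 1 then 1 else 0)) ∧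
      ∀ a, q * (2 * ℓ + 3) ≤ a → s.rarr 7 a = 0 ∧ s.rarr 8 a = 0 := by
  refine (Runs.seq (Runs.forLoop (i := 3) (b := 1) (T := 7) (B := q) (Inv := fun k s =>
      s.nreg 15 = k * (2 * ℓ + 3) ∧ s.nreg 17 = k * q ∧
      (∀ x < k, ∀ c < 2 * ℓ + 3, s.rarr 7 (x * (2 * ℓ + 3) + c) = (if c = ℓ + 1 then 1 else 0) ∧
        s.rarr 8 (x * (2 * ℓ + 3) + c) = (if c = ℓ + 1 then 1 else 0)) ∧
      ∀ a, k * (2 * ℓ + 3) ≤ a → s.rarr 7 a = 0 ∧ s.rarr 8 a = 0)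
    (by decide) (by decide) rfl rfl rfl hq h1 ?_ ?_) fun s hF h => Runs.block (T := 2) ?_ le_rfl).mono
      le_rfl fun _ _ h => h
  · simp [Memory.setNreg, h15, h17, h7, h8]
  · rintro k s hk hF hi ⟨i15, i17, irow, izero⟩
    have e1 := (hF.nreg 1 rfl).trans hq
    have e2 := (hF.nreg 2 rfl).trans h1
    have e11 := (hF.nreg 11 rfl).trans h11
    have e12 := (hF.nreg 12 rfl).trans h12
    have er1 := (hF.rreg 1 rfl).trans hr1
    have hlt : ∀ x < k, ∀ c < 2 * ℓ + 3, x * (2 * ℓ + 3) + c ≠ k * (2 * ℓ + 3) + ℓ + 1 :=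
      fun x hx c hc h => by
        rw [add_assoc, row_inj hc (by omega)] at h
        omega
    refine Runs.block ⟨?_, ?_, ?_, ?_⟩ le_rfl
    · simp [effect, Instr.apply, Memory.setNreg, i15, e12]; ring
    · simp [effect, Instr.apply, Memory.setNreg, i17, e1]; ring
    · intro x hx c hc
      simp only [effect, Instr.apply, Memory.setNreg]
      simp [i15, e11, e2, er1, Function.update_apply]
      rcases (by omega : x < k ∨ x = k) with h | rfl
      · rw [if_neg (hlt x h c hc), if_neg (hlt x h c hc)]
        exact irow x h c hc
      · obtain ⟨g7, g8⟩ := izero (x * (2 * ℓ + 3) + c) (by omega)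
        rw [g7, g8, and_self]
        congr 1
        rw [add_assoc, add_right_inj]
    · intro a ha
      rw [add_mul] at ha
      simp only [effect, Instr.apply, Memory.setNreg]
      simp [i15, e11, e2, er1, Function.update_apply]
      rw [if_neg (by omega), if_neg (by omega)]
      exact izero a (by omega)
  · obtain ⟨hF, i15, i17, irow, izero⟩ := h
    refine ⟨?_, ?_, ?_, irow, izero⟩
    · simp [effect, Instr.apply, i15]
    · simp [effect, Instr.apply, i15, hF.nreg 19 rfl, h19]
    · simp [effect, Instr.apply, i17]

/-! ### The program: sparsified concatenation -/

/-- The ratio distribution `R` is given by `N` atoms with masses `W c` at the ratios `V c`, sorted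
by the ratios if atoms of mass `0` are disregarded. -/
structure Encodes (W V : ℕ → ℝ) (N : ℕ) (R : Ratio) : Prop where
  nonneg : ∀ c < N, 0 ≤ W c
  sorted : ∀ c c', c < c' → c' < N → 0 < W c → 0 < W c' → V c ≤ V c'
  integral_eq : ∀ f, R.integral f = ∑ c ∈ range N, W c * f (V c)

theorem Encodes.congr {W V W' V' : ℕ → ℝ} {N : ℕ} {R : Ratio} (h : Encodes W V N R)
    (hW : ∀ c < N, W' c = W c) (hV : ∀ c < N, V' c = V c) : Encodes W' V' N R where
  nonneg c hc := by rw [hW c hc]; exact h.nonneg c hc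
  sorted c c' hcc' hc' hw hw' := by
    rw [hW c (by omega)] at hw
    rw [hW c' hc'] at hw'
    rw [hV c (by omega), hV c' hc']
    exact h.sorted c c' hcc' hc' hw hw'
  integral_eq f := by
    rw [h.integral_eq]
    exact Finset.sum_congr rfl fun c hc => by
      rw [hW c (Finset.mem_range.1 hc), hV c (Finset.mem_range.1 hc)]

theorem Encodes.single_one {W V : ℕ → ℝ} {N j : ℕ} (hj : j < N)
    (h : ∀ c < N, W c = (if c = j then 1 else 0) ∧ V c = (if c = j then 1 else 0)) :
    Encodes W V N (Finsupp.single 1 1) where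
  nonneg c hc := by rw [(h c hc).1]; split_ifs <;> norm_num
  sorted c c' hcc' hc' hw hw' := by
    have h1 := (h c (by omega)).1
    have h2 := (h c' hc').1
    split_ifs at h1 h2
    · omega
    · linarith
    · linarith
    · linarith
  integral_eq f := by
    rw [Finset.sum_eq_single j, (h j hj).1, (h j hj).2, Ratio.integral_single, if_pos rfl]
    · intro c hc hne
      rw [(h c (Finset.mem_range.1 hc)).1, if_neg hne, zero_mul]
    · intro hn
      exact absurd (Finset.mem_range.2 hj) hn

theorem Ratio.IsValid.cellDagger_le_mul {R : Ratio} (hR : R.IsValid) {ε : ℝ} {k c : ℕ}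
    (hε : 0 < ε) (hc : c < 2 * k + 2) :
    R.cellDagger ε k c ≤ bound ε k c * R.cellMass ε k c := by
  rw [← hR.sum_cellAtoms_weight hε (by omega), ← hR.sum_cellAtoms_weightDagger hε (by omega),
    Finset.mul_sum]
  refine Finset.sum_le_sum fun i hi => ?_
  match i, Finset.mem_filter.1 hi with
  | none, h => exact absurd h.2 (by simp only [cellIndexTop]; omega)
  | some r, h =>
    have h1 : r ≤ bound ε k c := le_bound_of_not_beyond hc ((cellIndex_eq_iff hε).1 h.2).1
    rw [Ratio.weight, Ratio.weightDagger, mul_comm]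
    exact mul_le_mul_of_nonneg_right h1 (hR.nonneg r)

theorem Ratio.IsValid.mul_le_cellDagger {R : Ratio} (hR : R.IsValid) {ε : ℝ} {k c c' : ℕ}
    (hε : 0 < ε) (hc : c < c') (hc' : c' < 2 * k + 3) :
    bound ε k c * R.cellMass ε k c' ≤ R.cellDagger ε k c' := by
  rw [← hR.sum_cellAtoms_weight hε (by omega), ← hR.sum_cellAtoms_weightDagger hε (by omega),
    Finset.mul_sum]
  refine Finset.sum_le_sum fun i hi => ?_
  match i, Finset.mem_filter.1 hi with
  | none, h =>
    rw [Ratio.weight, mul_zero]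
    exact hR.weightDagger_nonneg none h.1
  | some r, h =>
    have h1 : bound ε k c ≤ r := ((lt_cellIndex_iff hε).1 (lt_of_lt_of_eq hc h.2.symm)).bound_le
    rw [Ratio.weight, Ratio.weightDagger, mul_comm]
    exact mul_le_mul_of_nonneg_left h1 (hR.nonneg r)

/-- The atoms of a sparsified ratio are sorted if they are listed in the order of the cells. -/
theorem Ratio.IsValid.encodes_sparsify {R : Ratio} (hR : R.IsValid) {ε δ : ℝ} (hε : 0 < ε)
    {W V : ℕ → ℝ} (hW : ∀ c < 2 * lastCell ε δ + 3, W c = R.cellMass ε (lastCell ε δ) c)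
    (hV : ∀ c < 2 * lastCell ε δ + 3,
      V c = R.cellDagger ε (lastCell ε δ) c / R.cellMass ε (lastCell ε δ) c) :
    Encodes W V (2 * lastCell ε δ + 3) (MarkovTV.sparsify R ε δ) where
  nonneg c hc := by rw [hW c hc]; exact hR.cellMass_nonneg hε hc
  sorted c c' hcc' hc' hw hw' := by
    rw [hW c (by omega)] at hw
    rw [hW c' hc'] at hw'
    rw [hV c (by omega), hV c' hc']
    refine le_trans (b := bound ε (lastCell ε δ) c) ?_ ?_
    · rw [div_le_iff₀ hw]; exact hR.cellDagger_le_mul hε (by omega)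
    · rw [le_div_iff₀ hw']; exact hR.mul_le_cellDagger hε hcc' hc'
  integral_eq f := by
    rw [Ratio.integral_sparsify]
    exact Finset.sum_congr rfl fun c hc => by
      rw [hW c (Finset.mem_range.1 hc), hV c (Finset.mem_range.1 hc)]

/-- Run `p` if the number in real register `8` lies to the right of the cell whose number is in
register `22` and whose right end is in real register `18`, and `p'` otherwise. -/
def cellTest (p p' : Program) : Program :=
  .ite (.nle 22 11) (.ite (.rle 18 8) p p') (.ite (.nlt 22 13) (.ite (.rlt 18 8) p p') p')

theorem Runs.cellTest {p p' : Program} {s : Memory} {T ℓ c : ℕ} {ε r : ℝ} {Post : Memory → Prop}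
    (h11 : s.nreg 11 = ℓ) (h13 : s.nreg 13 = 2 * ℓ + 2) (h22 : s.nreg 22 = c) (h8 : s.rreg 8 = r)
    (h18 : c < 2 * ℓ + 2 → s.rreg 18 = bound ε ℓ c)
    (h : Beyond ε ℓ c r → Runs p s T Post) (h' : ¬ Beyond ε ℓ c r → Runs p' s T Post) :
    Runs (cellTest p p') s (T + 3) Post := by
  have hmono : ∀ {p'' : Program} {T' : ℕ}, T' ≤ T + 2 → Runs p'' s T' Post →
      Runs p'' s (T + 2) Post := fun hT h => h.mono hT fun _ _ h => h
  refine Runs.ite (fun h1 => hmono (by omega) (Runs.ite (fun h2 => h ?_) fun h2 => h' ?_))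
    fun h1 => Runs.ite (fun h2 => Runs.ite (fun h3 => h ?_) fun h3 => h' ?_)
      fun h2 => (h' ?_).mono (by omega) fun _ _ h => h
  · simp only [Test.Holds, h22, h11, h8] at h1 h2
    rwa [beyond_of_le h1, ← h18 (by omega)]
  · simp only [Test.Holds, h22, h11, h8] at h1 h2
    rwa [beyond_of_le h1, ← h18 (by omega)]
  · simp only [Test.Holds, h22, h11, h13, h8] at h1 h2 h3
    rw [beyond_of_gt (by omega), ← h18 h2]
    exact ⟨h2, h3⟩
  · simp only [Test.Holds, h22, h11, h13, h8] at h1 h2 h3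
    rw [beyond_of_gt (by omega), ← h18 h2]
    exact fun h => h3 h.2
  · simp only [Test.Holds, h22, h11, h13] at h1 h2
    exact fun h => h2 h.lt

/-- One round of the sweep: the atom at which the pointer in register `20` points is skipped if
its mass is `0`, and is added to the cell number `c` (in register `22`) if it lies in this cell;
otherwise `c` is increased. Real registers `5` and `6` hold `p' y` and `p y / p' y`, and real
register `16` sums up the mean of the ratio. -/
def sweepBody : Program :=
  .seq (block [.rload 7 7 20])
    (.ite (.rlt 9 7)
      (.seq (block [.rload 8 8 20, .rmul 8 6 8, .rload 18 6 22])
        (cellTest (block [.nadd 22 22 2])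
          (block [.rmul 7 5 7, .nadd 8 15 22, .rload 17 7 8, .radd 17 17 7, .rstore 7 8 17,
            .rmul 7 7 8, .radd 16 16 7, .rload 17 8 8, .radd 17 17 7, .rstore 8 8 17,
            .nadd 20 20 2, .nadd 21 21 2])))
      (block [.nadd 20 20 2, .nadd 21 21 2]))

/-- Add the atoms of one row to the cells that contain them. As the atoms and the cells are both
sorted, the two pointers only move forward, and there are at most `2 N` rounds. -/
def sweepProg : Program := .while (.nlt 21 12) sweepBody

theorem runs_sweepProg {s₀ : Memory} {ε p' ρ : ℝ} {ℓ N src dst : ℕ} {w v : ℕ → ℝ} {R : Ratio}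
    (hε : 0 < ε) (hρ : 0 ≤ ρ) (hN : N = 2 * ℓ + 3) (hwv : Encodes w v N R)
    (h1 : s₀.nreg 2 = 1) (h11 : s₀.nreg 11 = ℓ) (h12 : s₀.nreg 12 = N)
    (h13 : s₀.nreg 13 = 2 * ℓ + 2) (h15 : s₀.nreg 15 = dst) (h20 : s₀.nreg 20 = src)
    (h21 : s₀.nreg 21 = 0) (h22 : s₀.nreg 22 = 0) (hr5 : s₀.rreg 5 = p') (hr6 : s₀.rreg 6 = ρ)
    (hr9 : s₀.rreg 9 = 0) (hB : ∀ c < 2 * ℓ + 2, s₀.rarr 6 c = bound ε ℓ c)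
    (hw : ∀ c < N, s₀.rarr 7 (src + c) = w c) (hv : ∀ c < N, s₀.rarr 8 (src + c) = v c)
    (hle : src + N ≤ dst) :
    Runs sweepProg s₀ (2 * N * 25 + 1) fun s =>
      s.nreg 20 = src + N ∧
      s.rreg 16 = s₀.rreg 16 + ∑ c ∈ range N, p' * w c * (ρ * v c) ∧
      (∀ a, s.rarr 7 a = s₀.rarr 7 a +
        ∑ c ∈ range N, if a = dst + cellIndex ε ℓ (ρ * v c) then p' * w c else 0) ∧
      ∀ a, s.rarr 8 a = s₀.rarr 8 a +
        ∑ c ∈ range N, if a = dst + cellIndex ε ℓ (ρ * v c) then p' * w c * (ρ * v c) else 0 := by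
  refine (Runs.whileLoop (b := .nlt 21 12) (T := 24) (k := 2 * N) (Inv := fun k s => ∃ i c,
      k + i + c = 2 * N ∧ i ≤ N ∧ c < N ∧ s.nreg 21 = i ∧ s.nreg 22 = c ∧ s.nreg 20 = src + i ∧
      (∀ j, i ≤ j → j < N → 0 < w j → c ≤ cellIndex ε ℓ (ρ * v j)) ∧
      s.rreg 16 = s₀.rreg 16 + ∑ c ∈ range i, p' * w c * (ρ * v c) ∧
      (∀ a, s.rarr 7 a = s₀.rarr 7 a +
        ∑ c ∈ range i, if a = dst + cellIndex ε ℓ (ρ * v c) then p' * w c else 0) ∧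
      ∀ a, s.rarr 8 a = s₀.rarr 8 a +
        ∑ c ∈ range i, if a = dst + cellIndex ε ℓ (ρ * v c) then p' * w c * (ρ * v c) else 0)
      ⟨0, 0, by omega, by omega, by omega, h21, h22, h20, by simp, by simp, by simp, by simp⟩
      ?_).mono le_rfl ?_
  · rintro k s hF ⟨i, c, hk, hi, hc, i21, i22, i20, hidx, i16, i7, i8⟩ hb
    have e2 := (hF.nreg 2 rfl).trans h1
    have e11 := (hF.nreg 11 rfl).trans h11
    have e12 := (hF.nreg 12 rfl).trans h12
    have e13 := (hF.nreg 13 rfl).trans h13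
    have e15 := (hF.nreg 15 rfl).trans h15
    have er5 := (hF.rreg 5 rfl).trans hr5
    have er6 := (hF.rreg 6 rfl).trans hr6
    have er9 := (hF.rreg 9 rfl).trans hr9
    have e6 := hF.rarr 6 rfl
    simp only [Test.Holds, i21, e12] at hb
    -- the row that is read has not been changed
    have ew : s.rarr 7 (src + i) = w i := by
      rw [i7, hw i hb, add_eq_left]
      exact Finset.sum_eq_zero fun j _ => if_neg (by omega)
    have ev : s.rarr 8 (src + i) = v i := by
      rw [i8, hv i hb, add_eq_left]
      exact Finset.sum_eq_zero fun j _ => if_neg (by omega)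
    refine ⟨by omega, (Runs.block_seq (Runs.ite (T := 21) (fun hpos => ?_) fun hpos =>
      Runs.block ?_ (by simp))).mono (by simp) fun _ _ h => h⟩
    · have hwi : 0 < w i := by simpa [Test.Holds, effect, Instr.apply, er9, i20, ew] using hpos
      refine (Runs.block_seq (Runs.cellTest (T := 13) (ε := ε) (ℓ := ℓ) (c := c) (r := ρ * v i)
        ?_ ?_ ?_ ?_ ?_ (fun hbey => Runs.block ?_ (by simp))
        fun hbey => Runs.block ?_ (by simp))).mono (by simp) fun _ _ h => h
      · simp [effect, Instr.apply, e11]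
      · simp [effect, Instr.apply, e13]
      · simp [effect, Instr.apply, i22]
      · simp [effect, Instr.apply, er6, i20, ev]
      · intro hc
        simp [effect, Instr.apply, i22, e6, hB c hc]
      · -- all the remaining atoms lie to the right of the cell `c`
        have hlt : ∀ j, i ≤ j → j < N → 0 < w j → c + 1 ≤ cellIndex ε ℓ (ρ * v j) :=
          fun j hij hj hwj => by
            refine ((lt_cellIndex_iff hε).2 hbey).trans_le (cellIndex_mono hε ?_)
            rcases hij.eq_or_lt with rfl | hij
            · exact le_rfl
            · exact mul_le_mul_of_nonneg_left (hwv.sorted i j hij hj hwi hwj) hρ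
        have hcl := hlt i le_rfl hb hwi
        have hcN := cellIndex_lt hε ℓ (ρ * v i)
        refine ⟨i, c + 1, by omega, hi, by omega, ?_, ?_, ?_, hlt, ?_, ?_, ?_⟩
        · simp [effect, Instr.apply, i21]
        · simp [effect, Instr.apply, i22, e2]
        · simp [effect, Instr.apply, i20]
        · simpa [effect, Instr.apply] using i16
        · simpa [effect, Instr.apply] using i7
        · simpa [effect, Instr.apply] using i8
      · have heq : cellIndex ε ℓ (ρ * v i) = c := by
          rw [← lt_cellIndex_iff hε] at hbey
          exact le_antisymm (not_lt.1 hbey) (hidx i le_rfl hb hwi)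
        refine ⟨i + 1, c, by omega, by omega, hc, ?_, ?_, ?_, ?_, ?_, fun a => ?_, fun a => ?_⟩
        · simp [effect, Instr.apply, i21, e2]
        · simp [effect, Instr.apply, i22]
        · simp [effect, Instr.apply, i20, e2, add_assoc]
        · exact fun j hj hjN hwj => hidx j (by omega) hjN hwj
        · simp [effect, Instr.apply, i20, er5, er6, ew, ev, i16, Finset.sum_range_succ, add_assoc]
        · simp only [effect, Instr.apply]
          simp [i20, e15, i22, er5, ew, Function.update_apply, Finset.sum_range_succ, heq]
          split_ifs with ha
          · rw [← ha, i7, add_assoc]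
          · rw [i7, add_zero]
        · simp only [effect, Instr.apply]
          simp [i20, e15, i22, er5, er6, ew, ev, Function.update_apply, Finset.sum_range_succ, heq]
          split_ifs with ha
          · rw [← ha, i8, add_assoc]
          · rw [i8, add_zero]
    · have hwi : w i = 0 := by
        refine le_antisymm ?_ (hwv.nonneg i hb)
        simpa [Test.Holds, effect, Instr.apply, er9, i20, ew] using hpos
      refine ⟨i + 1, c, by omega, by omega, hc, ?_, ?_, ?_, ?_, ?_, fun a => ?_, fun a => ?_⟩
      · simp [effect, Instr.apply, i21, e2]
      · simp [effect, Instr.apply, i22]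
      · simp [effect, Instr.apply, i20, e2, add_assoc]
      · exact fun j hj hjN hwj => hidx j (by omega) hjN hwj
      · simp [effect, Instr.apply, i16, Finset.sum_range_succ, hwi]
      · simp [effect, Instr.apply, i7, Finset.sum_range_succ, hwi]
      · simp [effect, Instr.apply, i8, Finset.sum_range_succ, hwi]
  · rintro s hF ⟨hn, k, i, c, hk, hi, hc, i21, i22, i20, hidx, i16, i7, i8⟩
    simp only [Test.Holds, i21, (hF.nreg 12 rfl).trans h12] at hn
    obtain rfl : i = N := by omega
    exact ⟨i20, i16, i7, i8⟩

/-- Collect the atoms of a concatenation in the cells: `src` (register `14`) is the address of the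
first of `q` rows of atoms, register `18` points to the rows of the kernels, and `dst` (register
`15`) is the address of the row of cells. -/
def collectProg : Program :=
  .seq (block [.nconst 20 0, .nadd 20 20 14, .radd 16 9 9])
    (forLoop 4 1 (.seq (block [.rload 4 2 18, .rload 5 3 18, .nadd 18 18 2, .rdiv 6 4 5,
      .nconst 21 0, .nconst 22 0]) sweepProg))

theorem runs_collectProg {s₀ : Memory} {ε : ℝ} {ℓ N src dst ptr q : ℕ} {R : Fin q → Ratio}
    (hε : 0 < ε) (hN : N = 2 * ℓ + 3) (hq : s₀.nreg 1 = q)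
    (h1 : s₀.nreg 2 = 1) (h11 : s₀.nreg 11 = ℓ) (h12 : s₀.nreg 12 = N)
    (h13 : s₀.nreg 13 = 2 * ℓ + 2) (h14 : s₀.nreg 14 = src) (h15 : s₀.nreg 15 = dst)
    (h18 : s₀.nreg 18 = ptr) (hr9 : s₀.rreg 9 = 0)
    (hB : ∀ c < 2 * ℓ + 2, s₀.rarr 6 c = bound ε ℓ c)
    (hρ : ∀ y < q, 0 ≤ s₀.rarr 2 (ptr + y) / s₀.rarr 3 (ptr + y))
    (hR : ∀ y : Fin q, Encodes (fun c => s₀.rarr 7 (src + y * N + c))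
      (fun c => s₀.rarr 8 (src + y * N + c)) N (R y))
    (hle : src + q * N ≤ dst) :
    Runs collectProg s₀ (q * (2 * N * 25 + 10) + 6) fun s =>
      s.nreg 18 = ptr + q ∧
      s.rreg 16 = ∑ y ∈ range q, ∑ c ∈ range N, s₀.rarr 3 (ptr + y) * s₀.rarr 7 (src + y * N + c) *
        (s₀.rarr 2 (ptr + y) / s₀.rarr 3 (ptr + y) * s₀.rarr 8 (src + y * N + c)) ∧
      (∀ a, s.rarr 7 a = s₀.rarr 7 a + ∑ y ∈ range q, ∑ c ∈ range N,
        if a = dst + cellIndex ε ℓ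
            (s₀.rarr 2 (ptr + y) / s₀.rarr 3 (ptr + y) * s₀.rarr 8 (src + y * N + c)) then
          s₀.rarr 3 (ptr + y) * s₀.rarr 7 (src + y * N + c) else 0) ∧
      ∀ a, s.rarr 8 a = s₀.rarr 8 a + ∑ y ∈ range q, ∑ c ∈ range N,
        if a = dst + cellIndex ε ℓ
            (s₀.rarr 2 (ptr + y) / s₀.rarr 3 (ptr + y) * s₀.rarr 8 (src + y * N + c)) then
          s₀.rarr 3 (ptr + y) * s₀.rarr 7 (src + y * N + c) *
            (s₀.rarr 2 (ptr + y) / s₀.rarr 3 (ptr + y) * s₀.rarr 8 (src + y * N + c)) else 0 := by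
  refine (Runs.block_seq ((Runs.forLoop (i := 4) (b := 1) (T := 2 * N * 25 + 8) (B := q)
    (Inv := fun k s =>
      s.nreg 18 = ptr + k ∧ s.nreg 20 = src + k * N ∧
      s.rreg 16 = ∑ y ∈ range k, ∑ c ∈ range N, s₀.rarr 3 (ptr + y) * s₀.rarr 7 (src + y * N + c) *
        (s₀.rarr 2 (ptr + y) / s₀.rarr 3 (ptr + y) * s₀.rarr 8 (src + y * N + c)) ∧
      (∀ a, s.rarr 7 a = s₀.rarr 7 a + ∑ y ∈ range k, ∑ c ∈ range N,
        if a = dst + cellIndex ε ℓ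
            (s₀.rarr 2 (ptr + y) / s₀.rarr 3 (ptr + y) * s₀.rarr 8 (src + y * N + c)) then
          s₀.rarr 3 (ptr + y) * s₀.rarr 7 (src + y * N + c) else 0) ∧
      ∀ a, s.rarr 8 a = s₀.rarr 8 a + ∑ y ∈ range k, ∑ c ∈ range N,
        if a = dst + cellIndex ε ℓ
            (s₀.rarr 2 (ptr + y) / s₀.rarr 3 (ptr + y) * s₀.rarr 8 (src + y * N + c)) then
          s₀.rarr 3 (ptr + y) * s₀.rarr 7 (src + y * N + c) *
            (s₀.rarr 2 (ptr + y) / s₀.rarr 3 (ptr + y) * s₀.rarr 8 (src + y * N + c)) else 0)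
    (by decide) (by decide) rfl rfl rfl (by simp [effect, Instr.apply, hq])
    (by simp [effect, Instr.apply, h1]) ?_ ?_).mono le_rfl fun s _ h =>
      ⟨h.2.1, h.2.2.2⟩)).mono ?_ fun _ _ h => h
  · simp [effect, Instr.apply, Memory.setNreg, h18, h14, hr9]
  · rintro k s hk hF hi ⟨i18, i20, i16, i7, i8⟩
    have e2 : s.nreg 2 = 1 := (hF.nreg 2 rfl).trans (by simp [effect, Instr.apply, h1])
    have e11 : s.nreg 11 = ℓ := (hF.nreg 11 rfl).trans (by simp [effect, Instr.apply, h11])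
    have e12 : s.nreg 12 = N := (hF.nreg 12 rfl).trans (by simp [effect, Instr.apply, h12])
    have e13 : s.nreg 13 = 2 * ℓ + 2 := (hF.nreg 13 rfl).trans (by simp [effect, Instr.apply, h13])
    have e15 : s.nreg 15 = dst := (hF.nreg 15 rfl).trans (by simp [effect, Instr.apply, h15])
    have er9 : s.rreg 9 = 0 := (hF.rreg 9 rfl).trans (by simp [effect, Instr.apply, hr9])
    have a2 : s.rarr 2 = s₀.rarr 2 := (hF.rarr 2 rfl).trans (by simp [effect, Instr.apply])
    have a3 : s.rarr 3 = s₀.rarr 3 := (hF.rarr 3 rfl).trans (by simp [effect, Instr.apply])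
    have a6 : s.rarr 6 = s₀.rarr 6 := (hF.rarr 6 rfl).trans (by simp [effect, Instr.apply])
    have hkN : k * N + N ≤ q * N := by
      rw [← Nat.succ_mul]; exact Nat.mul_le_mul_right N hk
    refine (Runs.block_seq ((runs_sweepProg hε (hρ k hk) hN (hR ⟨k, hk⟩) (src := src + k * N)
      (p' := s₀.rarr 3 (ptr + k)) (dst := dst) ?_ ?_ ?_ ?_ ?_ ?_ ?_ ?_ ?_ ?_ ?_ ?_ ?_ ?_ ?_).mono
        le_rfl ?_)).mono (by simp only [List.length]; omega) fun _ _ h => h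
    · simp [effect, Instr.apply, e2]
    · simp [effect, Instr.apply, e11]
    · simp [effect, Instr.apply, e12]
    · simp [effect, Instr.apply, e13]
    · simp [effect, Instr.apply, e15]
    · simp [effect, Instr.apply, i20]
    · simp [effect, Instr.apply]
    · simp [effect, Instr.apply]
    · simp [effect, Instr.apply, i18, a3]
    · simp [effect, Instr.apply, i18, a2, a3]
    · simp [effect, Instr.apply, er9]
    · intro c hc
      simp [effect, Instr.apply, a6, hB c hc]
    · intro c hc
      simp only [effect, Instr.apply, i7, add_eq_left]
      exact Finset.sum_eq_zero fun y _ => Finset.sum_eq_zero fun c' _ => if_neg (by omega)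
    · intro c hc
      simp only [effect, Instr.apply, i8, add_eq_left]
      exact Finset.sum_eq_zero fun y _ => Finset.sum_eq_zero fun c' _ => if_neg (by omega)
    · omega
    · rintro s' hF' ⟨j20, j16, j7, j8⟩
      have g18 : s'.nreg 18 = ptr + k + 1 := by
        rw [hF'.nreg 18 rfl]; simp [effect, Instr.apply, i18, e2]
      refine ⟨by simp [Memory.setNreg, g18, add_assoc], ?_, ?_, fun a => ?_, fun a => ?_⟩
      · simp [Memory.setNreg, j20]; ring
      · simp only [Memory.setNreg, j16]
        rw [Finset.sum_range_succ, ← i16]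
        simp [effect, Instr.apply]
      · simp only [Memory.setNreg, j7]
        rw [Finset.sum_range_succ, ← add_assoc, ← i7]
        simp [effect, Instr.apply]
      · simp only [Memory.setNreg, j8]
        rw [Finset.sum_range_succ, ← add_assoc, ← i8]
        simp [effect, Instr.apply]
  · simp only [List.length]; ring_nf; omega

/-- Add the atom of `R†` at `∞` to the last cell, and divide the masses of `R†` by those of `R`. -/
def normalizeProg : Program :=
  .seq (block [.nadd 8 15 13, .rsub 7 1 16, .rload 17 8 8, .radd 17 17 7, .rstore 8 8 17])
    (forLoop 4 12 (block [.nadd 8 15 4, .rload 7 7 8, .rload 17 8 8, .rdiv 17 17 7,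
      .rstore 8 8 17]))

theorem runs_normalizeProg {s₀ : Memory} {N dst : ℕ} (h1 : s₀.nreg 2 = 1)
    (h12 : s₀.nreg 12 = N) (h13 : s₀.nreg 13 + 1 = N) (h15 : s₀.nreg 15 = dst)
    (hr1 : s₀.rreg 1 = 1) :
    Runs normalizeProg s₀ (N * 8 + 8) fun s =>
      (∀ c < N, s.rarr 8 (dst + c) = (s₀.rarr 8 (dst + c) +
        if c + 1 = N then 1 - s₀.rreg 16 else 0) / s₀.rarr 7 (dst + c)) ∧
      ∀ a, a < dst ∨ dst + N ≤ a → s.rarr 8 a = s₀.rarr 8 a := by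
  refine (Runs.block_seq ((Runs.forLoop (i := 4) (b := 12) (T := 6) (B := N) (Inv := fun k s =>
      k ≤ N ∧
      (∀ c < k, s.rarr 8 (dst + c) = (s₀.rarr 8 (dst + c) +
        if c + 1 = N then 1 - s₀.rreg 16 else 0) / s₀.rarr 7 (dst + c)) ∧
      (∀ c < N, k ≤ c → s.rarr 8 (dst + c) = s₀.rarr 8 (dst + c) +
        if c + 1 = N then 1 - s₀.rreg 16 else 0) ∧
      ∀ a, a < dst ∨ dst + N ≤ a → s.rarr 8 a = s₀.rarr 8 a)
    (by decide) (by decide) rfl rfl rfl (by simp [effect, Instr.apply, h12])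
    (by simp [effect, Instr.apply, h1]) ?_ ?_).mono le_rfl fun s _ h =>
      ⟨h.2.2.1, h.2.2.2.2⟩)).mono ?_ fun _ _ h => h
  · refine ⟨Nat.zero_le _, by simp, fun c hc _ => ?_, fun a ha => ?_⟩
    · simp only [effect, Instr.apply, Memory.setNreg]
      simp [h15, hr1, Function.update_apply]
      by_cases h : c = s₀.nreg 13
      · subst h; simp [h13]
      · rw [if_neg h, if_neg (by omega), add_zero]
    · simp only [effect, Instr.apply, Memory.setNreg]
      simp [h15, Function.update_apply]
      intro h; omega
  · rintro k s hk hF hi ⟨-, jlt, jge, jout⟩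
    have e15 : s.nreg 15 = dst := (hF.nreg 15 rfl).trans (by simp [effect, Instr.apply, h15])
    have e7 : s.rarr 7 = s₀.rarr 7 := (hF.rarr 7 rfl).trans (by simp [effect, Instr.apply])
    refine Runs.block ⟨hk, fun c hc => ?_, fun c hc hkc => ?_, fun a ha => ?_⟩ le_rfl
    · simp only [effect, Instr.apply, Memory.setNreg]
      simp [e15, hi, e7, Function.update_apply]
      by_cases h : c = k
      · subst h; simp [jge c hk le_rfl]
      · rw [if_neg h, jlt c (by omega)]
    · simp only [effect, Instr.apply, Memory.setNreg]
      simp [e15, hi, e7, Function.update_apply]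
      rw [if_neg (by omega), jge c hc (by omega)]
    · simp only [effect, Instr.apply, Memory.setNreg]
      simp [e15, hi, e7, Function.update_apply]
      rw [if_neg (by omega), jout a ha]
  · simp only [List.length]; omega

/-- Compute the row of a sparsified concatenation. It is written to cells that still hold `0`, and
register `15` moves on to the next row. -/
def rowProg : Program :=
  .seq collectProg (.seq normalizeProg (block [.nadd 15 15 12]))

theorem runs_rowProg {s₀ : Memory} {ε δ : ℝ} {ℓ N src dst ptr q : ℕ} {p p' : Fin q → ℝ}
    {R : Fin q → Ratio}
    (hε : 0 < ε) (hℓ : ℓ = lastCell ε δ) (hN : N = 2 * ℓ + 3) (hq : s₀.nreg 1 = q)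
    (h1 : s₀.nreg 2 = 1) (h11 : s₀.nreg 11 = ℓ) (h12 : s₀.nreg 12 = N)
    (h13 : s₀.nreg 13 = 2 * ℓ + 2) (h14 : s₀.nreg 14 = src) (h15 : s₀.nreg 15 = dst)
    (h18 : s₀.nreg 18 = ptr) (hr1 : s₀.rreg 1 = 1) (hr9 : s₀.rreg 9 = 0)
    (hB : ∀ c < 2 * ℓ + 2, s₀.rarr 6 c = bound ε ℓ c)
    (hp : p ∈ stdSimplex ℝ (Fin q)) (hp' : p' ∈ stdSimplex ℝ (Fin q))
    (h2 : ∀ y : Fin q, s₀.rarr 2 (ptr + y) = p y) (h3 : ∀ y : Fin q, s₀.rarr 3 (ptr + y) = p' y)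
    (hR : ∀ y : Fin q, Encodes (fun c => s₀.rarr 7 (src + y * N + c))
      (fun c => s₀.rarr 8 (src + y * N + c)) N (R y))
    (hv : ∀ y, (R y).IsValid)
    (hle : src + q * N ≤ dst) (hzero : ∀ a, dst ≤ a → s₀.rarr 7 a = 0 ∧ s₀.rarr 8 a = 0) :
    Runs rowProg s₀ (q * (2 * N * 25 + 10) + N * 8 + 16) fun s =>
      s.nreg 15 = dst + N ∧ s.nreg 18 = ptr + q ∧
      Encodes (fun c => s.rarr 7 (dst + c)) (fun c => s.rarr 8 (dst + c)) N
        (sparsify (concatenate p p' R) ε δ) ∧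
      (∀ a < dst, s.rarr 7 a = s₀.rarr 7 a ∧ s.rarr 8 a = s₀.rarr 8 a) ∧
      ∀ a, dst + N ≤ a → s.rarr 7 a = 0 ∧ s.rarr 8 a = 0 := by
  have hX := isValid_concatenate hp hp' hv
  have hint : ∀ f, (concatenate p p' R).integral f = ∑ y ∈ range q, ∑ c ∈ range N,
      s₀.rarr 3 (ptr + y) * s₀.rarr 7 (src + y * N + c) *
        f (s₀.rarr 2 (ptr + y) / s₀.rarr 3 (ptr + y) * s₀.rarr 8 (src + y * N + c)) := fun f => by
    rw [Ratio.integral_concatenate, Finset.sum_range]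
    refine Finset.sum_congr rfl fun y _ => ?_
    rw [(hR y).integral_eq, Finset.mul_sum]
    exact Finset.sum_congr rfl fun c _ => by rw [h2, h3, mul_assoc]
  have hρ : ∀ y < q, 0 ≤ s₀.rarr 2 (ptr + y) / s₀.rarr 3 (ptr + y) := fun y hy => by
    rw [h2 ⟨y, hy⟩, h3 ⟨y, hy⟩]; exact div_nonneg (hp.1 _) (hp'.1 _)
  refine (Runs.seq (runs_collectProg hε hN hq h1 h11 h12 h13 h14 h15 h18 hr9 hB hρ hR hle)
    (T' := (N * 8 + 8) + 2) fun s₁ hF₁ hs₁ => Runs.seq (runs_normalizeProg (N := N) (dst := dst)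
      ((hF₁.nreg 2 rfl).trans h1) ((hF₁.nreg 12 rfl).trans h12) (by rw [hF₁.nreg 13 rfl]; omega)
      ((hF₁.nreg 15 rfl).trans h15) ((hF₁.rreg 1 rfl).trans hr1)) fun s₂ hF₂ hs₂ =>
        Runs.block ?_ le_rfl).mono (by omega) fun _ _ h => h
  obtain ⟨i18, i16, i7, i8⟩ := hs₁
  obtain ⟨j8, jout⟩ := hs₂
  have e7 := hF₂.rarr 7 rfl
  have hmass : ∀ c < N, s₁.rarr 7 (dst + c) = (concatenate p p' R).cellMass ε ℓ c := fun c hc => by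
    rw [i7, (hzero _ (by omega)).1, zero_add, hX.cellMass_eq hε (by omega), hint]
    simp only [add_right_inj, eq_comm (a := c), mul_ite, mul_one, mul_zero]
  have hdag : ∀ c < N, s₁.rarr 8 (dst + c) + (if c + 1 = N then 1 - s₁.rreg 16 else 0) =
      (concatenate p p' R).cellDagger ε ℓ c := fun c hc => by
    rw [i8, (hzero _ (by omega)).2, zero_add, hX.cellDagger_eq hε (by omega), hint, hint, i16]
    have : c + 1 = N ↔ c = 2 * ℓ + 2 := by omega
    simp only [add_right_inj, eq_comm (a := c), mul_ite, mul_zero, this]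
  refine ⟨?_, ?_, ?_, fun a ha => ?_, fun a ha => ?_⟩
  · simp [effect, Instr.apply, hF₂.nreg 15 rfl, hF₁.nreg 15 rfl, hF₂.nreg 12 rfl, hF₁.nreg 12 rfl,
      h15, h12]
  · simp [effect, Instr.apply, hF₂.nreg 18 rfl, i18]
  · have hN' : N = 2 * lastCell ε δ + 3 := by rw [hN, hℓ]
    rw [hN']
    refine hX.encodes_sparsify hε (fun c hc => ?_) fun c hc => ?_
    · simp only [effect, Instr.apply, e7]
      rw [hmass c (by omega), hℓ]
    · simp only [effect, Instr.apply]
      rw [j8 c (by omega), hdag c (by omega), hmass c (by omega), hℓ]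
  · simp only [effect, Instr.apply, e7]
    rw [jout a (.inl ha), i7, i8]
    constructor <;>
    · rw [add_eq_left]
      exact Finset.sum_eq_zero fun y _ => Finset.sum_eq_zero fun c' _ => if_neg (by omega)
  · simp only [effect, Instr.apply, e7]
    rw [jout a (.inr ha), i7, i8, (hzero a (by omega)).1, (hzero a (by omega)).2, zero_add,
      zero_add]
    constructor <;>
    · refine Finset.sum_eq_zero fun y _ => Finset.sum_eq_zero fun c' _ => if_neg ?_
      have := cellIndex_lt hε ℓ
        (s₀.rarr 2 (ptr + y) / s₀.rarr 3 (ptr + y) * s₀.rarr 8 (src + y * N + c'))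
      omega

/-! ### The program: all steps of the chain, and the output -/

/-- Compute the rows of all states, for one kernel after the other, from the last one to the first
one. Register `5` points to the table of the current kernel; it starts at the end of the last
table, where `hybridDistProg` has left it. Every kernel gets `q` new rows in arrays `7` and `8`, so
that the accumulators need not be cleared. -/
def stagesProg : Program :=
  forLoop 9 10 (.seq (block [.nsub 5 5 17, .nadd 18 5 19])
    (.seq (forLoop 3 1 rowProg) (block [.nadd 14 14 16])))

theorem runs_stagesProg {s₀ : Memory} {ε δ : ℝ} {ℓ N m q : ℕ} {P Q : Chain m q}
    (hε : 0 < ε) (hℓ : ℓ = lastCell ε δ) (hN : N = 2 * ℓ + 3) (hq : s₀.nreg 1 = q)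
    (h1 : s₀.nreg 2 = 1) (h5 : s₀.nreg 5 = m * (q * q)) (h10 : s₀.nreg 10 = m)
    (h11 : s₀.nreg 11 = ℓ) (h12 : s₀.nreg 12 = N)
    (h13 : s₀.nreg 13 = 2 * ℓ + 2) (h14 : s₀.nreg 14 = 0) (h15 : s₀.nreg 15 = q * N)
    (h16 : s₀.nreg 16 = q * N) (h17 : s₀.nreg 17 = q * q) (h19 : s₀.nreg 19 = 0)
    (hr1 : s₀.rreg 1 = 1) (hr9 : s₀.rreg 9 = 0)
    (hB : ∀ c < 2 * ℓ + 2, s₀.rarr 6 c = bound ε ℓ c)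
    (h2 : ∀ i < m, ∀ x y : Fin q, s₀.rarr 2 (i * (q * q) + x * q + y) = P.step i x y)
    (h3 : ∀ i < m, ∀ x y : Fin q, s₀.rarr 3 (i * (q * q) + x * q + y) = Q.step i x y)
    (hR : ∀ y : Fin q, Encodes (fun c => s₀.rarr 7 (y * N + c))
      (fun c => s₀.rarr 8 (y * N + c)) N (Finsupp.single 1 1))
    (hzero : ∀ a, q * N ≤ a → s₀.rarr 7 a = 0 ∧ s₀.rarr 8 a = 0) :
    Runs stagesProg s₀ (m * (q * (q * (2 * N * 25 + 10) + N * 8 + 18) + 9) + 2) fun s =>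
      ∀ y : Fin q, Encodes (fun c => s.rarr 7 (s.nreg 14 + y * N + c))
        (fun c => s.rarr 8 (s.nreg 14 + y * N + c)) N (sparseRatio ε δ m P.step Q.step y) := by
  refine (Runs.forLoop (i := 9) (b := 10) (B := m)
    (T := q * (q * (2 * N * 25 + 10) + N * 8 + 18) + 7) (Inv := fun j s =>
      j ≤ m ∧ s.nreg 5 = (m - j) * (q * q) ∧ s.nreg 14 = j * (q * N) ∧
      s.nreg 15 = (j + 1) * (q * N) ∧
      (∀ y : Fin q, Encodes (fun c => s.rarr 7 (j * (q * N) + y * N + c))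
        (fun c => s.rarr 8 (j * (q * N) + y * N + c)) N
          (sparseRatio ε δ j (fun i => P.step (m - j + i)) (fun i => Q.step (m - j + i)) y)) ∧
      ∀ a, (j + 1) * (q * N) ≤ a → s.rarr 7 a = 0 ∧ s.rarr 8 a = 0)
    (by decide) (by decide) rfl rfl rfl h10 h1 ?_ ?_).mono (by ring_nf; omega) ?_
  · refine ⟨Nat.zero_le _, ?_, ?_, ?_, ?_, ?_⟩
    · simp [Memory.setNreg, h5]
    · simp [Memory.setNreg, h14]
    · simp [Memory.setNreg, h15]
    · simpa [Memory.setNreg, sparseRatio] using hR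
    · simpa [Memory.setNreg] using hzero
  · rintro j s hj hF hi ⟨-, i5, i14, i15, irow, izero⟩
    have e1 := (hF.nreg 1 rfl).trans hq
    have e2 := (hF.nreg 2 rfl).trans h1
    have e11 := (hF.nreg 11 rfl).trans h11
    have e12 := (hF.nreg 12 rfl).trans h12
    have e13 := (hF.nreg 13 rfl).trans h13
    have e16 := (hF.nreg 16 rfl).trans h16
    have e17 := (hF.nreg 17 rfl).trans h17
    have e19 := (hF.nreg 19 rfl).trans h19
    have er1 := (hF.rreg 1 rfl).trans hr1
    have er9 := (hF.rreg 9 rfl).trans hr9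
    have a2 := hF.rarr 2 rfl
    have a3 := hF.rarr 3 rfl
    have a6 := hF.rarr 6 rfl
    set k := m - (j + 1) with hk
    have hkm : k < m := by omega
    have hk1 : m - j = k + 1 := by omega
    set T := sparseRatio ε δ j (fun i => P.step (m - j + i)) (fun i => Q.step (m - j + i)) with hT
    have hKj : Stochastic j fun i => P.step (m - j + i) :=
      fun i hi => P.stochastic_step _ (by omega)
    have hLj : Stochastic j fun i => Q.step (m - j + i) :=
      fun i hi => Q.stochastic_step _ (by omega)
    have hTv := isValid_sparseRatio hε δ hKj hLj
    have hsucc : ∀ x, sparseRatio ε δ (j + 1) (fun i => P.step (k + i)) (fun i => Q.step (k + i)) x =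
        sparsify (concatenate (P.step k x) (Q.step k x) T) ε δ := fun x => by
      have h : ∀ i, m - j + i = k + (i + 1) := fun i => by omega
      simp only [hT, h]
      rfl
    have n5 : (m - j) * (q * q) - q * q = k * (q * q) := by rw [hk1, add_mul, one_mul]; omega
    refine (Runs.block_seq (Runs.seq (T' := 2) (Runs.forLoop (i := 3) (b := 1) (B := q)
      (T := q * (2 * N * 25 + 10) + N * 8 + 16) (Inv := fun x s' =>
        s'.nreg 15 = (j + 1) * (q * N) + x * N ∧ s'.nreg 18 = k * (q * q) + x * q ∧
        (∀ a < (j + 1) * (q * N), s'.rarr 7 a = s.rarr 7 a ∧ s'.rarr 8 a = s.rarr 8 a) ∧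
        (∀ y : Fin q, (y : ℕ) < x → Encodes (fun c => s'.rarr 7 ((j + 1) * (q * N) + y * N + c))
          (fun c => s'.rarr 8 ((j + 1) * (q * N) + y * N + c)) N
            (sparsify (concatenate (P.step k y) (Q.step k y) T) ε δ)) ∧
        ∀ a, (j + 1) * (q * N) + x * N ≤ a → s'.rarr 7 a = 0 ∧ s'.rarr 8 a = 0)
      (by decide) (by decide) rfl rfl rfl ?_ ?_ ?_ ?_) fun s' hF' h' =>
        Runs.block ?_ le_rfl)).mono ?_ fun _ _ h => h
    · simp [effect, Instr.apply, e1]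
    · simp [effect, Instr.apply, e2]
    · refine ⟨?_, ?_, ?_, ?_, ?_⟩
      · simp [effect, Instr.apply, Memory.setNreg, i15]
      · simp [effect, Instr.apply, Memory.setNreg, i5, e17, e19, n5]
      · simp [effect, Instr.apply, Memory.setNreg]
      · simp
      · simpa [effect, Instr.apply, Memory.setNreg] using izero
    · rintro x s' hx hF' hi' ⟨j15, j18, jold, jrow, jzero⟩
      have g1 : s'.nreg 1 = q := (hF'.nreg 1 rfl).trans (by simp [effect, Instr.apply, e1])
      have g2 : s'.nreg 2 = 1 := (hF'.nreg 2 rfl).trans (by simp [effect, Instr.apply, e2])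
      have g11 : s'.nreg 11 = ℓ := (hF'.nreg 11 rfl).trans (by simp [effect, Instr.apply, e11])
      have g12 : s'.nreg 12 = N := (hF'.nreg 12 rfl).trans (by simp [effect, Instr.apply, e12])
      have g13 : s'.nreg 13 = 2 * ℓ + 2 :=
        (hF'.nreg 13 rfl).trans (by simp [effect, Instr.apply, e13])
      have g14 : s'.nreg 14 = j * (q * N) :=
        (hF'.nreg 14 rfl).trans (by simp [effect, Instr.apply, i14])
      have gr1 : s'.rreg 1 = 1 := (hF'.rreg 1 rfl).trans (by simp [effect, Instr.apply, er1])
      have gr9 : s'.rreg 9 = 0 := (hF'.rreg 9 rfl).trans (by simp [effect, Instr.apply, er9])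
      have b2 : s'.rarr 2 = s₀.rarr 2 := (hF'.rarr 2 rfl).trans (by simp [effect, Instr.apply, a2])
      have b3 : s'.rarr 3 = s₀.rarr 3 := (hF'.rarr 3 rfl).trans (by simp [effect, Instr.apply, a3])
      have b6 : s'.rarr 6 = s₀.rarr 6 := (hF'.rarr 6 rfl).trans (by simp [effect, Instr.apply, a6])
      have hold : ∀ y : Fin q, ∀ c < N, j * (q * N) + y * N + c < (j + 1) * (q * N) :=
        fun y c hc => by
          have : (y : ℕ) * N + N ≤ q * N := by
            rw [← Nat.succ_mul]; exact Nat.mul_le_mul_right N y.2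
          rw [add_mul, one_mul]; omega
      refine (runs_rowProg (s₀ := s') hε hℓ hN g1 g2 g11 g12 g13 g14 j15 j18 gr1 gr9
        (p := P.step k ⟨x, hx⟩) (p' := Q.step k ⟨x, hx⟩) (R := T) (fun c hc => by rw [b6, hB c hc])
        (P.stochastic_step k hkm _) (Q.stochastic_step k hkm _)
        (fun y => by rw [b2]; exact h2 k hkm ⟨x, hx⟩ y)
        (fun y => by rw [b3]; exact h3 k hkm ⟨x, hx⟩ y) (fun y => ?_) hTv ?_ jzero).mono le_rfl ?_
      · exact (irow y).congr (fun c hc => (jold _ (hold y c hc)).1)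
          fun c hc => (jold _ (hold y c hc)).2
      · rw [add_mul, one_mul]; omega
      · rintro s'' hF'' ⟨k15, k18, kenc, kold, kzero⟩
        refine ⟨?_, ?_, fun a ha => ?_, fun y hy => ?_, fun a ha => ?_⟩
        · simp [Memory.setNreg, k15]; ring
        · simp [Memory.setNreg, k18]; ring
        · simp only [Memory.setNreg]
          rw [(kold a (by omega)).1, (kold a (by omega)).2]
          exact jold a ha
        · rcases (by omega : (y : ℕ) < x ∨ (y : ℕ) = x) with h | h
          · have hyx : (y : ℕ) * N + N ≤ x * N := by
              rw [← Nat.succ_mul]; exact Nat.mul_le_mul_right N h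
            exact (jrow y h).congr (fun c hc => (kold _ (by omega)).1)
              fun c hc => (kold _ (by omega)).2
          · obtain rfl : y = ⟨x, hx⟩ := Fin.ext h
            exact kenc
        · exact kzero a (by rw [add_mul x, one_mul] at ha; omega)
    · obtain ⟨hF', j15, -, -, jrow, jzero⟩ := h'
      have g5 : s'.nreg 5 = k * (q * q) := by
        rw [hF'.nreg 5 rfl]; simp [effect, Instr.apply, i5, e17, n5]
      have g14 : s'.nreg 14 = j * (q * N) := by
        rw [hF'.nreg 14 rfl]; simp [effect, Instr.apply, i14]
      have g16 : s'.nreg 16 = q * N := by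
        rw [hF'.nreg 16 rfl]; simp [effect, Instr.apply, e16]
      refine ⟨hj, ?_, ?_, ?_, fun y => ?_, fun a ha => ?_⟩
      · simp [effect, Instr.apply, Memory.setNreg, g5]
      · simp [effect, Instr.apply, Memory.setNreg, g14, g16]; ring
      · simp [effect, Instr.apply, Memory.setNreg, j15]; ring
      · rw [hsucc]
        exact jrow y y.2
      · exact jzero a (by rw [add_mul (j + 1) 1, one_mul] at ha; exact ha)
    · simp only [List.length]; ring_nf; omega
  · rintro s - ⟨hF, -, -, i14, -, irow, -⟩ y
    have h := irow y
    simp only [Nat.sub_self, zero_add] at h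
    rw [i14]
    exact h

/-- Real register `0` receives the distance of the concatenation of the initial laws and the rows
that start at the address in register `14`. -/
def outputProg : Program :=
  .seq (block [.nconst 20 0, .nadd 20 20 14, .radd 19 9 9])
    (.seq (forLoop 3 1 (.seq (block [.rload 4 0 3, .rload 5 1 3, .rdiv 6 4 5])
      (forLoop 4 12 (.seq (block [.rload 7 7 20, .rload 8 8 20, .rmul 8 6 8, .rsub 8 1 8,
        .nadd 20 20 2])
        (.ite (.rlt 9 8) (block [.rmul 8 7 8, .rmul 8 5 8, .radd 19 19 8]) (block []))))))
      (block [.radd 0 19 9]))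

theorem runs_outputProg {s₀ : Memory} {N src q : ℕ} {p p' : Fin q → ℝ} {R : Fin q → Ratio}
    (hq : s₀.nreg 1 = q) (h1 : s₀.nreg 2 = 1) (h12 : s₀.nreg 12 = N) (h14 : s₀.nreg 14 = src)
    (hr1 : s₀.rreg 1 = 1) (hr9 : s₀.rreg 9 = 0)
    (h0 : ∀ y : Fin q, s₀.rarr 0 y = p y) (h1' : ∀ y : Fin q, s₀.rarr 1 y = p' y)
    (hR : ∀ y : Fin q, Encodes (fun c => s₀.rarr 7 (src + y * N + c))
      (fun c => s₀.rarr 8 (src + y * N + c)) N (R y)) :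
    Runs outputProg s₀ (q * (N * 13 + 8) + 8) fun s => s.rreg 0 = (concatenate p p' R).tv := by
  have hint : (concatenate p p' R).tv = ∑ y ∈ range q, ∑ c ∈ range N,
      s₀.rarr 1 y * (s₀.rarr 7 (src + y * N + c) *
        max (1 - s₀.rarr 0 y / s₀.rarr 1 y * s₀.rarr 8 (src + y * N + c)) 0) := by
    change Ratio.integral _ (fun r => max (1 - r) 0) = _
    rw [Ratio.integral_concatenate, Finset.sum_range]
    refine Finset.sum_congr rfl fun y _ => ?_
    rw [(hR y).integral_eq, Finset.mul_sum]
    exact Finset.sum_congr rfl fun c _ => by rw [h0, h1']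
  refine (Runs.block_seq (Runs.seq (T' := 2) (Runs.forLoop (i := 3) (b := 1) (B := q)
    (T := N * 13 + 6) (Inv := fun k s => s.nreg 20 = src + k * N ∧
      s.rreg 19 = ∑ y ∈ range k, ∑ c ∈ range N,
        s₀.rarr 1 y * (s₀.rarr 7 (src + y * N + c) *
          max (1 - s₀.rarr 0 y / s₀.rarr 1 y * s₀.rarr 8 (src + y * N + c)) 0))
    (by decide) (by decide) rfl rfl rfl ?_ ?_ ?_ ?_) fun s hF h => Runs.block ?_ le_rfl)).mono ?_
      fun _ _ h => h
  · simp [effect, Instr.apply, hq]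
  · simp [effect, Instr.apply, h1]
  · simp [effect, Instr.apply, Memory.setNreg, h14, hr9]
  · rintro k s hk hF hi ⟨i20, i19⟩
    have e2 : s.nreg 2 = 1 := (hF.nreg 2 rfl).trans (by simp [effect, Instr.apply, h1])
    have e12 : s.nreg 12 = N := (hF.nreg 12 rfl).trans (by simp [effect, Instr.apply, h12])
    have er1 : s.rreg 1 = 1 := (hF.rreg 1 rfl).trans (by simp [effect, Instr.apply, hr1])
    have er9 : s.rreg 9 = 0 := (hF.rreg 9 rfl).trans (by simp [effect, Instr.apply, hr9])
    have a0 : s.rarr 0 = s₀.rarr 0 := (hF.rarr 0 rfl).trans (by simp [effect, Instr.apply])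
    have a1 : s.rarr 1 = s₀.rarr 1 := (hF.rarr 1 rfl).trans (by simp [effect, Instr.apply])
    have a7 : s.rarr 7 = s₀.rarr 7 := (hF.rarr 7 rfl).trans (by simp [effect, Instr.apply])
    have a8 : s.rarr 8 = s₀.rarr 8 := (hF.rarr 8 rfl).trans (by simp [effect, Instr.apply])
    refine (Runs.block_seq ((Runs.forLoop (i := 4) (b := 12) (B := N) (T := 11)
      (Inv := fun l s' => s'.nreg 20 = src + k * N + l ∧
        s'.rreg 19 = s.rreg 19 + ∑ c ∈ range l,
          s₀.rarr 1 k * (s₀.rarr 7 (src + k * N + c) *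
            max (1 - s₀.rarr 0 k / s₀.rarr 1 k * s₀.rarr 8 (src + k * N + c)) 0))
      (by decide) (by decide) rfl rfl rfl ?_ ?_ ?_ ?_).mono le_rfl ?_)).mono ?_ fun _ _ h => h
    · simp [effect, Instr.apply, e12]
    · simp [effect, Instr.apply, e2]
    · simp [effect, Instr.apply, Memory.setNreg, i20]
    · rintro l s' hl hF' hi' ⟨j20, j19⟩
      have g2 : s'.nreg 2 = 1 := (hF'.nreg 2 rfl).trans (by simp [effect, Instr.apply, e2])
      have gr1 : s'.rreg 1 = 1 := (hF'.rreg 1 rfl).trans (by simp [effect, Instr.apply, er1])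
      have gr9 : s'.rreg 9 = 0 := (hF'.rreg 9 rfl).trans (by simp [effect, Instr.apply, er9])
      have g5 : s'.rreg 5 = s₀.rarr 1 k :=
        (hF'.rreg 5 rfl).trans (by simp [effect, Instr.apply, a1, hi])
      have g6 : s'.rreg 6 = s₀.rarr 0 k / s₀.rarr 1 k :=
        (hF'.rreg 6 rfl).trans (by simp [effect, Instr.apply, a0, a1, hi])
      have b7 : s'.rarr 7 = s₀.rarr 7 := (hF'.rarr 7 rfl).trans (by simp [effect, Instr.apply, a7])
      have b8 : s'.rarr 8 = s₀.rarr 8 := (hF'.rarr 8 rfl).trans (by simp [effect, Instr.apply, a8])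
      refine (Runs.block_seq (Runs.ite (T := 4) (fun hb => Runs.block ⟨?_, ?_⟩ le_rfl)
        fun hb => Runs.block ⟨?_, ?_⟩ (by simp))).mono (by simp) fun _ _ h => h
      · simp [effect, Instr.apply, Memory.setNreg, j20, g2, add_assoc]
      · simp [Test.Holds, effect, Instr.apply, gr9, gr1, g6, b8, j20, -sub_pos] at hb
        rw [Finset.sum_range_succ, max_eq_left hb.le, ← add_assoc, ← j19]
        simp [effect, Instr.apply, Memory.setNreg, j20, gr1, g5, g6, b7, b8]
      · simp [effect, Instr.apply, Memory.setNreg, j20, g2, add_assoc]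
      · simp [Test.Holds, effect, Instr.apply, gr9, gr1, g6, b8, j20] at hb
        rw [Finset.sum_range_succ, max_eq_right (sub_nonpos.2 hb), mul_zero, mul_zero,
          ← add_assoc, ← j19]
        simp [effect, Instr.apply, Memory.setNreg]
    · rintro s' - ⟨hF', j20, j19⟩
      refine ⟨?_, ?_⟩
      · simp [Memory.setNreg, j20]; ring
      · simp only [Memory.setNreg]
        rw [j19, i19, Finset.sum_range_succ]
    · simp only [List.length]; omega
  · rw [hint, ← h.2.2]
    simp [effect, Instr.apply, hF.rreg 9 rfl, hr9]
  · simp only [List.length]; ring_nf; omega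

/-! ### The whole program -/

theorem input_vec {q : ℕ} (v : Fin q → ℝ) (x : Fin q) : input.vec v x = v x := by
  rw [input.vec, Finset.sum_eq_single x] <;> simp +contextual [Fin.ext_iff, eq_comm]

theorem input_table {m q : ℕ} (P : Chain m q) {i : ℕ} (hi : i < m) (x y : Fin q) :
    input.table P.kernel ((i * q + x) * q + y) = P.step i x y := by
  have h : ∀ (i' : Fin m) (x' y' : Fin q), (i * q + x) * q + y = ((i' : ℕ) * q + x') * q + y' ↔
      i' = ⟨i, hi⟩ ∧ x' = x ∧ y' = y := fun i' x' y' => by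
    rw [row_inj y.2 y'.2, row_inj x.2 x'.2, Fin.ext_iff, Fin.ext_iff, Fin.ext_iff]
    simp only
    omega
  rw [input.table, Chain.step, dif_pos hi]
  simp only [h]
  rw [Finset.sum_eq_single ⟨i, hi⟩ (fun i' _ hne => by simp [hne]) (by simp),
    Finset.sum_eq_single x (fun x' _ hne => by simp [hne]) (by simp),
    Finset.sum_eq_single y (fun y' _ hne => by simp [hne]) (by simp)]
  simp

theorem natMarginal_eq {m q : ℕ} (Q : Chain m q) {k : ℕ} (hk : k ≤ m) (x : Fin q) :
    natMarginal q (input.vec Q.initial) (input.table Q.kernel) k x =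
      marginal Q.initial Q.step k x := by
  induction k generalizing x with
  | zero => exact input_vec _ _
  | succ k ih =>
      simp only [natMarginal, marginal, push]
      rw [Finset.sum_range]
      exact Finset.sum_congr rfl fun y _ => by rw [ih (by omega), input_table Q (by omega)]

theorem natDist_eq {m q : ℕ} (P Q : Chain m q) {k : ℕ} (hk : k ≤ m) :
    natDist q (input.vec P.initial) (input.vec Q.initial) (input.table P.kernel)
      (input.table Q.kernel) k = 2 * hybridDist P Q k := by
  cases k with
  | zero =>
      rw [natDist, hybridDist, tv, Finset.sum_range]
      simp only [input_vec]
      ring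
  | succ k =>
      rw [natDist, hybridDist, Finset.sum_range, Finset.mul_sum]
      refine Finset.sum_congr rfl fun x _ => ?_
      rw [← Finset.sum_mul, natMarginal_eq Q (by omega), Finset.sum_range, tv]
      simp only [input_table P (by omega : k < m), input_table Q (by omega : k < m)]
      ring

/-- The program that computes the estimate. Its use of the memory:
* registers: `0` the length `n`; `1` the number `q`; `2` the constant `1`; `3`, `4`, `9` loop
  counters; `5` the pointer to the current kernel; `6`, `7` pointers to two consecutive rows of
  marginals; `8` addresses; `10` the number `n - 1` of kernels; `11` the number `ℓ`; `12`, `13` the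
  number `N` of cells and `N - 1`; `14` the first row that is read; `15` the row that is written;
  `16`, `17` the products `q N` and `q²`; `18` the pointer within the current kernel; `19` the
  constant `0`; `20`, `21` the pointer to an atom and its number; `22` the number of a cell;
* real registers: `0` first `ε` and in the end the result; `1` and `9` the constants `1` and `0`;
  `2` the largest `L¹` distance of hybrids; `12`, `14`, `15` the parameters `ε_s`, `δ_s` and `1 + ε_s`; `16`
  the mean of the ratio that is being sparsified; `18` the end of a cell; `19` the sum that becomes
  the result; the others are temporary;
* real arrays: `0`, …, `3` the input; `4` the marginals of `Q`; `6` the ends of the cells; `7` and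
  `8` the masses and the ratios of the atoms. -/
def estimateProg : Program :=
  .seq (block [.nconst 2 1]) (.seq hybridDistProg (.seq paramProg (.seq lastCellProg
    (.seq boundProg (.seq initTableProg (.seq stagesProg outputProg))))))

/-- The running time of the program is `O(n q² (ℓ + 1))`, where the sparsification has `2 ℓ + 3`
cells. -/
theorem runs_estimateProg {m q : ℕ} (P Q : Chain m q) {ε : ℝ} (hε : 0 < ε) (hq0 : 0 < q) :
    Runs estimateProg (input P Q ε) (1000 * ((m + 1) * q * q *
      (lastCell (ε / (4 * ((m : ℝ) + 1))) (ε / (2 * ((m : ℝ) + 1)) * lowerBound P Q) + 1)))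
      fun s => s.rreg 0 = estimate P Q ε := by
  set εs := ε / (4 * ((m : ℝ) + 1)) with hεs
  set δ := ε / (2 * ((m : ℝ) + 1)) * lowerBound P Q with hδ
  set ℓ := lastCell εs δ with hℓ
  have hεs0 : 0 < εs := by positivity
  have hlb : 0 ≤ lowerBound P Q := by
    have h1 := tv_le_lowerBound P Q
    have h2 := tv_nonneg P.law Q.law
    by_contra h
    have : 2 * ((m : ℝ) + 1) * lowerBound P Q < 0 :=
      mul_neg_of_pos_of_neg (by positivity) (not_le.1 h)
    linarith
  have hδ0 : 0 ≤ δ := by positivity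
  refine (Runs.block_seq
    (Runs.seq (T' := 14 + ((ℓ * 4 + 4) + ((ℓ * 11 + 11) + ((q * 9 + 4) +
      ((m * (q * (q * (2 * (2 * ℓ + 3) * 25 + 10) + (2 * ℓ + 3) * 8 + 18) + 9) + 2) +
        (q * ((2 * ℓ + 3) * 13 + 8) + 8))))))
    (runs_hybridDistProg (m := m) (q := q) ?_ ?_ ?_ ?_ ?_ ?_ ?_ ?_ ?_) fun s₁ hF₁ h₁ => ?_)).mono
      ?_ fun _ _ h => h
  · simp [effect, Instr.apply, input]
  · simp [effect, Instr.apply, input]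
  · simp [effect, Instr.apply]
  · simp [effect, Instr.apply, input]
  · simp [effect, Instr.apply, input]
  · simp [effect, Instr.apply, input]
  · simp [effect, Instr.apply, input]
  · simp [effect, Instr.apply, input]
  · simp [effect, Instr.apply, input]
  · obtain ⟨h15, h110, hmax, hex⟩ := h₁
    have hbest : s₁.rreg 2 = 4 * lowerBound P Q := by
      have harr : ∀ k ≤ m, natDist q
          ((effect [.nconst 2 1] (input P Q ε)).rarr 0) ((effect [.nconst 2 1] (input P Q ε)).rarr 1)
          ((effect [.nconst 2 1] (input P Q ε)).rarr 2) ((effect [.nconst 2 1] (input P Q ε)).rarr 3)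
          k = 2 * hybridDist P Q k := fun k hk => by
        rw [← natDist_eq P Q hk]
        simp [effect, Instr.apply, input]
      have := lowerBound_eq P Q (b := s₁.rreg 2 / 2)
        (fun k hk => by
          have := hmax k hk
          rw [harr k hk] at this
          linarith)
        (by
          obtain ⟨k, hk, h⟩ := hex
          rw [harr k hk] at h
          exact ⟨k, hk, by linarith⟩)
      linarith
    refine Runs.seq (runs_paramProg (m := m) ?_ ?_) fun s₂ hF₂ h₂ => ?_
    · simp [hF₁.nreg 0 rfl, effect, Instr.apply, input]
    · simp [hF₁.nreg 2 rfl, effect, Instr.apply]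
    obtain ⟨h211, h21, h214, h215⟩ := h₂
    have hr0 : s₁.rreg 0 = ε := by simp [hF₁.rreg 0 rfl, effect, Instr.apply, input]
    rw [hr0, hbest, mul_div_cancel_left₀ _ (by norm_num), ← hδ] at h214
    rw [hr0, ← hεs] at h215
    have g2 : s₂.nreg 2 = 1 := by simp [hF₂.nreg 2 rfl, hF₁.nreg 2 rfl, effect, Instr.apply]
    have g9 : s₂.rreg 9 = 0 := by simp [hF₂.rreg 9 rfl, hF₁.rreg 9 rfl, effect, Instr.apply, input]
    refine Runs.seq (runs_lastCellProg hεs0 hδ0 g2 h211 h21 g9 h214 h215) fun s₃ hF₃ h311 => ?_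
    refine Runs.seq (runs_boundProg (ε := εs) (ℓ := ℓ) ((hF₃.nreg 2 rfl).trans g2) h311
      ((hF₃.rreg 1 rfl).trans h21) ((hF₃.rreg 9 rfl).trans g9) ((hF₃.rreg 15 rfl).trans h215))
      fun s₄ hF₄ h₄ => ?_
    obtain ⟨h412, h413, h46⟩ := h₄
    have n1 : s₄.nreg 1 = q := by
      simp [hF₄.nreg 1 rfl, hF₃.nreg 1 rfl, hF₂.nreg 1 rfl, hF₁.nreg 1 rfl, effect, Instr.apply,
        input]
    have n2 : s₄.nreg 2 = 1 := by
      simp [hF₄.nreg 2 rfl, hF₃.nreg 2 rfl, g2]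
    have n11 : s₄.nreg 11 = ℓ := (hF₄.nreg 11 rfl).trans h311
    have nz : ∀ r, 3 ≤ r → hybridDistProg.mentions (·.writesNreg r) = false →
        paramProg.mentions (·.writesNreg r) = false →
        lastCellProg.mentions (·.writesNreg r) = false →
        boundProg.mentions (·.writesNreg r) = false → s₄.nreg r = 0 := fun r hr k1 k2 k3 k4 => by
      rw [hF₄.nreg r k4, hF₃.nreg r k3, hF₂.nreg r k2, hF₁.nreg r k1]
      simp only [effect, Instr.apply, input]
      rw [Function.update_of_ne (by omega), if_neg (by omega), if_neg (by omega)]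
    have r1 : s₄.rreg 1 = 1 := by simp [hF₄.rreg 1 rfl, hF₃.rreg 1 rfl, h21]
    have r9 : s₄.rreg 9 = 0 := by simp [hF₄.rreg 9 rfl, hF₃.rreg 9 rfl, g9]
    have arr : ∀ A, hybridDistProg.mentions (·.writesRarr A) = false →
        paramProg.mentions (·.writesRarr A) = false →
        lastCellProg.mentions (·.writesRarr A) = false →
        boundProg.mentions (·.writesRarr A) = false →
        s₄.rarr A = (input P Q ε).rarr A := fun A k1 k2 k3 k4 => by
      rw [hF₄.rarr A k4, hF₃.rarr A k3, hF₂.rarr A k2, hF₁.rarr A k1]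
      rfl
    refine Runs.seq (runs_initTableProg (q := q) (ℓ := ℓ) n1 n2 n11 h412
      (nz 15 (by omega) rfl rfl rfl rfl) (nz 17 (by omega) rfl rfl rfl rfl)
      (nz 19 (by omega) rfl rfl rfl rfl) r1 (fun a => by rw [arr 7 rfl rfl rfl rfl]; simp [input])
      (fun a => by rw [arr 8 rfl rfl rfl rfl]; simp [input])) fun s₅ hF₅ h₅ => ?_
    obtain ⟨h515, h516, h517, hrow, hzero⟩ := h₅
    refine Runs.seq (runs_stagesProg (s₀ := s₅) (P := P) (Q := Q) (δ := δ) hεs0 hℓ rfl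
      ((hF₅.nreg 1 rfl).trans n1) ((hF₅.nreg 2 rfl).trans n2) ?_ ?_
      ((hF₅.nreg 11 rfl).trans n11) ((hF₅.nreg 12 rfl).trans h412) ((hF₅.nreg 13 rfl).trans h413)
      ((hF₅.nreg 14 rfl).trans (nz 14 (by omega) rfl rfl rfl rfl)) h515 h516 h517
      ((hF₅.nreg 19 rfl).trans (nz 19 (by omega) rfl rfl rfl rfl)) ((hF₅.rreg 1 rfl).trans r1)
      ((hF₅.rreg 9 rfl).trans r9) (fun c hc => by rw [hF₅.rarr 6 rfl]; exact h46 c hc) ?_ ?_ ?_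
      hzero) fun s₆ hF₆ h₆ => ?_
    · rw [hF₅.nreg 5 rfl, hF₄.nreg 5 rfl, hF₃.nreg 5 rfl, hF₂.nreg 5 rfl, h15]
    · rw [hF₅.nreg 10 rfl, hF₄.nreg 10 rfl, hF₃.nreg 10 rfl, hF₂.nreg 10 rfl, h110]
    · intro i hi x y
      rw [hF₅.rarr 2 rfl, arr 2 rfl rfl rfl rfl, ← input_table P hi, add_mul, mul_assoc]
      simp [input]
    · intro i hi x y
      rw [hF₅.rarr 3 rfl, arr 3 rfl rfl rfl rfl, ← input_table Q hi, add_mul, mul_assoc]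
      simp [input]
    · exact fun y => Encodes.single_one (j := ℓ + 1) (by omega) (hrow y y.2)
    · refine (runs_outputProg (p := P.initial) (p' := Q.initial)
        ((hF₆.nreg 1 rfl).trans ((hF₅.nreg 1 rfl).trans n1))
        ((hF₆.nreg 2 rfl).trans ((hF₅.nreg 2 rfl).trans n2))
        ((hF₆.nreg 12 rfl).trans ((hF₅.nreg 12 rfl).trans h412)) rfl
        ((hF₆.rreg 1 rfl).trans ((hF₅.rreg 1 rfl).trans r1))
        ((hF₆.rreg 9 rfl).trans ((hF₅.rreg 9 rfl).trans r9)) (fun y => ?_) (fun y => ?_) h₆).mono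
          le_rfl fun s _ h => ?_
      · rw [hF₆.rarr 0 rfl, hF₅.rarr 0 rfl, arr 0 rfl rfl rfl rfl, ← input_vec P.initial]
        simp [input]
      · rw [hF₆.rarr 1 rfl, hF₅.rarr 1 rfl, arr 1 rfl rfl rfl rfl, ← input_vec Q.initial]
        simp [input]
      · rw [h, estimate, approxRatio_eq]
  · -- every monomial of the bound is at most `(m + 1) q² (ℓ + 1)`
    have hX : ∀ a b c e, a ≤ m + 1 → b ≤ q → c ≤ q → e ≤ ℓ + 1 →
        a * b * c * e ≤ (m + 1) * q * q * (ℓ + 1) := fun a b c e ha hb hc he => by gcongr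
    have k1 := hX m q q ℓ (by omega) le_rfl le_rfl (by omega)
    have k2 := hX m q q 1 (by omega) le_rfl le_rfl (by omega)
    have k3 := hX m q 1 ℓ (by omega) le_rfl hq0 (by omega)
    have k4 := hX m q 1 1 (by omega) le_rfl hq0 (by omega)
    have k5 := hX m 1 1 1 (by omega) hq0 hq0 (by omega)
    have k6 := hX 1 q 1 ℓ (by omega) le_rfl hq0 (by omega)
    have k7 := hX 1 q 1 1 (by omega) le_rfl hq0 (by omega)
    have k8 := hX 1 1 1 ℓ (by omega) hq0 hq0 (by omega)
    have k9 := hX 1 1 1 1 (by omega) hq0 hq0 (by omega)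
    generalize (m + 1) * q * q * (ℓ + 1) = X at *
    simp only [List.length]
    linarith

/-! ### The running time -/

theorem tv_law_le_one {m q : ℕ} (P Q : Chain m q) : tv P.law Q.law ≤ 1 := by
  rw [tv_eq_sum_max (P.sum_law.trans Q.sum_law.symm), ← Q.sum_law]
  exact Finset.sum_le_sum fun z _ => max_le (by linarith [P.law_nonneg z]) (Q.law_nonneg z)

theorem two_le_of_tv_pos {m q : ℕ} {P Q : Chain m q} (h : 0 < tv P.law Q.law) : 2 ≤ q := by
  by_contra hq
  have : Subsingleton (Fin q) := Fin.subsingleton_iff_le_one.2 (by omega)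
  have hPQ : P.law = Q.law := funext fun z => by
    rw [← Fintype.sum_subsingleton P.law z, ← Fintype.sum_subsingleton Q.law z, P.sum_law,
      Q.sum_law]
  simp [hPQ, tv] at h

/-- The number of cells, for `n` steps of the chain and a lower bound `d` of the distance `D` that
is exact up to the factor `2 n`. -/
theorem lastCell_le {n ε d D : ℝ} (hn : 1 ≤ n) (hε : 0 < ε) (hD : 0 < D) (hD1 : D ≤ 1)
    (hd : D ≤ 2 * n * d) :
    (lastCell (ε / (4 * n)) (ε / (2 * n) * d) : ℝ) + 1 ≤
      40 * (n / min ε 1 * Real.log (max 2 (n / (ε * D)))) := by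
  have hn0 : 0 < n := by linarith
  have hd0 : 0 < d := by
    by_contra h
    have := mul_nonpos_of_nonneg_of_nonpos (by positivity : 0 ≤ 2 * n) (not_lt.1 h)
    linarith
  set u := n / (ε * D) with hu
  have hu0 : 0 < u := by positivity
  set M := max 2 u with hM
  have hM2 : 2 ≤ M := le_max_left _ _
  have huM : u ≤ M := le_max_right _ _
  set L := Real.log M with hL
  have hL2 : 1 / 2 ≤ L := by
    have h1 := Real.log_two_gt_d9
    have h2 : Real.log 2 ≤ L := Real.log_le_log (by norm_num) hM2
    linarith
  set Λ := Real.log (4 * n * u) with hΛ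
  have hδ : -Real.log (ε / (2 * n) * d) ≤ Λ := by
    rw [← Real.log_inv]
    refine Real.log_le_log (by positivity) ?_
    rw [hu, inv_le_iff_one_le_mul₀ (by positivity)]
    rw [show 4 * n * (n / (ε * D)) * (ε / (2 * n) * d) = 2 * n * d / D by field_simp; ring,
      le_div_iff₀ hD, one_mul]
    exact hd
  have hlog : (1 + 4 * n / ε)⁻¹ ≤ Real.log (1 + ε / (4 * n)) := by
    refine le_trans (le_of_eq ?_) (Real.one_sub_inv_le_log_of_pos (by positivity))
    field_simp
    ring
  have hlog0 : 0 < Real.log (1 + ε / (4 * n)) := lt_of_lt_of_le (by positivity) hlog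
  have hΛ0 : 0 ≤ max Λ 0 := le_max_right _ _
  -- `Λ` may be negative if `ε` is large; then there is a single lower cell
  have hcell : (lastCell (ε / (4 * n)) (ε / (2 * n) * d) : ℝ) ≤
      max Λ 0 * (1 + 4 * n / ε) + 1 := by
    have h1 : -Real.log (ε / (2 * n) * d) / Real.log (1 + ε / (4 * n)) ≤
        max Λ 0 * (1 + 4 * n / ε) := by
      rw [div_le_iff₀ hlog0]
      refine (hδ.trans (le_max_left Λ 0)).trans ?_
      rw [mul_assoc]
      refine le_mul_of_one_le_right hΛ0 ?_
      calc (1 : ℝ) = (1 + 4 * n / ε) * (1 + 4 * n / ε)⁻¹ := (mul_inv_cancel₀ (by positivity)).symm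
        _ ≤ _ := mul_le_mul_of_nonneg_left hlog (by positivity)
    have h2 := Nat.ceil_lt_add_one (by positivity : 0 ≤ max Λ 0 * (1 + 4 * n / ε))
    have h3 : (lastCell (ε / (4 * n)) (ε / (2 * n) * d) : ℝ) ≤
        (⌈max Λ 0 * (1 + 4 * n / ε)⌉₊ : ℝ) := by
      exact_mod_cast Nat.ceil_mono h1
    linarith
  have hnL : 1 / 2 ≤ n * L := by nlinarith
  have hM4 : Real.log (M ^ 4) = 4 * L := by rw [Real.log_pow]; push_cast; ring
  have h4M : 4 * M ^ 2 ≤ M ^ 4 := by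
    have : 4 ≤ M ^ 2 := by nlinarith
    nlinarith [sq_nonneg M]
  rcases le_or_gt ε 1 with h | h
  · rw [min_eq_left h]
    have hnu : n ≤ u := by
      rw [hu, le_div_iff₀ (by positivity)]
      exact mul_le_of_le_one_right hn0.le (mul_le_one₀ h hD.le hD1)
    have h1 : Λ ≤ 4 * L := by
      rw [hΛ, ← hM4]
      refine Real.log_le_log (by positivity) (le_trans ?_ h4M)
      nlinarith
    have h2 : max Λ 0 ≤ 4 * L := max_le h1 (by linarith)
    have h3 : 1 + 4 * n / ε ≤ 5 * (n / ε) := by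
      have : 1 ≤ n / ε := by rw [le_div_iff₀ hε]; linarith
      rw [mul_div_assoc]; linarith
    have h4 : max Λ 0 * (1 + 4 * n / ε) ≤ 4 * L * (5 * (n / ε)) :=
      mul_le_mul h2 h3 (by positivity) (by linarith)
    have h5 : 1 / 2 ≤ n / ε * L := by
      refine hnL.trans (mul_le_mul_of_nonneg_right ?_ (by linarith))
      rw [le_div_iff₀ hε]; nlinarith
    linarith
  · -- for large `ε`, the factor `1 / ε` compensates for the growth of the logarithm with `ε`
    rw [min_eq_right h.le, div_one]
    have h1 : max Λ 0 ≤ 9 * (n * L) := by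
      refine max_le ?_ (by linarith)
      have : Λ ≤ Real.log (4 * n) + L := by
        rw [hΛ, hL, ← Real.log_mul (by positivity) (by positivity)]
        exact Real.log_le_log (by positivity) (mul_le_mul_of_nonneg_left huM (by positivity))
      have h2 := Real.log_le_self (by positivity : 0 ≤ 4 * n)
      nlinarith
    have h2 : max Λ 0 * (4 * n / ε) ≤ 24 * (n * L) := by
      have h3 : max Λ 0 ≤ 4 * L + ε := by
        refine max_le ?_ (by linarith)
        have h4 : Λ ≤ Real.log (M ^ 4 * ε) := by
          refine Real.log_le_log (by positivity) ?_
          have h5 : n ≤ M * ε := by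
            have : n = u * (ε * D) := by rw [hu]; field_simp
            calc n = u * ε * D := by rw [mul_assoc, ← this]
              _ ≤ M * ε * 1 := by gcongr
              _ = M * ε := mul_one _
          calc 4 * n * u ≤ 4 * (M * ε) * M := by gcongr
            _ = 4 * M ^ 2 * ε := by ring
            _ ≤ M ^ 4 * ε := by gcongr
        rw [Real.log_mul (by positivity) (by positivity), hM4] at h4
        linarith [Real.log_le_self hε.le]
      have h4 : max Λ 0 / ε ≤ 6 * L := by
        rw [div_le_iff₀ hε]
        nlinarith
      calc max Λ 0 * (4 * n / ε) = max Λ 0 / ε * (4 * n) := by ring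
        _ ≤ 6 * L * (4 * n) := by gcongr
        _ = 24 * (n * L) := by ring
    nlinarith

end MarkovTV

theorem mainTheorem2 :
    ∃ (prog : RealRAM.Program) (C : ℝ), 0 < C ∧
      ∀ (m q : ℕ) (P Q : MarkovTV.Chain m q) (ε : ℝ), 0 < ε →
        ∃ (s : RealRAM.Memory) (t : ℕ),
          RealRAM.Exec prog (MarkovTV.input P Q ε) s t ∧
          s.rreg 0 = MarkovTV.estimate P Q ε ∧
          (1 - ε) * MarkovTV.tv P.law Q.law ≤ s.rreg 0 ∧
          s.rreg 0 ≤ MarkovTV.tv P.law Q.law ∧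
          (0 < MarkovTV.tv P.law Q.law →
            (t : ℝ) ≤ C * (((q : ℝ) ^ 2 * ((m : ℝ) + 1) ^ 2 / min ε 1) * Real.log q *
              Real.log (max 2 (((m : ℝ) + 1) / (ε * MarkovTV.tv P.law Q.law))))) := by
  refine ⟨MarkovTV.estimateProg, 80000, by norm_num, fun m q P Q ε hε => ?_⟩
  have hq0 : 0 < q := by
    -- there is no probability distribution on the empty set
    rcases q.eq_zero_or_pos with rfl | h
    · have := P.initial_mem.2
      simp at this
    · exact h
  obtain ⟨s, t, he, ht, hs⟩ := MarkovTV.runs_estimateProg P Q hε hq0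
  refine ⟨s, t, he, hs, hs ▸ MarkovTV.le_estimate P Q hε, hs ▸ MarkovTV.estimate_le P Q hε,
    fun hpos => ?_⟩
  have hq2 : (2 : ℝ) ≤ q := by exact_mod_cast MarkovTV.two_le_of_tv_pos hpos
  have hlogq : 1 / 2 ≤ Real.log q := by
    have h1 := Real.log_two_gt_d9
    have h2 : Real.log 2 ≤ Real.log q := Real.log_le_log (by norm_num) hq2
    linarith
  have hm1 : (1 : ℝ) ≤ (m : ℝ) + 1 := by linarith [(Nat.cast_nonneg m : (0 : ℝ) ≤ m)]
  have hℓ := MarkovTV.lastCell_le hm1 hε hpos (MarkovTV.tv_law_le_one P Q)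
    (MarkovTV.tv_le_lowerBound P Q)
  set ℓ := MarkovTV.lastCell (ε / (4 * ((m : ℝ) + 1)))
    (ε / (2 * ((m : ℝ) + 1)) * MarkovTV.lowerBound P Q)
  set L := Real.log (max 2 (((m : ℝ) + 1) / (ε * MarkovTV.tv P.law Q.law)))
  have hmin : 0 < min ε 1 := lt_min hε one_pos
  have hL : 0 ≤ L := Real.log_nonneg (le_trans (by norm_num) (le_max_left _ _))
  have ht' : (t : ℝ) ≤ 1000 * (((m : ℝ) + 1) * q * q * ((ℓ : ℝ) + 1)) := by exact_mod_cast ht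
  -- `80000` is `1000 * 40`, from the step count and the number of cells, divided by `1 / 2 ≤ log q`
  calc (t : ℝ) ≤ 1000 * (((m : ℝ) + 1) * q * q * ((ℓ : ℝ) + 1)) := ht'
    _ ≤ 1000 * (((m : ℝ) + 1) * q * q * (40 * (((m : ℝ) + 1) / min ε 1 * L))) := by gcongr
    _ = 80000 * (((q : ℝ) ^ 2 * ((m : ℝ) + 1) ^ 2 / min ε 1) * (1 / 2) * L) := by ring
    _ ≤ _ := by gcongr
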